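/- Let $k$ be an algebraically closed field of characteristic zero (for instance $k=\mathbb C$), and let $A$ and $B$ be cosemisimple Hopf algebras over $k$. Let $A*B$ be their free product (the coproduct of unital $k$-algebras, with the Hopf algebra structure extending those of $A$ and $B$), so that $A$ and $B$ are Hopf subalgebras of $A*B$. For a Hopf algebra $H$, let $\mathcal{YD}_H^H$ be the abelian category of right-right Yetter–Drinfeld modules over $H$, i.e. right $H$-modules and right $H$-comodules $V$ such that $$(v\cdot a)_{(0)}\otimes (v\cdot a)_{(1)} = v_{(0)}\cdot a_{(2)}\otimes S(a_{(1)})v_{(1)}a_{(3)}\qquad (v\in V,\ a\in H),$$ with the $H$-linear and $H$-colinear maps as morphisms, and define Gerstenhaber–Schack cohomology by $$H^n_{\rm GS}(H,V)=\operatorname{Ext}^n_{\mathcal{YD}_H^H}(k,V),$$ where $k$ is the trivial Yetter–Drinfeld module. For a Hopf subalgebra $L\subset H$ and $V\in\mathcal{YD}_H^H$, let $$V^{(L)}=\{v\in V \mid v_{(0)}\otimes v_{(1)}\in V\otimes L\},$$ which is a Yetter–Drinfeld module over $L$ with the induced action and coaction; this defines the restriction functor $\mathcal{YD}_H^H\to\mathcal{YD}_L^L$.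 Then for every $n\ge 2$ and every Yetter–Drinfeld module $M$ over $A*B$ there is a $k$-linear isomorphism, natural in $M$, $$H^n_{\rm GS}(A*B,M)\simeq H^n_{\rm GS}(A,M^{(A)})\oplus H^n_{\rm GS}(B,M^{(B)}).$$ -/

import Mathlib

open TensorProduct CategoryTheory CategoryTheory.Limits

universe u

noncomputable section

/-! ### Free products of Hopf algebras -/

/-- The two-element family of types `A`, `B`. -/
def pairFam (A B : Type u) : Bool → Type u
  | true => A
  | false => B

instance pairFamRing (A B : Type u) [Ring A] [Ring B] : ∀ i, Ring (pairFam A B i)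
  | true => inferInstanceAs (Ring A)
  | false => inferInstanceAs (Ring B)

instance pairFamAlgebra (k A B : Type u) [Field k] [Ring A] [Ring B] [Algebra k A] [Algebra k B] :
    ∀ i, Algebra k (pairFam A B i)
  | true => inferInstanceAs (Algebra k A)
  | false => inferInstanceAs (Algebra k B)

/-- The free product (coproduct of unital algebras) `A * B` over `k`. -/
def FreeProd (k A B : Type u) [Field k] [Ring A] [Ring B] [Algebra k A] [Algebra k B] : Type u :=
  LinearAlgebra.FreeProduct k (pairFam A B)

namespace FreeProd

section Alg

variable (k A B : Type u) [Field k] [Ring A] [Ring B] [Algebra k A] [Algebra k B]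

instance : Ring (FreeProd k A B) :=
  inferInstanceAs (Ring (LinearAlgebra.FreeProduct.ringCon k (pairFam A B)).Quotient)

instance : Algebra k (FreeProd k A B) :=
  inferInstanceAs (Algebra k (LinearAlgebra.FreeProduct.ringCon k (pairFam A B)).Quotient)

/-- The canonical map `A → A * B`. -/
def inl : A →ₐ[k] FreeProd k A B := LinearAlgebra.FreeProduct.ι k (pairFam A B) true

/-- The canonical map `B → A * B`. -/
def inr : B →ₐ[k] FreeProd k A B := LinearAlgebra.FreeProduct.ι k (pairFam A B) false

variable {k A B} {C : Type u} [Ring C] [Algebra k C]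

/-- Two algebra maps as a map from the family. -/
def pairMap (f : A →ₐ[k] C) (g : B →ₐ[k] C) : (i : Bool) → pairFam A B i →ₐ[k] C
  | true => f
  | false => g

/-- The universal property of the free product: existence. -/
def lift (f : A →ₐ[k] C) (g : B →ₐ[k] C) : FreeProd k A B →ₐ[k] C :=
  LinearAlgebra.FreeProduct.lift k (pairFam A B) (fun {i} => pairMap f g i)

theorem lift_comp_inl (f : A →ₐ[k] C) (g : B →ₐ[k] C) : (lift f g).comp (inl k A B) = f :=
  LinearAlgebra.FreeProduct.lift_comp_ι k (pairFam A B) (fun {i} => pairMap f g i) (i := true)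

theorem lift_comp_inr (f : A →ₐ[k] C) (g : B →ₐ[k] C) : (lift f g).comp (inr k A B) = g :=
  LinearAlgebra.FreeProduct.lift_comp_ι k (pairFam A B) (fun {i} => pairMap f g i) (i := false)

/-- The universal property of the free product: uniqueness. -/
theorem hom_ext {f g : FreeProd k A B →ₐ[k] C}
    (hl : f.comp (inl k A B) = g.comp (inl k A B))
    (hr : f.comp (inr k A B) = g.comp (inr k A B)) : f = g := by
  have key : ∀ h : FreeProd k A B →ₐ[k] C, (∀ i : Bool,
      h.comp (LinearAlgebra.FreeProduct.ι k (pairFam A B) i) =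
        pairMap (g.comp (inl k A B)) (g.comp (inr k A B)) i) →
      h = lift (g.comp (inl k A B)) (g.comp (inr k A B)) := fun h hh =>
    LinearAlgebra.FreeProduct.lift_unique k (pairFam A B)
      (fun {i} => pairMap (g.comp (inl k A B)) (g.comp (inr k A B)) i) h hh
  refine (key f ?_).trans (key g ?_).symm
  · rintro (_ | _)
    · exact hr
    · exact hl
  · rintro (_ | _) <;> rfl

@[simp] theorem lift_inl (f : A →ₐ[k] C) (g : B →ₐ[k] C) (a : A) :
    lift f g (inl k A B a) = f a := DFunLike.congr_fun (lift_comp_inl f g) a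

@[simp] theorem lift_inr (f : A →ₐ[k] C) (g : B →ₐ[k] C) (b : B) :
    lift f g (inr k A B b) = g b := DFunLike.congr_fun (lift_comp_inr f g) b

/-- Induction principle: the free product is generated by the images of `A` and `B`. -/
theorem induction {p : FreeProd k A B → Prop} (hl : ∀ a, p (inl k A B a))
    (hr : ∀ b, p (inr k A B b)) (hadd : ∀ x y, p x → p y → p (x + y))
    (hmul : ∀ x y, p x → p y → p (x * y)) (x : FreeProd k A B) : p x := by
  have halg : ∀ r : k, p (algebraMap k _ r) := fun r => by
    rw [← AlgHom.commutes (inl k A B) r]; exact hl _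
  let S : Subalgebra k (FreeProd k A B) :=
    { carrier := {y | p y}
      mul_mem' := fun {a b} ha hb => hmul a b ha hb
      add_mem' := fun {a b} ha hb => hadd a b ha hb
      algebraMap_mem' := halg }
  let f : FreeProd k A B →ₐ[k] S :=
    lift ((inl k A B).codRestrict S hl) ((inr k A B).codRestrict S hr)
  have h : S.val.comp f = AlgHom.id k _ := by
    apply hom_ext <;> ext a <;> simp [f]
  have := (f x).2
  have h2 : ((f x : S) : FreeProd k A B) = x := DFunLike.congr_fun h x
  rw [h2] at this
  exact this

end Alg

section Hopf

variable (k A B : Type u) [Field k] [Ring A] [Ring B]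

/-- `Δ : A * B → (A * B) ⊗ (A * B)`, extending the comultiplications of the factors. -/
def comulHom [Bialgebra k A] [Bialgebra k B] :
    FreeProd k A B →ₐ[k] FreeProd k A B ⊗[k] FreeProd k A B :=
  lift ((Algebra.TensorProduct.map (inl k A B) (inl k A B)).comp (Bialgebra.comulAlgHom k A))
    ((Algebra.TensorProduct.map (inr k A B) (inr k A B)).comp (Bialgebra.comulAlgHom k B))

/-- `ε : A * B → k`, extending the counits of the factors. -/
def counitHom [Bialgebra k A] [Bialgebra k B] : FreeProd k A B →ₐ[k] k :=
  lift (Bialgebra.counitAlgHom k A) (Bialgebra.counitAlgHom k B)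

/-- `S : A * B → (A * B)ᵐᵒᵖ`, extending the antipodes of the factors. -/
def antipodeHom [HopfAlgebra k A] [HopfAlgebra k B] : FreeProd k A B →ₐ[k] (FreeProd k A B)ᵐᵒᵖ :=
  lift ((AlgHom.op (inl k A B)).comp (HopfAlgebra.antipodeAlgHomOp k A))
    ((AlgHom.op (inr k A B)).comp (HopfAlgebra.antipodeAlgHomOp k B))

section aux

variable {k A} {H : Type u} [Bialgebra k A] [Ring H] [Algebra k H] {i : A →ₐ[k] H}
  {D : H →ₐ[k] H ⊗[k] H} {E : H →ₐ[k] k}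

theorem aux_coassoc
    (hD : D.comp i = (Algebra.TensorProduct.map i i).comp (Bialgebra.comulAlgHom k A)) :
    (((Algebra.TensorProduct.assoc k k k H H H).toAlgHom.comp
      ((Algebra.TensorProduct.map D (.id k H)).comp D)).comp i) =
    ((Algebra.TensorProduct.map (.id k H) D).comp D).comp i := by
  have hD' : ∀ a, D (i a) = TensorProduct.map i.toLinearMap i.toLinearMap (Coalgebra.comul a) :=
    fun a => DFunLike.congr_fun hD a
  have h1 : ∀ t : A ⊗[k] A, Algebra.TensorProduct.assoc k k k H H H
      (Algebra.TensorProduct.map D (.id k H)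
        (TensorProduct.map i.toLinearMap i.toLinearMap t)) =
      TensorProduct.map i.toLinearMap (TensorProduct.map i.toLinearMap i.toLinearMap)
        (TensorProduct.assoc k A A A (Coalgebra.comul.rTensor A t)) := by
    intro t
    induction t with
    | zero => simp
    | add x y hx hy => simp only [map_add, hx, hy]
    | tmul x y =>
      simp only [map_tmul, AlgHom.toLinearMap_apply, Algebra.TensorProduct.map_tmul, hD',
        LinearMap.rTensor_tmul, AlgHom.coe_id, id_eq]
      generalize (Coalgebra.comul x : A ⊗[k] A) = s
      induction s with
      | zero => simp
      | add x y hx hy => simp only [map_add, add_tmul, hx, hy]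
      | tmul x y => simp
  have h2 : ∀ t : A ⊗[k] A, Algebra.TensorProduct.map (.id k H) D
        (TensorProduct.map i.toLinearMap i.toLinearMap t) =
      TensorProduct.map i.toLinearMap (TensorProduct.map i.toLinearMap i.toLinearMap)
        (Coalgebra.comul.lTensor A t) := by
    intro t
    induction t with
    | zero => simp
    | add x y hx hy => simp only [map_add, hx, hy]
    | tmul x y => simp [hD']
  ext a
  simp only [AlgHom.comp_apply, hD']
  rw [h2, ← Coalgebra.coassoc_apply, ← h1]
  rfl

theorem aux_rTensor
    (hD : D.comp i = (Algebra.TensorProduct.map i i).comp (Bialgebra.comulAlgHom k A))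
    (hE : E.comp i = Bialgebra.counitAlgHom k A) :
    (((Algebra.TensorProduct.map E (.id k H)).comp D).comp i) =
    ((Algebra.TensorProduct.lid k H).symm : H →ₐ[k] k ⊗[k] H).comp i := by
  have hD' : ∀ a, D (i a) = TensorProduct.map i.toLinearMap i.toLinearMap (Coalgebra.comul a) :=
    fun a => DFunLike.congr_fun hD a
  have hE' : ∀ a, E (i a) = Coalgebra.counit a := fun a => DFunLike.congr_fun hE a
  have h1 : ∀ t : A ⊗[k] A, Algebra.TensorProduct.map E (.id k H)
      (TensorProduct.map i.toLinearMap i.toLinearMap t) =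
      i.toLinearMap.lTensor k (Coalgebra.counit.rTensor A t) := by
    intro t
    induction t with
    | zero => simp
    | add x y hx hy => simp only [map_add, hx, hy]
    | tmul x y => simp [hE']
  ext a
  simp only [AlgHom.comp_apply, hD', h1, Coalgebra.rTensor_counit_comul]
  simp

theorem aux_lTensor
    (hD : D.comp i = (Algebra.TensorProduct.map i i).comp (Bialgebra.comulAlgHom k A))
    (hE : E.comp i = Bialgebra.counitAlgHom k A) :
    (((Algebra.TensorProduct.map (.id k H) E).comp D).comp i) =
    ((Algebra.TensorProduct.rid k k H).symm : H →ₐ[k] H ⊗[k] k).comp i := by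
  have hD' : ∀ a, D (i a) = TensorProduct.map i.toLinearMap i.toLinearMap (Coalgebra.comul a) :=
    fun a => DFunLike.congr_fun hD a
  have hE' : ∀ a, E (i a) = Coalgebra.counit a := fun a => DFunLike.congr_fun hE a
  have h1 : ∀ t : A ⊗[k] A, Algebra.TensorProduct.map (.id k H) E
      (TensorProduct.map i.toLinearMap i.toLinearMap t) =
      i.toLinearMap.rTensor k (Coalgebra.counit.lTensor A t) := by
    intro t
    induction t with
    | zero => simp
    | add x y hx hy => simp only [map_add, hx, hy]
    | tmul x y => simp [hE']
  ext a
  simp only [AlgHom.comp_apply, hD', h1, Coalgebra.lTensor_counit_comul]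
  simp

end aux

instance [Bialgebra k A] [Bialgebra k B] : Bialgebra k (FreeProd k A B) :=
  Bialgebra.ofAlgHom (comulHom k A B) (counitHom k A B)
    (hom_ext (aux_coassoc (lift_comp_inl _ _)) (aux_coassoc (lift_comp_inr _ _)))
    (hom_ext (aux_rTensor (lift_comp_inl _ _) (lift_comp_inl _ _))
      (aux_rTensor (lift_comp_inr _ _) (lift_comp_inr _ _)))
    (hom_ext (aux_lTensor (lift_comp_inl _ _) (lift_comp_inl _ _))
      (aux_lTensor (lift_comp_inr _ _) (lift_comp_inr _ _)))

/-- The canonical map `A → A * B` as a bialgebra map. -/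
def inlBialg [Bialgebra k A] [Bialgebra k B] : A →ₐc[k] FreeProd k A B :=
  BialgHom.ofAlgHom (inl k A B) (lift_comp_inl _ _) (lift_comp_inl _ _).symm

/-- The canonical map `B → A * B` as a bialgebra map. -/
def inrBialg [Bialgebra k A] [Bialgebra k B] : B →ₐc[k] FreeProd k A B :=
  BialgHom.ofAlgHom (inr k A B) (lift_comp_inr _ _) (lift_comp_inr _ _).symm

theorem inlBialg_injective [Bialgebra k A] [Bialgebra k B] :
    Function.Injective (inlBialg k A B) := by
  let r : FreeProd k A B →ₐ[k] A :=
    lift (AlgHom.id k A) ((Algebra.ofId k A).comp (Bialgebra.counitAlgHom k B))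
  exact Function.LeftInverse.injective (g := r) fun a => lift_inl _ _ a

theorem inrBialg_injective [Bialgebra k A] [Bialgebra k B] :
    Function.Injective (inrBialg k A B) := by
  let r : FreeProd k A B →ₐ[k] B :=
    lift ((Algebra.ofId k B).comp (Bialgebra.counitAlgHom k A)) (AlgHom.id k B)
  exact Function.LeftInverse.injective (g := r) fun a => lift_inr _ _ a

/-- The antipode of `A * B` as a linear map. -/
def antipodeLin [HopfAlgebra k A] [HopfAlgebra k B] : FreeProd k A B →ₗ[k] FreeProd k A B :=
  (MulOpposite.opLinearEquiv k).symm.toLinearMap ∘ₗ (antipodeHom k A B).toLinearMap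

section aux2

variable {k} {H : Type u} [Ring H] [Bialgebra k H] {S : H →ₗ[k] H}

/-- If `S` is anti-multiplicative, the left antipode identity is stable under products. -/
theorem aux_left_mul (hS : ∀ x y, S (x * y) = S y * S x) (x y : H)
    (hx : LinearMap.mul' k H (S.rTensor H (Coalgebra.comul x)) = algebraMap k H (Coalgebra.counit x))
    (hy : LinearMap.mul' k H (S.rTensor H (Coalgebra.comul y)) =
      algebraMap k H (Coalgebra.counit y)) :
    LinearMap.mul' k H (S.rTensor H (Coalgebra.comul (x * y))) =
      algebraMap k H (Coalgebra.counit (x * y)) := by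
  have h1 : ∀ s t : H ⊗[k] H, LinearMap.mul' k H (S.rTensor H (s * t)) =
      LinearMap.mul' k H ((LinearMap.mulLeft k (LinearMap.mul' k H (S.rTensor H s))).lTensor H
        (S.rTensor H t)) := by
    intro s t
    induction t with
    | zero => simp
    | add a b ha hb => simp only [mul_add, map_add, ha, hb]
    | tmul a b =>
      induction s with
      | zero => simp
      | add c d hc hd =>
        simp only [add_mul, map_add, hc, hd, LinearMap.rTensor_tmul, LinearMap.lTensor_tmul,
          LinearMap.mul'_apply, LinearMap.mulLeft_apply, mul_add]
      | tmul c d => simp [hS, mul_assoc]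
  rw [Bialgebra.comul_mul, h1, hx, Bialgebra.counit_mul, map_mul, ← hy]
  generalize (Coalgebra.comul y : H ⊗[k] H) = t
  induction t with
  | zero => simp
  | add a b ha hb => simp only [map_add, ha, hb, mul_add]
  | tmul a b =>
    simp only [LinearMap.rTensor_tmul, LinearMap.lTensor_tmul, LinearMap.mul'_apply,
      LinearMap.mulLeft_apply]
    rw [← mul_assoc, ← mul_assoc, Algebra.commutes]

/-- If `S` is anti-multiplicative, the right antipode identity is stable under products. -/
theorem aux_right_mul (hS : ∀ x y, S (x * y) = S y * S x) (x y : H)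
    (hx : LinearMap.mul' k H (S.lTensor H (Coalgebra.comul x)) = algebraMap k H (Coalgebra.counit x))
    (hy : LinearMap.mul' k H (S.lTensor H (Coalgebra.comul y)) =
      algebraMap k H (Coalgebra.counit y)) :
    LinearMap.mul' k H (S.lTensor H (Coalgebra.comul (x * y))) =
      algebraMap k H (Coalgebra.counit (x * y)) := by
  have h1 : ∀ s t : H ⊗[k] H, LinearMap.mul' k H (S.lTensor H (s * t)) =
      LinearMap.mul' k H ((LinearMap.mulRight k (LinearMap.mul' k H (S.lTensor H t))).rTensor H
        (S.lTensor H s)) := by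
    intro s t
    induction s with
    | zero => simp
    | add a b ha hb => simp only [add_mul, map_add, ha, hb]
    | tmul a b =>
      induction t with
      | zero => simp
      | add c d hc hd =>
        simp only [mul_add, map_add, hc, hd, LinearMap.rTensor_tmul, LinearMap.lTensor_tmul,
          LinearMap.mul'_apply, LinearMap.mulRight_apply, add_mul]
      | tmul c d => simp [hS, mul_assoc]
  rw [Bialgebra.comul_mul, h1, hy, Bialgebra.counit_mul, map_mul, ← hx]
  generalize (Coalgebra.comul x : H ⊗[k] H) = t
  induction t with
  | zero => simp
  | add a b ha hb => simp only [map_add, ha, hb, add_mul]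
  | tmul a b =>
    simp only [LinearMap.rTensor_tmul, LinearMap.lTensor_tmul, LinearMap.mul'_apply,
      LinearMap.mulRight_apply]
    rw [mul_assoc, Algebra.commutes, ← mul_assoc]

variable {A : Type u} [Ring A] [HopfAlgebra k A]

theorem aux_left_map (i : A →ₐc[k] H) (hi : ∀ a, S (i a) = i (HopfAlgebra.antipode k a)) (a : A) :
    LinearMap.mul' k H (S.rTensor H (Coalgebra.comul (i a))) =
      algebraMap k H (Coalgebra.counit (i a)) := by
  have h : ∀ t : A ⊗[k] A, LinearMap.mul' k H (S.rTensor H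
      (TensorProduct.map (i : A →ₗ[k] H) (i : A →ₗ[k] H) t)) =
      i (LinearMap.mul' k A ((HopfAlgebra.antipode k).rTensor A t)) := by
    intro t
    induction t with
    | zero => simp
    | add x y hx hy => simp only [map_add, hx, hy]
    | tmul x y => simp [hi]
  rw [← CoalgHomClass.map_comp_comul_apply, h, HopfAlgebra.mul_antipode_rTensor_comul_apply,
    CoalgHomClass.counit_comp_apply]
  exact AlgHomClass.commutes i _

theorem aux_right_map (i : A →ₐc[k] H) (hi : ∀ a, S (i a) = i (HopfAlgebra.antipode k a)) (a : A) :
    LinearMap.mul' k H (S.lTensor H (Coalgebra.comul (i a))) =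
      algebraMap k H (Coalgebra.counit (i a)) := by
  have h : ∀ t : A ⊗[k] A, LinearMap.mul' k H (S.lTensor H
      (TensorProduct.map (i : A →ₗ[k] H) (i : A →ₗ[k] H) t)) =
      i (LinearMap.mul' k A ((HopfAlgebra.antipode k).lTensor A t)) := by
    intro t
    induction t with
    | zero => simp
    | add x y hx hy => simp only [map_add, hx, hy]
    | tmul x y => simp [hi]
  rw [← CoalgHomClass.map_comp_comul_apply, h, HopfAlgebra.mul_antipode_lTensor_comul_apply,
    CoalgHomClass.counit_comp_apply]
  exact AlgHomClass.commutes i _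

end aux2

theorem antipodeLin_mul [HopfAlgebra k A] [HopfAlgebra k B] (x y : FreeProd k A B) :
    antipodeLin k A B (x * y) = antipodeLin k A B y * antipodeLin k A B x := by
  simp [antipodeLin]

theorem antipodeLin_inl [HopfAlgebra k A] [HopfAlgebra k B] (a : A) :
    antipodeLin k A B (inlBialg k A B a) = inlBialg k A B (HopfAlgebra.antipode k a) := by
  change (antipodeHom k A B (inl k A B a)).unop = inl k A B _
  simp [antipodeHom]

theorem antipodeLin_inr [HopfAlgebra k A] [HopfAlgebra k B] (b : B) :
    antipodeLin k A B (inrBialg k A B b) = inrBialg k A B (HopfAlgebra.antipode k b) := by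
  change (antipodeHom k A B (inr k A B b)).unop = inr k A B _
  simp [antipodeHom]

/-- The free product of two Hopf algebras is a Hopf algebra; `inlBialg` and `inrBialg` are
Hopf algebra maps. -/
instance [HopfAlgebra k A] [HopfAlgebra k B] : HopfAlgebra k (FreeProd k A B) where
  antipode := antipodeLin k A B
  mul_antipode_rTensor_comul := by
    refine LinearMap.ext fun x => ?_
    refine induction (aux_left_map (inlBialg k A B) (antipodeLin_inl k A B))
      (aux_left_map (inrBialg k A B) (antipodeLin_inr k A B)) ?_
      (aux_left_mul (antipodeLin_mul k A B)) x
    intro x y hx hy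
    simp only [map_add, hx, hy]
  mul_antipode_lTensor_comul := by
    refine LinearMap.ext fun x => ?_
    refine induction (aux_right_map (inlBialg k A B) (antipodeLin_inl k A B))
      (aux_right_map (inrBialg k A B) (antipodeLin_inr k A B)) ?_
      (aux_right_mul (antipodeLin_mul k A B)) x
    intro x y hx hy
    simp only [map_add, hx, hy]

end Hopf

end FreeProd

/-- A bialgebra map between Hopf algebras commutes with the antipodes. -/
theorem BialgHom.map_antipode_apply {k B A : Type u} [Field k] [Ring A] [Ring B] [HopfAlgebra k A]
    [HopfAlgebra k B] (f : B →ₐc[k] A) (b : B) :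
    f (HopfAlgebra.antipode k b) = HopfAlgebra.antipode k (f b) := by
  have h : WithConv.toConv ((f : B →ₗ[k] A) ∘ₗ HopfAlgebra.antipode k) =
      WithConv.toConv (HopfAlgebra.antipode k ∘ₗ (f : B →ₗ[k] A)) := by
    apply left_inv_eq_right_inv (a := WithConv.toConv (f : B →ₗ[k] A))
    · ext b
      have := congrArg f (HopfAlgebra.sum_antipode_mul_eq_algebraMap_counit
        (Coalgebra.Repr.arbitrary k b))
      have hc : f (algebraMap k B (Coalgebra.counit b)) = algebraMap k A (Coalgebra.counit b) :=
        AlgHomClass.commutes f _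
      rw [(Coalgebra.Repr.arbitrary k b).convMul_apply]
      simpa [hc] using this
    · ext b
      have := HopfAlgebra.mul_antipode_lTensor_comul_apply (R := k) (f b)
      rw [← CoalgHomClass.map_comp_comul_apply, ← (Coalgebra.Repr.arbitrary k b).eq] at this
      rw [(Coalgebra.Repr.arbitrary k b).convMul_apply]
      simpa using this
  exact congrArg (fun g : WithConv (B →ₗ[k] A) => g b) h

/-! ### Comodules and cosemisimplicity -/

/-- A right comodule structure on `V` over the coalgebra `C`. -/
structure Coaction (k C V : Type u) [Field k] [AddCommGroup C] [Module k C] [Coalgebra k C]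
    [AddCommGroup V] [Module k V] where
  /-- The coaction `v ↦ v₍₀₎ ⊗ v₍₁₎`. -/
  coact : V →ₗ[k] V ⊗[k] C
  coassoc : ∀ v, TensorProduct.assoc k V C C (coact.rTensor C (coact v)) =
    Coalgebra.comul.lTensor V (coact v)
  counit : ∀ v, Coalgebra.counit.lTensor V (coact v) = v ⊗ₜ[k] (1 : k)

/-- `W ⊆ V` is a subcomodule: the coaction maps `W` into (the image of) `W ⊗ C`. -/
def Coaction.IsSubcomodule {k C V : Type u} [Field k] [AddCommGroup C] [Module k C] [Coalgebra k C]
    [AddCommGroup V] [Module k V] (ρ : Coaction k C V) (W : Submodule k V) : Prop :=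
  ∀ w ∈ W, ρ.coact w ∈ LinearMap.range (W.subtype.rTensor C)

/-- A coalgebra is cosemisimple if all its right comodules are semisimple: every subcomodule of
every comodule has a complementary subcomodule. -/
def IsCosemisimple (k C : Type u) [Field k] [AddCommGroup C] [Module k C] [Coalgebra k C] : Prop :=
  ∀ (V : Type u) [AddCommGroup V] [Module k V] (ρ : Coaction k C V) (W : Submodule k V),
    ρ.IsSubcomodule W → ∃ W' : Submodule k V, ρ.IsSubcomodule W' ∧ IsCompl W W'

/-! ### Yetter–Drinfeld modules -/

/-- For a bilinear map `act v a = v · a`, the map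
`(v ⊗ h, x ⊗ y ⊗ z) ↦ (v · y) ⊗ S(x) h z`. -/
def ydTwist {k A V : Type u} [Field k] [Ring A] [HopfAlgebra k A] [AddCommGroup V] [Module k V]
    (act : V →ₗ[k] A →ₗ[k] V) : V ⊗[k] A →ₗ[k] A ⊗[k] (A ⊗[k] A) →ₗ[k] V ⊗[k] A :=
  TensorProduct.lift <| LinearMap.mk₂ k
    (fun v h => TensorProduct.lift ((TensorProduct.mapBilinear (RingHom.id k) A A V A (act v)) ∘ₗ
      LinearMap.mul k A ∘ₗ LinearMap.mulRight k h ∘ₗ HopfAlgebra.antipode k))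
    (fun _ _ _ => by ext; simp)
    (fun _ _ _ => by ext; simp [smul_tmul'])
    (fun _ _ _ => by ext; simp [mul_add, tmul_add])
    (fun _ _ _ => by ext; simp)

@[simp] theorem ydTwist_tmul {k A V : Type u} [Field k] [Ring A] [HopfAlgebra k A] [AddCommGroup V]
    [Module k V] (act : V →ₗ[k] A →ₗ[k] V) (v : V) (h x y z : A) :
    ydTwist act (v ⊗ₜ h) (x ⊗ₜ (y ⊗ₜ z)) =
      act v y ⊗ₜ[k] (HopfAlgebra.antipode k x * h * z) := by
  simp [ydTwist]

/-- A (right-right) Yetter–Drinfeld module over the Hopf algebra `A`: a right `A`-module and right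
`A`-comodule with `(v·a)₍₀₎ ⊗ (v·a)₍₁₎ = v₍₀₎·a₍₂₎ ⊗ S(a₍₁₎) v₍₁₎ a₍₃₎`. -/
structure YetterDrinfeld (k A : Type u) [Field k] [Ring A] [HopfAlgebra k A] where
  /-- The underlying vector space. -/
  carrier : Type u
  [addCommGroup : AddCommGroup carrier]
  [module : Module k carrier]
  /-- The right action `act v a = v · a`. -/
  act : carrier →ₗ[k] A →ₗ[k] carrier
  act_one : ∀ v, act v 1 = v
  act_mul : ∀ v a b, act v (a * b) = act (act v a) b
  /-- The right coaction. -/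
  coaction : Coaction k A carrier
  yd : ∀ v a, coaction.coact (act v a) =
    ydTwist act (coaction.coact v) (Coalgebra.comul.lTensor A (Coalgebra.comul a))

attribute [instance] YetterDrinfeld.addCommGroup YetterDrinfeld.module

namespace YetterDrinfeld

section Basic

variable {k A : Type u} [Field k] [Ring A] [HopfAlgebra k A]

/-- The coaction as a linear map. -/
abbrev coact (M : YetterDrinfeld k A) : M.carrier →ₗ[k] M.carrier ⊗[k] A := M.coaction.coact

/-- Morphisms of Yetter–Drinfeld modules: the `A`-linear and `A`-colinear maps. -/
@[ext] structure Hom (M N : YetterDrinfeld k A) where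
  /-- The underlying linear map. -/
  lin : M.carrier →ₗ[k] N.carrier
  map_act : ∀ v a, lin (M.act v a) = N.act (lin v) a
  map_coact : ∀ v, lin.rTensor A (M.coact v) = N.coact (lin v)

instance : Category (YetterDrinfeld k A) where
  Hom M N := Hom M N
  id M := ⟨LinearMap.id, fun _ _ => rfl, fun _ => by simp⟩
  comp f g := ⟨g.lin ∘ₗ f.lin, fun _ _ => by simp [f.map_act, g.map_act], fun _ => by
    rw [LinearMap.rTensor_comp_apply, f.map_coact, g.map_coact]; rfl⟩

variable {M N P : YetterDrinfeld k A}

theorem hom_ext {f g : M ⟶ N} (h : ∀ v, f.lin v = g.lin v) : f = g :=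
  Hom.ext (LinearMap.ext h)

@[simp] theorem id_lin (M : YetterDrinfeld k A) : Hom.lin (𝟙 M) = LinearMap.id := rfl

@[simp] theorem comp_lin (f : M ⟶ N) (g : N ⟶ P) : Hom.lin (f ≫ g) = g.lin ∘ₗ f.lin := rfl

theorem lin_injective : Function.Injective (fun f : M ⟶ N => f.lin) := fun _ _ h => Hom.ext h

instance : Zero (M ⟶ N) := ⟨⟨0, fun _ _ => by simp, fun _ => by simp⟩⟩
instance : Add (M ⟶ N) := ⟨fun f g => ⟨f.lin + g.lin,
  fun _ _ => by simp [f.map_act, g.map_act],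
  fun _ => by simp [LinearMap.rTensor_add, f.map_coact, g.map_coact]⟩⟩
instance : Neg (M ⟶ N) := ⟨fun f => ⟨-f.lin,
  fun _ _ => by simp [f.map_act], fun _ => by simp [LinearMap.rTensor_neg, f.map_coact]⟩⟩
instance : Sub (M ⟶ N) := ⟨fun f g => ⟨f.lin - g.lin,
  fun _ _ => by simp [f.map_act, g.map_act],
  fun _ => by simp [LinearMap.rTensor_sub, f.map_coact, g.map_coact]⟩⟩
instance : SMul k (M ⟶ N) := ⟨fun c f => ⟨c • f.lin,
  fun _ _ => by simp [f.map_act], fun _ => by simp [LinearMap.rTensor_smul, f.map_coact]⟩⟩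
instance : SMul ℕ (M ⟶ N) := ⟨fun c f => (c : k) • f⟩
instance : SMul ℤ (M ⟶ N) := ⟨fun c f => (c : k) • f⟩

@[simp] theorem zero_lin : Hom.lin (0 : M ⟶ N) = 0 := rfl
@[simp] theorem add_lin (f g : M ⟶ N) : Hom.lin (f + g) = f.lin + g.lin := rfl
@[simp] theorem neg_lin (f : M ⟶ N) : Hom.lin (-f) = -f.lin := rfl
@[simp] theorem sub_lin (f g : M ⟶ N) : Hom.lin (f - g) = f.lin - g.lin := rfl
@[simp] theorem smul_lin (c : k) (f : M ⟶ N) : Hom.lin (c • f) = c • f.lin := rfl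

instance : AddCommGroup (M ⟶ N) :=
  lin_injective.addCommGroup _ rfl (fun _ _ => rfl) (fun _ => rfl) (fun _ _ => rfl)
    (fun f n => (Nat.cast_smul_eq_nsmul k n f.lin)) (fun f n => (Int.cast_smul_eq_zsmul k n f.lin))

/-- Forgetting to linear maps, as an additive map. -/
def linAddHom (M N : YetterDrinfeld k A) : (M ⟶ N) →+ (M.carrier →ₗ[k] N.carrier) where
  toFun f := f.lin
  map_zero' := rfl
  map_add' _ _ := rfl

instance : Module k (M ⟶ N) :=
  lin_injective.module k (linAddHom M N) (fun _ _ => rfl)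

instance : Preadditive (YetterDrinfeld k A) where
  add_comp _ _ _ f f' g := hom_ext fun v => by simp
  comp_add _ _ _ f g g' := hom_ext fun v => by simp

instance : Linear k (YetterDrinfeld k A) where
  smul_comp _ _ _ r f g := hom_ext fun v => by simp
  comp_smul _ _ _ f r g := hom_ext fun v => by simp

/-- The trivial Yetter–Drinfeld module `k`: `v · a = ε(a) v` and `v ↦ v ⊗ 1`. -/
def trivialModule (k A : Type u) [Field k] [Ring A] [HopfAlgebra k A] : YetterDrinfeld k A where
  carrier := k
  act := (LinearMap.mul k k).compl₂ Coalgebra.counit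
  act_one v := by simp
  act_mul v a b := by simp [mul_assoc]
  coaction :=
    { coact := (TensorProduct.mk k k A).flip 1
      coassoc := fun v => by simp [Algebra.TensorProduct.one_def]
      counit := fun v => by simp }
  yd v a := by
    have h : ∀ t : A ⊗[k] A, ydTwist ((LinearMap.mul k k).compl₂ Coalgebra.counit) (v ⊗ₜ (1 : A))
        (Coalgebra.comul.lTensor A t) =
        v ⊗ₜ LinearMap.mul' k A ((HopfAlgebra.antipode k).rTensor A t) := by
      intro t
      induction t with
      | zero => simp
      | add x y hx hy => simp only [map_add, hx, hy, tmul_add]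
      | tmul x y =>
        have h2 : ∀ s : A ⊗[k] A,
            ydTwist ((LinearMap.mul k k).compl₂ Coalgebra.counit) (v ⊗ₜ (1 : A)) (x ⊗ₜ s) =
            v ⊗ₜ (HopfAlgebra.antipode k x *
              TensorProduct.lid k A (Coalgebra.counit.rTensor A s)) := by
          intro s
          induction s with
          | zero => simp
          | add x y hx hy => simp only [map_add, hx, hy, tmul_add, mul_add]
          | tmul y z =>
            simp only [ydTwist_tmul, LinearMap.compl₂_apply, LinearMap.mul_apply', mul_one,
              LinearMap.rTensor_tmul, lid_tmul, mul_smul_comm, tmul_smul]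
            rw [mul_comm v, ← smul_eq_mul, smul_tmul']
        simp [h2]
    have := h (Coalgebra.comul a)
    simp only [LinearMap.flip_apply, TensorProduct.mk_apply, LinearMap.compl₂_apply,
      LinearMap.mul_apply'] at this ⊢
    rw [this, HopfAlgebra.mul_antipode_rTensor_comul_apply, mul_comm, ← smul_eq_mul, smul_tmul,
      Algebra.algebraMap_eq_smul_one]

end Basic

/-! #### Transport of the axioms along linear maps -/

section Transport

variable {k A B V W : Type u} [Field k] [Ring A] [HopfAlgebra k A] [Ring B] [HopfAlgebra k B]
  [AddCommGroup V] [Module k V] [AddCommGroup W] [Module k W]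

theorem coassoc_left (f : B →ₐc[k] A) (φ : V →ₗ[k] W) (ρV : V →ₗ[k] V ⊗[k] B)
    (ρW : W →ₗ[k] W ⊗[k] A)
    (h : ∀ v, TensorProduct.map φ (f : B →ₗ[k] A) (ρV v) = ρW (φ v)) (v : V) :
    TensorProduct.map φ (TensorProduct.map (f : B →ₗ[k] A) (f : B →ₗ[k] A))
      (TensorProduct.assoc k V B B (ρV.rTensor B (ρV v))) =
    TensorProduct.assoc k W A A (ρW.rTensor A (ρW (φ v))) := by
  rw [← h]
  generalize ρV v = t
  induction t with
  | zero => simp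
  | add x y hx hy => simp only [map_add, hx, hy]
  | tmul x y =>
    simp only [LinearMap.rTensor_tmul, map_tmul, ← h]
    generalize ρV x = s
    induction s with
    | zero => simp
    | add x y hx hy => simp only [map_add, hx, hy, add_tmul]
    | tmul x y => simp

theorem coassoc_right (f : B →ₐc[k] A) (φ : V →ₗ[k] W) (ρV : V →ₗ[k] V ⊗[k] B)
    (ρW : W →ₗ[k] W ⊗[k] A)
    (h : ∀ v, TensorProduct.map φ (f : B →ₗ[k] A) (ρV v) = ρW (φ v)) (v : V) :
    TensorProduct.map φ (TensorProduct.map (f : B →ₗ[k] A) (f : B →ₗ[k] A))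
      (Coalgebra.comul.lTensor V (ρV v)) =
    Coalgebra.comul.lTensor W (ρW (φ v)) := by
  rw [← h]
  generalize ρV v = t
  induction t with
  | zero => simp
  | add x y hx hy => simp only [map_add, hx, hy]
  | tmul x y => simp [← CoalgHomClass.map_comp_comul_apply]

theorem counit_left (f : B →ₐc[k] A) (φ : V →ₗ[k] W) (ρV : V →ₗ[k] V ⊗[k] B)
    (ρW : W →ₗ[k] W ⊗[k] A)
    (h : ∀ v, TensorProduct.map φ (f : B →ₗ[k] A) (ρV v) = ρW (φ v)) (v : V) :
    φ.rTensor k (Coalgebra.counit.lTensor V (ρV v)) = Coalgebra.counit.lTensor W (ρW (φ v)) := by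
  rw [← h]
  generalize ρV v = t
  induction t with
  | zero => simp
  | add x y hx hy => simp only [map_add, hx, hy]
  | tmul x y => simp

theorem ydTwist_map (f : B →ₐc[k] A) (φ : V →ₗ[k] W) (actV : V →ₗ[k] B →ₗ[k] V)
    (actW : W →ₗ[k] A →ₗ[k] W) (h : ∀ v b, φ (actV v b) = actW (φ v) (f b))
    (t : V ⊗[k] B) (s : B ⊗[k] (B ⊗[k] B)) :
    TensorProduct.map φ (f : B →ₗ[k] A) (ydTwist actV t s) =
      ydTwist actW (TensorProduct.map φ (f : B →ₗ[k] A) t)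
        (TensorProduct.map (f : B →ₗ[k] A) (TensorProduct.map (f : B →ₗ[k] A) (f : B →ₗ[k] A)) s) := by
  induction t with
  | zero => simp
  | add x y hx hy => simp only [map_add, hx, hy, LinearMap.add_apply]
  | tmul v x =>
    induction s with
    | zero => simp
    | add x y hx hy => simp only [map_add, hx, hy]
    | tmul a s =>
      induction s with
      | zero => simp
      | add x y hx hy => simp only [map_add, hx, hy, tmul_add]
      | tmul b c => simp [h, BialgHom.map_antipode_apply]

theorem comul_map (f : B →ₐc[k] A) (b : B) :
    TensorProduct.map (f : B →ₗ[k] A) (TensorProduct.map (f : B →ₗ[k] A) (f : B →ₗ[k] A))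
      (Coalgebra.comul.lTensor B (Coalgebra.comul b)) =
    Coalgebra.comul.lTensor A (Coalgebra.comul (f b)) := by
  rw [← CoalgHomClass.map_comp_comul_apply]
  generalize (Coalgebra.comul b : B ⊗[k] B) = t
  induction t with
  | zero => simp
  | add x y hx hy => simp only [map_add, hx, hy]
  | tmul x y => simp [← CoalgHomClass.map_comp_comul_apply]

theorem map_id_eq (φ : V →ₗ[k] W) (t : V ⊗[k] A) :
    TensorProduct.map φ ((BialgHom.id k A : A →ₐc[k] A) : A →ₗ[k] A) t = φ.rTensor A t := rfl

end Transport

/-! #### Subobjects and restriction -/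

section Pull

variable {k A B : Type u} [Field k] [Ring A] [HopfAlgebra k A] [Ring B] [HopfAlgebra k B]

theorem map_injective {V W : Type u} [AddCommGroup V] [Module k V] [AddCommGroup W] [Module k W]
    (φ : V →ₗ[k] W) (hφ : Function.Injective φ) {U X : Type u} [AddCommGroup U] [Module k U]
    [AddCommGroup X] [Module k X] (ψ : U →ₗ[k] X) (hψ : Function.Injective ψ) :
    Function.Injective (TensorProduct.map φ ψ) :=
  TensorProduct.map_injective_of_flat_flat _ _ hφ hψ

variable (f : B →ₐc[k] A) (hf : Function.Injective f) (X : YetterDrinfeld k A)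
  (W : Submodule k X.carrier)

/-- The coaction `W → W ⊗ B` obtained by corestricting that of `X`, when the latter maps `W` into
`W ⊗ B ⊆ X ⊗ A`. -/
def pullCoact
    (hco : ∀ w ∈ W, X.coact w ∈ LinearMap.range (TensorProduct.map W.subtype (f : B →ₗ[k] A))) :
    W →ₗ[k] W ⊗[k] B :=
  (LinearEquiv.ofInjective (TensorProduct.map W.subtype (f : B →ₗ[k] A))
    (map_injective _ W.subtype_injective _ hf)).symm.toLinearMap ∘ₗ
    LinearMap.codRestrict _ (X.coact ∘ₗ W.subtype) (fun w => hco w w.2)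

theorem map_pullCoact
    (hco : ∀ w ∈ W, X.coact w ∈ LinearMap.range (TensorProduct.map W.subtype (f : B →ₗ[k] A)))
    (w : W) :
    TensorProduct.map W.subtype (f : B →ₗ[k] A) (pullCoact f hf X W hco w) =
      X.coact (W.subtype w) := by
  have := LinearEquiv.apply_symm_apply (LinearEquiv.ofInjective
    (TensorProduct.map W.subtype (f : B →ₗ[k] A)) (map_injective _ W.subtype_injective _ hf))
    (LinearMap.codRestrict _ (X.coact ∘ₗ W.subtype) (fun w => hco w w.2) w)
  exact congrArg Subtype.val this

/-- A subspace `W ⊆ X` stable under the action of the Hopf subalgebra `B ⊆ A`, with coaction taking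
values in `W ⊗ B`, is a Yetter–Drinfeld module over `B`. -/
def pull (hact : ∀ w ∈ W, ∀ b, X.act w (f b) ∈ W)
    (hco : ∀ w ∈ W, X.coact w ∈ LinearMap.range (TensorProduct.map W.subtype (f : B →ₗ[k] A))) :
    YetterDrinfeld k B where
  carrier := W
  act := LinearMap.mk₂ k (fun w b => ⟨X.act w (f b), hact w w.2 b⟩)
    (fun _ _ _ => by ext; simp) (fun _ _ _ => by ext; simp)
    (fun _ _ _ => by ext; simp) (fun _ _ _ => by ext; simp)
  act_one w := by ext; simp [X.act_one]
  act_mul w a b := by ext; simp [X.act_mul]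
  coaction :=
    { coact := pullCoact f hf X W hco
      coassoc := fun w => by
        have hh := map_pullCoact f hf X W hco
        apply map_injective _ W.subtype_injective _ (map_injective _ hf _ hf)
        refine (coassoc_left f _ _ X.coact hh w).trans ?_
        exact (X.coaction.coassoc _).trans (coassoc_right f _ _ X.coact hh w).symm
      counit := fun w => by
        have hh := map_pullCoact f hf X W hco
        apply Module.Flat.rTensor_preserves_injective_linearMap (M := k) _ W.subtype_injective
        rw [counit_left f _ _ X.coact hh w, X.coaction.counit]
        simp }
  yd w b := by
    have hh := map_pullCoact f hf X W hco
    apply map_injective _ W.subtype_injective _ hf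
    refine Eq.trans ?_ (ydTwist_map f W.subtype _ X.act (fun _ _ => rfl) _ _).symm
    rw [comul_map]
    refine (hh _).trans ((X.yd _ _).trans ?_)
    exact congrArg (fun t => ydTwist X.act t _) (hh w).symm

end Pull

section Restriction

variable {k A B : Type u} [Field k] [Ring A] [HopfAlgebra k A] [Ring B] [HopfAlgebra k B]
  (f : B →ₐc[k] A) (hf : Function.Injective f) (X : YetterDrinfeld k A)

/-- `X^(B) = {x ∈ X | x₍₀₎ ⊗ x₍₁₎ ∈ X ⊗ B}`, for a Hopf subalgebra `f : B ↪ A`. -/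
def resSubmodule : Submodule k X.carrier :=
  (LinearMap.range ((f : B →ₗ[k] A).lTensor X.carrier)).comap X.coact

theorem resSubmodule_act (x : X.carrier) (hx : x ∈ resSubmodule f X) (b : B) :
    X.act x (f b) ∈ resSubmodule f X := by
  have key : ∀ (t : X.carrier ⊗[k] B) (s : B ⊗[k] (B ⊗[k] B)),
      ydTwist X.act ((f : B →ₗ[k] A).lTensor X.carrier t)
        (TensorProduct.map (f : B →ₗ[k] A)
          (TensorProduct.map (f : B →ₗ[k] A) (f : B →ₗ[k] A)) s) ∈
        LinearMap.range ((f : B →ₗ[k] A).lTensor X.carrier) := by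
    intro t s
    induction t with
    | zero => simp
    | add a b ha hb =>
      simp only [map_add, LinearMap.add_apply]
      exact Submodule.add_mem _ ha hb
    | tmul v h =>
      induction s with
      | zero => simp
      | add a b ha hb =>
        simp only [map_add]
        exact Submodule.add_mem _ ha hb
      | tmul a s =>
        induction s with
        | zero => simp
        | add b c hb hc =>
          simp only [map_add, tmul_add]
          exact Submodule.add_mem _ hb hc
        | tmul b c =>
          refine ⟨X.act v (f b) ⊗ₜ (HopfAlgebra.antipode k a * h * c), ?_⟩
          simp [BialgHom.map_antipode_apply]
  obtain ⟨t, ht⟩ := hx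
  refine Submodule.mem_comap.2 ?_
  have hyd : X.coact (X.act x (f b)) = _ := X.yd x (f b)
  rw [hyd, ← comul_map f b, ← ht]
  exact key _ _

theorem resSubmodule_coact (hf : Function.Injective f) (x : X.carrier) (hx : x ∈ resSubmodule f X) :
    X.coact x ∈
      LinearMap.range (TensorProduct.map (resSubmodule f X).subtype (f : B →ₗ[k] A)) := by
  obtain ⟨t, ht⟩ := hx
  -- `resSubmodule f X` is the kernel of `ψ : X → X ⊗ A / f(B)`.
  let q : A →ₗ[k] A ⧸ LinearMap.range (f : B →ₗ[k] A) := Submodule.mkQ _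
  let ψ : X.carrier →ₗ[k] X.carrier ⊗[k] (A ⧸ LinearMap.range (f : B →ₗ[k] A)) :=
    q.lTensor X.carrier ∘ₗ X.coact
  have hqf : ∀ b, q (f b) = 0 := fun b =>
    (Submodule.Quotient.mk_eq_zero _).2 ⟨b, rfl⟩
  have hex : Function.Exact (f : B →ₗ[k] A) q := by
    intro a
    exact Submodule.Quotient.mk_eq_zero _
  have hex2 : Function.Exact ((f : B →ₗ[k] A).lTensor X.carrier) (q.lTensor X.carrier) :=
    Module.Flat.lTensor_exact X.carrier hex
  have hker : Function.Exact (resSubmodule f X).subtype ψ := by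
    intro y
    rw [show ψ y = q.lTensor X.carrier (X.coact y) from rfl, hex2]
    constructor
    · intro hy
      exact ⟨⟨y, hy⟩, rfl⟩
    · rintro ⟨z, rfl⟩
      exact z.2
  have hex3 := Module.Flat.rTensor_exact B hker
  have ht0 : ψ.rTensor B t = 0 := by
    apply Module.Flat.lTensor_preserves_injective_linearMap
      (M := X.carrier ⊗[k] (A ⧸ LinearMap.range (f : B →ₗ[k] A))) (f : B →ₗ[k] A) hf
    rw [map_zero]
    have h1 : ∀ t : X.carrier ⊗[k] B, (f : B →ₗ[k] A).lTensor _ (ψ.rTensor B t) =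
        (q.lTensor X.carrier).rTensor A
          (X.coact.rTensor A ((f : B →ₗ[k] A).lTensor X.carrier t)) := by
      intro t
      induction t with
      | zero => simp
      | add a b ha hb => simp only [map_add, ha, hb]
      | tmul v b => simp [ψ]
    have h2 : ∀ s : X.carrier ⊗[k] (A ⊗[k] A), (q.lTensor X.carrier).rTensor A
        ((TensorProduct.assoc k X.carrier A A).symm s) =
        (TensorProduct.assoc k X.carrier _ A).symm ((q.rTensor A).lTensor X.carrier s) := by
      intro s
      induction s with
      | zero => simp
      | add a b ha hb => simp only [map_add, ha, hb]
      | tmul v s =>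
        induction s with
        | zero => simp
        | add a b ha hb => simp only [map_add, ha, hb, tmul_add]
        | tmul a b => simp
    have h3 : ∀ t : X.carrier ⊗[k] B, (q.rTensor A).lTensor X.carrier
        (Coalgebra.comul.lTensor X.carrier ((f : B →ₗ[k] A).lTensor X.carrier t)) = 0 := by
      intro t
      induction t with
      | zero => simp
      | add a b ha hb => simp only [map_add, ha, hb, add_zero]
      | tmul v b =>
        have h4 : ∀ s : B ⊗[k] B, q.rTensor A
            (TensorProduct.map (f : B →ₗ[k] A) (f : B →ₗ[k] A) s) = 0 := by
          intro s
          induction s with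
          | zero => simp
          | add a b ha hb => simp only [map_add, ha, hb, add_zero]
          | tmul a b => simp [hqf]
        simp only [LinearMap.lTensor_tmul]
        erw [← CoalgHomClass.map_comp_comul_apply f b, h4, tmul_zero]
    rw [h1, ht, ← (TensorProduct.assoc k X.carrier A A).symm_apply_apply
      (X.coact.rTensor A (X.coact x)), h2]
    have hc : TensorProduct.assoc k X.carrier A A (X.coact.rTensor A (X.coact x)) = _ :=
      X.coaction.coassoc x
    rw [hc]
    have h5 := h3 t
    rw [ht] at h5
    erw [h5]
    simp
  obtain ⟨s, hs⟩ := (hex3 t).1 ht0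
  refine ⟨s, ?_⟩
  rw [← ht, ← hs]
  exact (LinearMap.congr_fun (LinearMap.lTensor_comp_rTensor _ _ _) s).symm

/-- The restriction `X^(B)` of a Yetter–Drinfeld module `X` over `A`, for a Hopf subalgebra
`f : B ↪ A`: the action and the coaction are those of `X`. -/
def resObj : YetterDrinfeld k B :=
  pull f hf X (resSubmodule f X) (resSubmodule_act f X) (resSubmodule_coact f X hf)

theorem map_resObj_coact (w : (resObj f hf X).carrier) :
    TensorProduct.map (resSubmodule f X).subtype (f : B →ₗ[k] A) ((resObj f hf X).coact w) =
      X.coact ((resSubmodule f X).subtype w) :=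
  map_pullCoact f hf X (resSubmodule f X) (resSubmodule_coact f X hf) w

theorem resSubmodule_map {X Y : YetterDrinfeld k A} (g : X ⟶ Y) (x : X.carrier)
    (hx : x ∈ resSubmodule f X) : g.lin x ∈ resSubmodule f Y := by
  obtain ⟨t, ht⟩ := hx
  refine ⟨g.lin.rTensor B t, ?_⟩
  rw [← g.map_coact, ← ht]
  exact (LinearMap.congr_fun (LinearMap.lTensor_comp_rTensor _ _ _) t).trans
    (LinearMap.congr_fun (LinearMap.rTensor_comp_lTensor _ _ _) t).symm

/-- The restriction of a morphism. -/
def resMap {X Y : YetterDrinfeld k A} (g : X ⟶ Y) : resObj f hf X ⟶ resObj f hf Y where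
  lin := g.lin.restrict (resSubmodule_map f g)
  map_act v a := Subtype.ext (g.map_act _ _)
  map_coact v := by
    apply map_injective _ (resSubmodule f Y).subtype_injective _ hf
    refine Eq.trans ?_ (map_resObj_coact f hf Y _).symm
    have h1 : ∀ t : (resSubmodule f X) ⊗[k] B,
        TensorProduct.map (resSubmodule f Y).subtype (f : B →ₗ[k] A)
          ((g.lin.restrict (resSubmodule_map f g)).rTensor B t) =
        g.lin.rTensor A (TensorProduct.map (resSubmodule f X).subtype (f : B →ₗ[k] A) t) := by
      intro t
      induction t with
      | zero => simp
      | add a b ha hb => simp only [map_add, ha, hb]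
      | tmul v b => simp
    refine (h1 _).trans ?_
    rw [map_resObj_coact f hf X v]
    exact g.map_coact _

/-- The restriction functor `X ↦ X^(B)` from Yetter–Drinfeld modules over `A` to those over `B`,
for a Hopf subalgebra `f : B ↪ A`. -/
def restriction : YetterDrinfeld k A ⥤ YetterDrinfeld k B where
  obj X := resObj f hf X
  map g := resMap f hf g
  map_id _ := hom_ext fun _ => rfl
  map_comp _ _ := hom_ext fun _ => rfl

end Restriction

end YetterDrinfeld

namespace YetterDrinfeld

/-! #### The abelian category of Yetter–Drinfeld modules -/

section Abelian

variable {k A : Type u} [Field k] [Ring A] [HopfAlgebra k A]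

/-- The quotient of a Yetter–Drinfeld module by a Yetter–Drinfeld submodule. -/
def quot (X : YetterDrinfeld k A) (W : Submodule k X.carrier)
    (hact : ∀ w ∈ W, ∀ a, X.act w a ∈ W)
    (hco : ∀ w ∈ W, W.mkQ.rTensor A (X.coact w) = 0) : YetterDrinfeld k A where
  carrier := X.carrier ⧸ W
  act := W.liftQ (((LinearMap.llcomp k A X.carrier (X.carrier ⧸ W)) W.mkQ) ∘ₗ X.act)
    (fun w hw => LinearMap.mem_ker.2 (LinearMap.ext fun a =>
      (Submodule.Quotient.mk_eq_zero W).2 (hact w hw a)))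
  act_one v := by
    obtain ⟨v, rfl⟩ := W.mkQ_surjective v
    exact congrArg W.mkQ (X.act_one v)
  act_mul v a b := by
    obtain ⟨v, rfl⟩ := W.mkQ_surjective v
    exact congrArg W.mkQ (X.act_mul v a b)
  coaction :=
    { coact := W.liftQ (W.mkQ.rTensor A ∘ₗ X.coact) (fun w hw => LinearMap.mem_ker.2 (hco w hw))
      coassoc := fun v => by
        obtain ⟨v, rfl⟩ := W.mkQ_surjective v
        refine (coassoc_left (BialgHom.id k A) W.mkQ X.coact _ (fun _ => rfl) v).symm.trans ?_
        rw [X.coaction.coassoc]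
        exact coassoc_right (BialgHom.id k A) W.mkQ X.coact _ (fun _ => rfl) v
      counit := fun v => by
        obtain ⟨v, rfl⟩ := W.mkQ_surjective v
        refine (counit_left (BialgHom.id k A) W.mkQ X.coact _ (fun _ => rfl) v).symm.trans ?_
        rw [X.coaction.counit]
        rfl }
  yd v a := by
    obtain ⟨v, rfl⟩ := W.mkQ_surjective v
    have h := congrArg (W.mkQ.rTensor A) (X.yd v a)
    refine h.trans ?_
    refine (ydTwist_map (BialgHom.id k A) W.mkQ X.act
      (W.liftQ (((LinearMap.llcomp k A X.carrier (X.carrier ⧸ W)) W.mkQ) ∘ₗ X.act)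
        (fun w hw => LinearMap.mem_ker.2 (LinearMap.ext fun a =>
          (Submodule.Quotient.mk_eq_zero W).2 (hact w hw a)))) (fun _ _ => rfl) _ _).trans ?_
    rw [comul_map]
    rfl

/-- The componentwise action on a direct sum. -/
def sumAct (X Y : YetterDrinfeld k A) :
    X.carrier × Y.carrier →ₗ[k] A →ₗ[k] X.carrier × Y.carrier :=
  (LinearMap.llcomp k A X.carrier (X.carrier × Y.carrier) (LinearMap.inl k _ _) ∘ₗ
      X.act ∘ₗ LinearMap.fst k _ _) +
    (LinearMap.llcomp k A Y.carrier (X.carrier × Y.carrier) (LinearMap.inr k _ _) ∘ₗ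
      Y.act ∘ₗ LinearMap.snd k _ _)

/-- The componentwise coaction on a direct sum. -/
def sumCoact (X Y : YetterDrinfeld k A) :
    X.carrier × Y.carrier →ₗ[k] (X.carrier × Y.carrier) ⊗[k] A :=
  ((LinearMap.inl k X.carrier Y.carrier).rTensor A ∘ₗ X.coact ∘ₗ LinearMap.fst k _ _) +
    ((LinearMap.inr k X.carrier Y.carrier).rTensor A ∘ₗ Y.coact ∘ₗ LinearMap.snd k _ _)

theorem sumAct_apply (X Y : YetterDrinfeld k A) (v : X.carrier × Y.carrier) (a : A) :
    sumAct X Y v a = (X.act v.1 a, Y.act v.2 a) := by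
  simp [sumAct]

theorem sumCoact_inl (X Y : YetterDrinfeld k A) (x : X.carrier) :
    sumCoact X Y (LinearMap.inl k _ _ x) = (LinearMap.inl k _ _).rTensor A (X.coact x) := by
  simp [sumCoact]

theorem sumCoact_inr (X Y : YetterDrinfeld k A) (y : Y.carrier) :
    sumCoact X Y (LinearMap.inr k _ _ y) = (LinearMap.inr k _ _).rTensor A (Y.coact y) := by
  simp [sumCoact]

theorem fst_sumCoact (X Y : YetterDrinfeld k A) (v : X.carrier × Y.carrier) :
    (LinearMap.fst k _ _).rTensor A (sumCoact X Y v) = X.coact v.1 := by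
  simp [sumCoact, ← LinearMap.rTensor_comp_apply]

theorem snd_sumCoact (X Y : YetterDrinfeld k A) (v : X.carrier × Y.carrier) :
    (LinearMap.snd k _ _).rTensor A (sumCoact X Y v) = Y.coact v.2 := by
  simp [sumCoact, ← LinearMap.rTensor_comp_apply]

theorem sum_eq (X Y : YetterDrinfeld k A) (v : X.carrier × Y.carrier) :
    v = LinearMap.inl k X.carrier Y.carrier v.1 + LinearMap.inr k X.carrier Y.carrier v.2 := by
  simp

theorem sumCoact_coassoc (X Y : YetterDrinfeld k A) (v : X.carrier × Y.carrier) :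
    TensorProduct.assoc k (X.carrier × Y.carrier) A A
      ((sumCoact X Y).rTensor A (sumCoact X Y v)) =
      Coalgebra.comul.lTensor (X.carrier × Y.carrier) (sumCoact X Y v) := by
  have hX := coassoc_left (BialgHom.id k A) (LinearMap.inl k X.carrier Y.carrier) X.coact
    (sumCoact X Y) (fun x => (sumCoact_inl X Y x).symm) v.1
  rw [X.coaction.coassoc, coassoc_right (BialgHom.id k A) (LinearMap.inl k X.carrier Y.carrier)
    X.coact (sumCoact X Y) (fun x => (sumCoact_inl X Y x).symm)] at hX
  have hY := coassoc_left (BialgHom.id k A) (LinearMap.inr k X.carrier Y.carrier) Y.coact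
    (sumCoact X Y) (fun x => (sumCoact_inr X Y x).symm) v.2
  rw [Y.coaction.coassoc, coassoc_right (BialgHom.id k A) (LinearMap.inr k X.carrier Y.carrier)
    Y.coact (sumCoact X Y) (fun x => (sumCoact_inr X Y x).symm)] at hY
  rw [sum_eq X Y v]
  simp only [map_add]
  rw [hX, hY]

theorem sum_yd (X Y : YetterDrinfeld k A) (v : X.carrier × Y.carrier) (a : A) :
    sumCoact X Y (sumAct X Y v a) = ydTwist (sumAct X Y) (sumCoact X Y v)
      (Coalgebra.comul.lTensor A (Coalgebra.comul a)) := by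
  have hX : sumCoact X Y (sumAct X Y (LinearMap.inl k X.carrier Y.carrier v.1) a) =
      ydTwist (sumAct X Y) (sumCoact X Y (LinearMap.inl k X.carrier Y.carrier v.1))
      (Coalgebra.comul.lTensor A (Coalgebra.comul a)) := by
    have h1 : sumAct X Y (LinearMap.inl k _ _ v.1) a = LinearMap.inl k _ _ (X.act v.1 a) := by
      simp [sumAct_apply]
    have h2 := ydTwist_map (BialgHom.id k A) (LinearMap.inl k X.carrier Y.carrier) X.act
      (sumAct X Y) (fun v b => by simp [sumAct_apply]) (X.coact v.1)
      (Coalgebra.comul.lTensor A (Coalgebra.comul a))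
    rw [comul_map] at h2
    rw [h1, sumCoact_inl, sumCoact_inl]
    exact (congrArg ((LinearMap.inl k X.carrier Y.carrier).rTensor A) (X.yd v.1 a)).trans h2
  have hY : sumCoact X Y (sumAct X Y (LinearMap.inr k X.carrier Y.carrier v.2) a) =
      ydTwist (sumAct X Y) (sumCoact X Y (LinearMap.inr k X.carrier Y.carrier v.2))
      (Coalgebra.comul.lTensor A (Coalgebra.comul a)) := by
    have h1 : sumAct X Y (LinearMap.inr k _ _ v.2) a = LinearMap.inr k _ _ (Y.act v.2 a) := by
      simp [sumAct_apply]
    have h2 := ydTwist_map (BialgHom.id k A) (LinearMap.inr k X.carrier Y.carrier) Y.act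
      (sumAct X Y) (fun v b => by simp [sumAct_apply]) (Y.coact v.2)
      (Coalgebra.comul.lTensor A (Coalgebra.comul a))
    rw [comul_map] at h2
    rw [h1, sumCoact_inr, sumCoact_inr]
    exact (congrArg ((LinearMap.inr k X.carrier Y.carrier).rTensor A) (Y.yd v.2 a)).trans h2
  rw [sum_eq X Y v]
  simp only [map_add, LinearMap.add_apply]
  rw [hX, hY]

theorem sumCoact_counit (X Y : YetterDrinfeld k A) (v : X.carrier × Y.carrier) :
    Coalgebra.counit.lTensor _ (sumCoact X Y v) = v ⊗ₜ[k] (1 : k) := by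
  have h : ∀ (φ : X.carrier →ₗ[k] X.carrier × Y.carrier) (t : X.carrier ⊗[k] A),
      Coalgebra.counit.lTensor _ (φ.rTensor A t) =
        φ.rTensor k (Coalgebra.counit.lTensor _ t) := fun φ t =>
    (LinearMap.congr_fun (LinearMap.lTensor_comp_rTensor _ _ _) t).trans
      (LinearMap.congr_fun (LinearMap.rTensor_comp_lTensor _ _ _) t).symm
  have h' : ∀ (φ : Y.carrier →ₗ[k] X.carrier × Y.carrier) (t : Y.carrier ⊗[k] A),
      Coalgebra.counit.lTensor _ (φ.rTensor A t) =
        φ.rTensor k (Coalgebra.counit.lTensor _ t) := fun φ t =>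
    (LinearMap.congr_fun (LinearMap.lTensor_comp_rTensor _ _ _) t).trans
      (LinearMap.congr_fun (LinearMap.rTensor_comp_lTensor _ _ _) t).symm
  simp only [sumCoact, LinearMap.add_apply, LinearMap.comp_apply, map_add, h, h',
    X.coaction.counit, Y.coaction.counit, LinearMap.rTensor_tmul]
  rw [← add_tmul]
  simp

/-- The direct sum of two Yetter–Drinfeld modules. -/
def directSum (X Y : YetterDrinfeld k A) : YetterDrinfeld k A where
  carrier := X.carrier × Y.carrier
  act := sumAct X Y
  act_one v := by simp [sumAct_apply, act_one]
  act_mul v a b := by simp [sumAct_apply, act_mul]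
  coaction :=
    { coact := sumCoact X Y
      coassoc := sumCoact_coassoc X Y
      counit := sumCoact_counit X Y }
  yd := sum_yd X Y

/-- The zero Yetter–Drinfeld module. -/
def zeroObj : YetterDrinfeld k A where
  carrier := PUnit
  act := 0
  act_one _ := rfl
  act_mul _ _ _ := rfl
  coaction :=
    { coact := 0
      coassoc := fun v => by simp
      counit := fun v => by rw [Subsingleton.elim v 0, zero_tmul]; simp }
  yd v a := by simp

variable {X Y Z : YetterDrinfeld k A}

/-- Lift a morphism through an injective one. -/
def liftInj (i : X ⟶ Y) (hi : Function.Injective i.lin) (g : Z ⟶ Y)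
    (h : ∀ z, g.lin z ∈ LinearMap.range i.lin) : Z ⟶ X :=
  let l : Z.carrier →ₗ[k] X.carrier :=
    (LinearEquiv.ofInjective i.lin hi).symm.toLinearMap ∘ₗ LinearMap.codRestrict _ g.lin h
  have hl : ∀ z, i.lin (l z) = g.lin z := fun z =>
    congrArg Subtype.val (LinearEquiv.apply_symm_apply (LinearEquiv.ofInjective i.lin hi)
      (LinearMap.codRestrict _ g.lin h z))
  have hl' : i.lin ∘ₗ l = g.lin := LinearMap.ext hl
  { lin := l
    map_act := fun z a => hi (by rw [hl, g.map_act, i.map_act, hl])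
    map_coact := fun z => by
      apply Module.Flat.rTensor_preserves_injective_linearMap (M := A) i.lin hi
      rw [i.map_coact, hl, ← LinearMap.rTensor_comp_apply, hl', g.map_coact] }

theorem liftInj_comp (i : X ⟶ Y) (hi : Function.Injective i.lin) (g : Z ⟶ Y)
    (h : ∀ z, g.lin z ∈ LinearMap.range i.lin) : liftInj i hi g h ≫ i = g :=
  hom_ext fun z => congrArg Subtype.val (LinearEquiv.apply_symm_apply
    (LinearEquiv.ofInjective i.lin hi) (LinearMap.codRestrict _ g.lin h z))

/-- Descend a morphism along a surjective one. -/
def descSurj (p : X ⟶ Y) (hp : Function.Surjective p.lin) (g : X ⟶ Z)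
    (h : LinearMap.ker p.lin ≤ LinearMap.ker g.lin) : Y ⟶ Z :=
  let l : Y.carrier →ₗ[k] Z.carrier :=
    (LinearMap.ker p.lin).liftQ g.lin h ∘ₗ
      (p.lin.quotKerEquivOfSurjective hp).symm.toLinearMap
  have hl : ∀ x, l (p.lin x) = g.lin x := fun x => by
    have : (p.lin.quotKerEquivOfSurjective hp).symm (p.lin x) = Submodule.Quotient.mk x := by
      rw [LinearEquiv.symm_apply_eq]; rfl
    simp [l, this]
  have hl' : l ∘ₗ p.lin = g.lin := LinearMap.ext hl
  { lin := l
    map_act := fun y a => by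
      obtain ⟨x, rfl⟩ := hp y
      rw [← p.map_act, hl, hl, g.map_act]
    map_coact := fun y => by
      obtain ⟨x, rfl⟩ := hp y
      rw [← p.map_coact, hl, ← LinearMap.rTensor_comp_apply, hl', g.map_coact] }

theorem comp_descSurj (p : X ⟶ Y) (hp : Function.Surjective p.lin) (g : X ⟶ Z)
    (h : LinearMap.ker p.lin ≤ LinearMap.ker g.lin) : p ≫ descSurj p hp g h = g :=
  hom_ext fun x => by
    have : (p.lin.quotKerEquivOfSurjective hp).symm (p.lin x) = Submodule.Quotient.mk x := by
      rw [LinearEquiv.symm_apply_eq]; rfl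
    simp [descSurj, this]

/-- An injective morphism onto the kernel of `g` is a categorical kernel of `g`. -/
def isLimitOfExact (i : X ⟶ Y) (g : Y ⟶ Z) (w : i ≫ g = 0) (hi : Function.Injective i.lin)
    (h : LinearMap.ker g.lin ≤ LinearMap.range i.lin) : IsLimit (KernelFork.ofι i w) :=
  KernelFork.IsLimit.ofι i w
    (fun {_} t ht => liftInj i hi t fun z => h (LinearMap.congr_fun (congrArg Hom.lin ht) z))
    (fun {_} t _ => liftInj_comp i hi t _)
    (fun {_} t _ _ hm => hom_ext fun z => hi
      ((LinearMap.congr_fun (congrArg Hom.lin hm) z).trans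
        (LinearMap.congr_fun (congrArg Hom.lin (liftInj_comp i hi t _)) z).symm))

/-- A surjective morphism whose kernel is the range of `f` is a categorical cokernel of `f`. -/
def isColimitOfExact (f : X ⟶ Y) (p : Y ⟶ Z) (w : f ≫ p = 0) (hp : Function.Surjective p.lin)
    (h : LinearMap.ker p.lin ≤ LinearMap.range f.lin) : IsColimit (CokernelCofork.ofπ p w) :=
  CokernelCofork.IsColimit.ofπ p w
    (fun {_} t ht => descSurj p hp t (by
      intro y hy
      obtain ⟨x, rfl⟩ := h hy
      exact LinearMap.congr_fun (congrArg Hom.lin ht) x))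
    (fun {_} t _ => comp_descSurj p hp t _)
    (fun {_} t ht _ hm => hom_ext fun z => by
      obtain ⟨y, rfl⟩ := hp z
      have hle : LinearMap.ker p.lin ≤ LinearMap.ker t.lin := by
        intro y hy
        obtain ⟨x, rfl⟩ := h hy
        exact LinearMap.congr_fun (congrArg Hom.lin ht) x
      exact (LinearMap.congr_fun (congrArg Hom.lin hm) y).trans
        (LinearMap.congr_fun (congrArg Hom.lin (comp_descSurj p hp t hle)) y).symm)

/-- A Yetter–Drinfeld submodule. -/
def sub (X : YetterDrinfeld k A) (W : Submodule k X.carrier)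
    (hact : ∀ w ∈ W, ∀ a, X.act w a ∈ W)
    (hco : ∀ w ∈ W, X.coact w ∈ LinearMap.range (W.subtype.rTensor A)) : YetterDrinfeld k A :=
  pull (BialgHom.id k A) Function.injective_id X W hact hco

/-- The inclusion of a Yetter–Drinfeld submodule. -/
def subι (X : YetterDrinfeld k A) (W : Submodule k X.carrier)
    (hact : ∀ w ∈ W, ∀ a, X.act w a ∈ W)
    (hco : ∀ w ∈ W, X.coact w ∈ LinearMap.range (W.subtype.rTensor A)) : sub X W hact hco ⟶ X where
  lin := W.subtype
  map_act _ _ := rfl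
  map_coact v := map_pullCoact (BialgHom.id k A) Function.injective_id X W hco v

/-- The projection to a quotient. -/
def quotπ (X : YetterDrinfeld k A) (W : Submodule k X.carrier)
    (hact : ∀ w ∈ W, ∀ a, X.act w a ∈ W)
    (hco : ∀ w ∈ W, W.mkQ.rTensor A (X.coact w) = 0) : X ⟶ quot X W hact hco where
  lin := W.mkQ
  map_act _ _ := rfl
  map_coact _ := rfl

theorem ker_act (f : X ⟶ Y) : ∀ w ∈ LinearMap.ker f.lin, ∀ a, X.act w a ∈ LinearMap.ker f.lin :=
  fun w hw a => by
    rw [LinearMap.mem_ker] at hw ⊢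
    rw [f.map_act, hw]
    simp

theorem ker_coact (f : X ⟶ Y) : ∀ w ∈ LinearMap.ker f.lin,
    X.coact w ∈ LinearMap.range ((LinearMap.ker f.lin).subtype.rTensor A) := fun w hw => by
  have hex : Function.Exact (LinearMap.ker f.lin).subtype f.lin := LinearMap.exact_subtype_ker_map _
  refine (Module.Flat.rTensor_exact A hex _).1 ?_
  rw [f.map_coact, LinearMap.mem_ker.1 hw, map_zero]

theorem range_act (f : X ⟶ Y) :
    ∀ w ∈ LinearMap.range f.lin, ∀ a, Y.act w a ∈ LinearMap.range f.lin := by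
  rintro _ ⟨x, rfl⟩ a
  exact ⟨X.act x a, f.map_act x a⟩

theorem range_coact (f : X ⟶ Y) : ∀ w ∈ LinearMap.range f.lin,
    Y.coact w ∈ LinearMap.range ((LinearMap.range f.lin).subtype.rTensor A) := by
  rintro _ ⟨x, rfl⟩
  refine ⟨f.lin.rangeRestrict.rTensor A (X.coact x), ?_⟩
  rw [← f.map_coact, ← LinearMap.rTensor_comp_apply]
  rfl

theorem range_coact' (f : X ⟶ Y) : ∀ w ∈ LinearMap.range f.lin,
    (LinearMap.range f.lin).mkQ.rTensor A (Y.coact w) = 0 := by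
  rintro _ ⟨x, rfl⟩
  rw [← f.map_coact, ← LinearMap.rTensor_comp_apply, LinearMap.range_mkQ_comp]
  simp

/-- Kernels, cokernels and images, computed on underlying vector spaces. -/
def abelianStruct (f : X ⟶ Y) : Abelian.AbelianStruct f :=
  have w1 : subι X _ (ker_act f) (ker_coact f) ≫ f = 0 := hom_ext fun v => v.2
  have w2 : f ≫ quotπ Y _ (range_act f) (range_coact' f) = 0 := hom_ext fun v =>
    (Submodule.Quotient.mk_eq_zero _).2 ⟨v, rfl⟩
  have inj : Function.Injective (subι Y _ (range_act f) (range_coact f)).lin :=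
    Submodule.subtype_injective _
  let π : X ⟶ sub Y _ (range_act f) (range_coact f) :=
    liftInj (subι Y _ (range_act f) (range_coact f)) inj f fun z => ⟨⟨f.lin z, z, rfl⟩, rfl⟩
  have hπ : ∀ x, (π.lin x : LinearMap.range f.lin).1 = f.lin x := fun x =>
    LinearMap.congr_fun (congrArg Hom.lin (liftInj_comp _ inj f _)) x
  { kernelFork := KernelFork.ofι _ w1
    isLimitKernelFork := isLimitOfExact _ _ w1 (Submodule.subtype_injective _)
      fun x hx => ⟨⟨x, hx⟩, rfl⟩
    cokernelCofork := CokernelCofork.ofπ _ w2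
    isColimitCokernelCofork := isColimitOfExact _ _ w2 (Submodule.mkQ_surjective _)
      fun x hx => (Submodule.Quotient.mk_eq_zero _).1 hx
    image := sub Y _ (range_act f) (range_coact f)
    imageπ := π
    ι_imageπ := hom_ext fun v => Subtype.ext ((hπ _).trans v.2)
    imageIsCokernel := isColimitOfExact _ _ _
      (fun y => by
        obtain ⟨_, x, rfl⟩ := y
        exact ⟨x, Subtype.ext (hπ x)⟩)
      (fun x hx => ⟨⟨x, (hπ x).symm.trans (congrArg Subtype.val hx)⟩, rfl⟩)
    imageι := subι Y _ (range_act f) (range_coact f)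
    imageι_π := hom_ext fun v => (Submodule.Quotient.mk_eq_zero _).2 v.2
    imageIsKernel := isLimitOfExact _ _ _ inj
      fun y hy => ⟨⟨y, (Submodule.Quotient.mk_eq_zero _).1 hy⟩, rfl⟩
    fac := liftInj_comp _ inj f _ }

instance : HasZeroObject (YetterDrinfeld k A) :=
  ⟨⟨zeroObj, fun _ => ⟨⟨⟨0⟩, fun f => hom_ext fun v => by
      rw [show v = 0 from Subsingleton.elim (α := PUnit) _ _]; simp⟩⟩,
    fun _ => ⟨⟨⟨0⟩, fun f => hom_ext fun v => Subsingleton.elim (α := PUnit) _ _⟩⟩⟩⟩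

/-- The biproduct bicone on the direct sum. -/
def sumBicone (X Y : YetterDrinfeld k A) : BinaryBicone X Y where
  pt := directSum X Y
  fst := ⟨LinearMap.fst k _ _, fun v a => congrArg Prod.fst (sumAct_apply X Y v a),
    fst_sumCoact X Y⟩
  snd := ⟨LinearMap.snd k _ _, fun v a => congrArg Prod.snd (sumAct_apply X Y v a),
    snd_sumCoact X Y⟩
  inl := ⟨LinearMap.inl k _ _, fun v a => ((sumAct_apply X Y (v, 0) a).trans (by simp only [map_zero]; rfl)).symm,
    fun v => (sumCoact_inl X Y v).symm⟩
  inr := ⟨LinearMap.inr k _ _, fun v a => ((sumAct_apply X Y (0, v) a).trans (by simp only [map_zero]; rfl)).symm,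
    fun v => (sumCoact_inr X Y v).symm⟩
  inl_fst := hom_ext fun _ => rfl
  inl_snd := hom_ext fun _ => rfl
  inr_fst := hom_ext fun _ => rfl
  inr_snd := hom_ext fun _ => rfl

instance : HasBinaryBiproducts (YetterDrinfeld k A) :=
  ⟨fun X Y => hasBinaryBiproduct_of_total (sumBicone X Y) (hom_ext fun v =>
    (Prod.ext (add_zero v.1) (zero_add v.2) : ((v.1, 0) + (0, v.2) : X.carrier × Y.carrier) = v))⟩

instance : HasFiniteProducts (YetterDrinfeld k A) :=
  hasFiniteProducts_of_has_binary_and_terminal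

/-- The category of Yetter–Drinfeld modules is abelian. -/
instance : Abelian (YetterDrinfeld k A) := Abelian.mk' fun _ _ f => ⟨abelianStruct f⟩

instance : HasExt.{u + 1} (YetterDrinfeld k A) := HasExt.standard _

end Abelian

end YetterDrinfeld

/-! ### Gerstenhaber–Schack cohomology -/

section GS

open YetterDrinfeld

variable {k A : Type u} [Field k] [Ring A] [HopfAlgebra k A]

/-- The Gerstenhaber–Schack cohomology `H^n_GS(A, M) = Ext^n(k, M)`, the extensions being taken in
the abelian category of Yetter–Drinfeld modules over `A`. It is a vector space over `k`. -/
abbrev HGS (n : ℕ) (M : YetterDrinfeld k A) : Type (u + 1) :=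
  Abelian.Ext.{u + 1} (trivialModule k A) M n

/-- Functoriality of `H^n_GS(A, M)` in `M`. -/
def HGS.map (n : ℕ) {M N : YetterDrinfeld k A} (f : M ⟶ N) : HGS n M →ₗ[k] HGS n N :=
  (Abelian.Ext.mk₀ f).postcompOfLinear k (trivialModule k A) (add_zero n)

end GS

section FreeProduct

variable (k A B : Type u) [Field k] [Ring A] [Ring B] [HopfAlgebra k A] [HopfAlgebra k B]

/-- The restriction functor `M ↦ M^(A)` from Yetter–Drinfeld modules over `A * B` to those
over `A`. -/
abbrev resLeft : YetterDrinfeld k (FreeProd k A B) ⥤ YetterDrinfeld k A :=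
  YetterDrinfeld.restriction (FreeProd.inlBialg k A B) (FreeProd.inlBialg_injective k A B)

/-- The restriction functor `M ↦ M^(B)` from Yetter–Drinfeld modules over `A * B` to those
over `B`. -/
abbrev resRight : YetterDrinfeld k (FreeProd k A B) ⥤ YetterDrinfeld k B :=
  YetterDrinfeld.restriction (FreeProd.inrBialg k A B) (FreeProd.inrBialg_injective k A B)

end FreeProduct

end

/-! Write H = A * B. The isomorphism is the comparison map Ext_H(k, M) → Ext_A(k, M^(A)) × Ext_B(k,
M^(B)) obtained by applying the two restriction functors and precomposing with the identification of
k with its restriction (`mapAlongPair`). Three facts make it bijective in degrees at least 2.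

Restriction is exact. Cosemisimplicity gives A and B two-sided invariant Haar functionals. H is
spanned by 1 and the alternating products of elements of their kernels, and the comultiplication
sends such a reduced word to tensors of words of the same pattern. A functional φ on A therefore
extends to a functional l on H, zero on all other reduced words, for which every x₍₁₎ l(x₍₂₎) has
the form a₍₁₎ φ(a₍₂₎) with a in A. With φ = ε the map m ↦ m₍₀₎ l(m₍₁₎) is a natural projection of M
onto M^(A); with φ the Haar functional it is a natural projection onto the coinvariants. So
restriction and coinvariants are both exact.

There are enough injectives that stay injective. M embeds into the cofree Yetter–Drinfeld module I =
N ⊗ H on the coinduced module N = Hom(H, M). The restriction of I to A is cofree on N viewed as an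
A-module, and N is injective over A as well as over H. The connecting maps then carry bijectivity
from degree n + 1 for I/M to degree n + 2 for M (`mapAlongPair_bijective_succ`).

Degree 1 is settled by coinvariants. Call a module good if each coinvariant is the sum of a
coinvariant on which A acts through ε and one on which B does. An element that is invariant for both
factors is invariant for H, because A and B generate H. Hence, for 0 → X₁ → X₂ → X₃ → 0 with X₂
injective together with its restrictions, goodness of X₁ gives injectivity of the comparison for X₁
in degree 1, and goodness of X₂ gives surjectivity. The cofree modules above are good, since every n
in N is a sum of an A-invariant and a B-invariant element, and quotients of good modules are good.
So I/M is good, the comparison for I/M is bijective in degree 1, and that for M in degree 2. The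
last two properties of N, injectivity over A and the splitting into invariants, both come from
`IsAlgCoprod.exists_equivariant_sub_invariant`. -/

noncomputable section

/-! ### Haar functionals on cosemisimple bialgebras -/

section Haar

variable {k A : Type u} [Field k] [Ring A] [Bialgebra k A]

/-- The regular comodule. -/
def regularCoaction (k A : Type u) [Field k] [Ring A] [Bialgebra k A] : Coaction k A A where
  coact := Coalgebra.comul
  coassoc := Coalgebra.coassoc_apply
  counit := Coalgebra.lTensor_counit_comul

/-- The functional `h` is right invariant: `h(a₍₁₎) a₍₂₎ = h(a) 1`. -/
def RightInvariant (h : A →ₗ[k] k) : Prop :=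
  ∀ a, h.rTensor A (Coalgebra.comul a) = h a ⊗ₜ[k] (1 : A)

/-- The functional `h` is left invariant: `a₍₁₎ h(a₍₂₎) = h(a) 1`. -/
def LeftInvariant (h : A →ₗ[k] k) : Prop :=
  ∀ a, h.lTensor A (Coalgebra.comul a) = (1 : A) ⊗ₜ[k] h a

/-- The line k · 1 is a subcomodule of the regular comodule. A functional that vanishes on a
complementary subcomodule and takes the value 1 at 1 is invariant on both summands. -/
theorem exists_rightInvariant (hA : IsCosemisimple k A) :
    ∃ h : A →ₗ[k] k, h 1 = 1 ∧ RightInvariant h := by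
  obtain ⟨W, hW, hc⟩ := hA A (regularCoaction k A) (k ∙ (1 : A)) (by
    intro w hw
    obtain ⟨c, rfl⟩ := Submodule.mem_span_singleton.1 hw
    refine ⟨⟨c • 1, hw⟩ ⊗ₜ 1, ?_⟩
    simp [regularCoaction, Algebra.TensorProduct.one_def, smul_tmul'])
  have h1W : (1 : A) ∉ W := fun hmem => by
    have : (1 : A) ∈ (k ∙ (1 : A)) ⊓ W := ⟨Submodule.mem_span_singleton_self 1, hmem⟩
    rw [hc.inf_eq_bot, Submodule.mem_bot] at this
    have h01 := congrArg (Coalgebra.counit (R := k)) this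
    simp at h01
  obtain ⟨f, hf1, hfW⟩ := Submodule.exists_dual_map_eq_bot_of_notMem h1W inferInstance
  let h : A →ₗ[k] k := (f 1)⁻¹ • f
  have h1 : h 1 = 1 := inv_mul_cancel₀ hf1
  have hW0 : ∀ w ∈ W, h w = 0 := fun w hw => by
    have : f w ∈ W.map f := ⟨w, hw, rfl⟩
    rw [hfW, Submodule.mem_bot] at this
    simp [h, this]
  refine ⟨h, h1, fun a => ?_⟩
  have ha : a ∈ (k ∙ (1 : A)) ⊔ W := hc.sup_eq_top ▸ Submodule.mem_top
  obtain ⟨x, hx, w, hw, rfl⟩ := Submodule.mem_sup.1 ha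
  obtain ⟨c, rfl⟩ := Submodule.mem_span_singleton.1 hx
  obtain ⟨t, ht⟩ := hW w hw
  have hw' : h.rTensor A (Coalgebra.comul w) = 0 := by
    rw [show Coalgebra.comul w = W.subtype.rTensor A t from ht.symm, ← LinearMap.rTensor_comp_apply,
      show h ∘ₗ W.subtype = 0 from LinearMap.ext fun w => hW0 w w.2]
    simp
  rw [map_add, map_add, hw', map_add, hW0 w hw]
  simp [Algebra.TensorProduct.one_def, h1, smul_tmul']

/-- A right invariant functional which vanishes at `1` is zero. -/
theorem RightInvariant.eq_zero (hA : IsCosemisimple k A) {d : A →ₗ[k] k} (hd : RightInvariant d)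
    (h1 : d 1 = 0) : d = 0 := by
  -- The kernel of an invariant functional is a subcomodule. Its complement `W`, on which `d` is
  -- injective, turns out to be zero.
  obtain ⟨W, hW, hc⟩ := hA A (regularCoaction k A) (LinearMap.ker d) (by
    intro w hw
    refine (Module.Flat.rTensor_exact A (LinearMap.exact_subtype_ker_map d) _).1 ?_
    refine (hd w).trans ?_
    rw [LinearMap.mem_ker.1 hw, zero_tmul])
  have hinj : Function.Injective (d ∘ₗ W.subtype) := by
    rw [← LinearMap.ker_eq_bot, LinearMap.ker_eq_bot']
    intro w hw
    have : (w : A) ∈ LinearMap.ker d ⊓ W := ⟨hw, w.2⟩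
    rw [hc.inf_eq_bot] at this
    exact Subtype.ext this
  have hbot : W = ⊥ := by
    refine (Submodule.eq_bot_iff W).2 fun c hcW => ?_
    obtain ⟨t, ht⟩ := hW c hcW
    have ht' : Coalgebra.comul c = W.subtype.rTensor A t := ht.symm
    -- The injective map d ⊗ id on W ⊗ A sends both sides to d(c) ⊗ 1, by invariance. Thus Δ(c) = c
    -- ⊗ 1, so c = ε(c) 1 is killed by `d` and must vanish.
    have key : t = (⟨c, hcW⟩ : W) ⊗ₜ[k] (1 : A) := by
      apply Module.Flat.rTensor_preserves_injective_linearMap (M := A) _ hinj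
      rw [LinearMap.rTensor_comp_apply, ← ht']
      refine (hd c).trans ?_
      simp
    rw [key] at ht'
    have h2 := congrArg (TensorProduct.lid k A ∘ Coalgebra.counit.rTensor A) ht'
    simp only [Function.comp_apply, Coalgebra.rTensor_counit_comul] at h2
    simp only [LinearMap.rTensor_tmul, lid_tmul, Submodule.subtype_apply, one_smul] at h2
    have h3 : d c = 0 := by rw [h2, map_smul, h1, smul_zero]
    have : (⟨c, hcW⟩ : W) = 0 := hinj (by simpa using h3)
    exact congrArg Subtype.val this
  have hk : LinearMap.ker d = ⊤ := by rw [← hc.sup_eq_top, hbot, sup_bot_eq]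
  exact LinearMap.ker_eq_top.1 hk

/-- For every functional φ, the functional a ↦ φ(a₍₁₎) h(a₍₂₎) − φ(1) h(a) is right invariant and
vanishes at 1, so `RightInvariant.eq_zero` kills it. Functionals separate the points of A. -/
theorem RightInvariant.leftInvariant (hA : IsCosemisimple k A) {h : A →ₗ[k] k}
    (hh : RightInvariant h) (h1 : h 1 = 1) : LeftInvariant h := by
  have key : ∀ (φ : A →ₗ[k] k) (a : A),
      TensorProduct.lid k k (TensorProduct.map φ h (Coalgebra.comul a)) = φ 1 * h a := by
    intro φ
    let d : A →ₗ[k] k := (TensorProduct.lid k k).toLinearMap ∘ₗ TensorProduct.map φ h ∘ₗ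
      Coalgebra.comul - φ 1 • h
    have hd : RightInvariant d := by
      intro a
      have e1 : ∀ t : A ⊗[k] A, ((TensorProduct.lid k k).toLinearMap ∘ₗ
          TensorProduct.map φ h ∘ₗ Coalgebra.comul).rTensor A t =
          TensorProduct.lid k (k ⊗[k] A) (TensorProduct.map φ (h.rTensor A)
            (TensorProduct.assoc k A A A (Coalgebra.comul.rTensor A t))) := by
        intro t
        induction t with
        | zero => simp
        | add x y hx hy => simp only [map_add, hx, hy]
        | tmul x y =>
          simp only [LinearMap.rTensor_tmul, LinearMap.comp_apply, LinearEquiv.coe_coe]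
          generalize (Coalgebra.comul x : A ⊗[k] A) = s
          induction s with
          | zero => simp
          | add x y hx hy => simp only [map_add, hx, hy, add_tmul]
          | tmul x z => simp [smul_tmul']
      have e2 : ∀ t : A ⊗[k] A, TensorProduct.map φ (h.rTensor A) (Coalgebra.comul.lTensor A t) =
          TensorProduct.map φ ((TensorProduct.mk k k A).flip 1 ∘ₗ h) t := by
        intro t
        induction t with
        | zero => simp
        | add x y hx hy => simp only [map_add, hx, hy]
        | tmul x y => simp [hh y]
      have e3 : ∀ t : A ⊗[k] A, TensorProduct.lid k (k ⊗[k] A)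
          (TensorProduct.map φ ((TensorProduct.mk k k A).flip 1 ∘ₗ h) t) =
          TensorProduct.lid k k (TensorProduct.map φ h t) ⊗ₜ 1 := by
        intro t
        induction t with
        | zero => simp
        | add x y hx hy => simp only [map_add, hx, hy, add_tmul]
        | tmul x y => simp [smul_tmul']
      rw [LinearMap.rTensor_sub, LinearMap.sub_apply, e1, Coalgebra.coassoc_apply, e2, e3,
        LinearMap.rTensor_smul, LinearMap.smul_apply, hh a]
      simp [d, sub_tmul, smul_tmul']
    have hz := hd.eq_zero hA (by simp [d, Algebra.TensorProduct.one_def, h1])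
    intro a
    have := LinearMap.congr_fun hz a
    simpa [d, sub_eq_zero] using this
  intro a
  apply (TensorProduct.rid k A).injective
  rw [← sub_eq_zero, ← Module.forall_dual_apply_eq_zero_iff k]
  intro φ
  have e : ∀ t : A ⊗[k] A, φ (TensorProduct.rid k A (h.lTensor A t)) =
      TensorProduct.lid k k (TensorProduct.map φ h t) := by
    intro t
    induction t with
    | zero => simp
    | add x y hx hy => simp only [map_add, hx, hy]
    | tmul x y => simp [mul_comm]
  rw [map_sub, e, key]
  simp [mul_comm]

end Haar

/-! ### Reduced words in a coproduct of algebras -/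

section Words

/-- Alternating words in two alphabets `I` and `J`. The words in `AltWord I J true` do not start
with a letter of `I`, those in `AltWord I J false` do not start with a letter of `J`. -/
inductive AltWord (I J : Type u) : Bool → Type u
  | nil (b : Bool) : AltWord I J b
  | consLeft (x : I) (w : AltWord I J true) : AltWord I J false
  | consRight (y : J) (w : AltWord I J false) : AltWord I J true

/-- Move a letter of `I` into the word, and take a letter of `J` off it. -/
def AltWord.swapLetter {I J : Type u} : AltWord I J true × Option I → AltWord I J false × Option J
  | (w, some x) => (.consLeft x w, none)
  | (.nil _, none) => (.nil _, none)
  | (.consRight y w, none) => (w, some y)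

/-- Move a letter of `J` into the word, and take a letter of `I` off it. -/
def AltWord.unswapLetter {I J : Type u} : AltWord I J false × Option J → AltWord I J true × Option I
  | (w, some y) => (.consRight y w, none)
  | (.nil _, none) => (.nil _, none)
  | (.consLeft x w, none) => (w, some x)

/-- Both sides parametrize all alternating words. -/
def AltWord.letterEquiv (I J : Type u) :
    AltWord I J true × Option I ≃ AltWord I J false × Option J where
  toFun := swapLetter
  invFun := unswapLetter
  left_inv := by rintro ⟨w, _ | x⟩ <;> [cases w; skip] <;> rfl
  right_inv := by rintro ⟨w, _ | x⟩ <;> [cases w; skip] <;> rfl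

variable {k : Type u} [Field k]

/-- A = ker h ⊕ k · 1. The basis elements of the kernel serve as letters, and `none`, standing for
1, as the absence of a letter. -/
theorem exists_basis_of_unital_functional {A : Type u} [Ring A] [Algebra k A] (h : A →ₗ[k] k)
    (h1 : h 1 = 1) :
    ∃ (I : Type u) (b : Module.Basis (Option I) k A), b none = 1 ∧ ∀ x, h (b (some x)) = 0 := by
  let e : (LinearMap.ker h × k) ≃ₗ[k] A :=
    { toFun := fun p => p.1 + p.2 • 1
      map_add' := fun p q => by simp only [Prod.fst_add, Submodule.coe_add, Prod.snd_add, add_smul]; abel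
      map_smul' := fun c p => by simp [mul_smul]
      invFun := fun a => (⟨a - h a • 1, by simp [h1]⟩, h a)
      left_inv := fun p => by
        have : h p.1 = 0 := p.1.2
        ext <;> simp [h1, this]
      right_inv := fun a => by simp }
  let b := (((Module.Basis.ofVectorSpace k (LinearMap.ker h)).prod
    (Module.Basis.singleton PUnit.{u + 1} k)).map e).reindex (Equiv.optionEquivSumPUnit _).symm
  refine ⟨_, b, ?_, fun x => ?_⟩
  · simp [b, e]
  · simp [b, e]

/-! ### The space with basis the alternating words, as a free module over either factor -/

section Transport

variable {A B : Type u} [Ring A] [Ring B] [Algebra k A] [Algebra k B]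
  {I J X Y : Type u} (bA : Module.Basis (Option I) k A) (bB : Module.Basis (Option J) k B)
  (E : X × Option I ≃ Y × Option J)

/-- The isomorphism of free modules induced by a bijection of bases. -/
def fockEquiv : (X →₀ A) ≃ₗ[k] (Y →₀ B) :=
  ((Finsupp.basis (fun _ : X => bA)).reindex (Equiv.sigmaEquivProd _ _)).equiv
    ((Finsupp.basis (fun _ : Y => bB)).reindex (Equiv.sigmaEquivProd _ _)) E

theorem fockEquiv_single (x : X) (o : Option I) :
    fockEquiv bA bB E (Finsupp.single x (bA o)) =
      Finsupp.single (E (x, o)).1 (bB (E (x, o)).2) := by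
  have := ((Finsupp.basis (fun _ : X => bA)).reindex (Equiv.sigmaEquivProd _ _)).equiv_apply
    (b' := (Finsupp.basis (fun _ : Y => bB)).reindex (Equiv.sigmaEquivProd _ _)) (x, o) E
  simpa [fockEquiv] using this

theorem fockEquiv_symm : (fockEquiv bA bB E).symm = fockEquiv bB bA E.symm := rfl

/-- A vector with coordinates in ker h involves only basis vectors whose `Option I` component is a
genuine letter. By `hE` the bijection leaves no letter in the other component and never produces the
index y₀ (the empty word in the application), so the new coordinates are multiples of 1 and vanish
at y₀. -/
theorem fockEquiv_of_forall_eq_zero {h : A →ₗ[k] k} (h1 : h 1 = 1) (hb1 : bA none = 1)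
    (hb : ∀ x, h (bA (some x)) = 0) (hb1' : bB none = 1) (y₀ : Y)
    (hE : ∀ x o, (E (x, some o)).2 = none ∧ (E (x, some o)).1 ≠ y₀) (f : X →₀ A)
    (hf : ∀ x, h (f x) = 0) :
    (∀ y, fockEquiv bA bB E f y ∈ k ∙ (1 : B)) ∧ fockEquiv bA bB E f y₀ = 0 := by
  classical
  let S : Submodule k (Y →₀ B) :=
    { carrier := {g | (∀ y, g y ∈ k ∙ (1 : B)) ∧ g y₀ = 0}
      add_mem' := fun ha hb => ⟨fun y => Submodule.add_mem _ (ha.1 y) (hb.1 y), by simp [ha.2, hb.2]⟩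
      zero_mem' := ⟨fun y => Submodule.zero_mem _, rfl⟩
      smul_mem' := fun c g hg => ⟨fun y => Submodule.smul_mem _ c (hg.1 y), by simp [hg.2]⟩ }
  change fockEquiv bA bB E f ∈ S
  rw [← Finsupp.sum_single f, map_finsuppSum]
  refine Submodule.sum_mem _ fun x _ => ?_
  have hr : h (f x) = bA.repr (f x) none := by
    conv_lhs => rw [← bA.linearCombination_repr (f x)]
    rw [Finsupp.linearCombination_apply, map_finsuppSum, Finsupp.sum_eq_single none]
    · simp [hb1, h1]
    · rintro (_ | o) _ ho
      · exact absurd rfl ho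
      · simp [hb]
    · simp
  rw [hf x] at hr
  rw [← bA.linearCombination_repr (f x), Finsupp.linearCombination_apply, Finsupp.sum]
  beta_reduce
  rw [Finsupp.single_finsetSum, map_sum]
  refine Submodule.sum_mem _ fun o _ => ?_
  rw [← Finsupp.smul_single, map_smul]
  rcases o with _ | o
  · rw [← hr, zero_smul]; exact S.zero_mem
  · refine S.smul_mem _ ?_
    rw [fockEquiv_single, (hE x o).1, hb1']
    refine ⟨fun y => ?_, Finsupp.single_eq_of_ne (hE x o).2.symm⟩
    rw [Finsupp.single_apply]
    split_ifs
    · exact Submodule.mem_span_singleton_self 1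
    · exact Submodule.zero_mem _

end Transport

/-- The algebra `H` is the coproduct of `A` and `B`. -/
structure IsAlgCoprod {A B H : Type u} [Ring A] [Ring B] [Ring H] [Algebra k A] [Algebra k B]
    [Algebra k H] (i : A →ₐ[k] H) (j : B →ₐ[k] H) : Prop where
  exists_lift : ∀ (C : Type u) [Ring C] [Algebra k C] (f : A →ₐ[k] C) (g : B →ₐ[k] C),
    ∃ φ : H →ₐ[k] C, (∀ a, φ (i a) = f a) ∧ ∀ b, φ (j b) = g b
  induction : ∀ p : H → Prop, (∀ a, p (i a)) → (∀ b, p (j b)) → (∀ x y, p x → p y → p (x + y)) →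
    (∀ x y, p x → p y → p (x * y)) → ∀ x, p x

variable {A B H : Type u} [Ring A] [Ring B] [Ring H] [Algebra k A] [Algebra k B] [Algebra k H]
  {i : A →ₐ[k] H} {j : B →ₐ[k] H}

theorem IsAlgCoprod.symm (hij : IsAlgCoprod i j) : IsAlgCoprod j i where
  exists_lift C _ _ f g := by
    obtain ⟨φ, h1, h2⟩ := hij.exists_lift C g f
    exact ⟨φ, h2, h1⟩
  induction p h1 h2 := hij.induction p h2 h1

/-- Nonempty alternating products of elements of the kernels of `hA` and `hB`; those indexed by
`true` start with an element of `A`, those indexed by `false` with an element of `B`. -/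
inductive Reduced (i : A →ₐ[k] H) (j : B →ₐ[k] H) (hA : A →ₗ[k] k) (hB : B →ₗ[k] k) :
    Bool → H → Prop
  | left {a : A} (ha : hA a = 0) : Reduced i j hA hB true (i a)
  | right {b : B} (hb : hB b = 0) : Reduced i j hA hB false (j b)
  | mulLeft {a : A} (ha : hA a = 0) {x : H} (hx : Reduced i j hA hB false x) :
      Reduced i j hA hB true (i a * x)
  | mulRight {b : B} (hb : hB b = 0) {x : H} (hx : Reduced i j hA hB true x) :
      Reduced i j hA hB false (j b * x)

variable {hA : A →ₗ[k] k} {hB : B →ₗ[k] k}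

/-- Splitting a = (a − h(a) 1) + h(a) 1 shows that the span is stable under left multiplication by
both factors. It is thus a left ideal, and it contains 1. -/
theorem IsAlgCoprod.mem_span_reduced (hij : IsAlgCoprod i j) (h1A : hA 1 = 1) (h1B : hB 1 = 1)
    (x : H) : x ∈ Submodule.span k ({1} ∪ {y | ∃ c, Reduced i j hA hB c y}) := by
  set S := Submodule.span k ({1} ∪ {y | ∃ c, Reduced i j hA hB c y}) with hSdef
  have h1S : (1 : H) ∈ S := Submodule.subset_span (Or.inl rfl)
  have hR : ∀ {c y}, Reduced i j hA hB c y → y ∈ S := fun hy => Submodule.subset_span (Or.inr ⟨_, hy⟩)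
  have stepA : ∀ a y, Reduced i j hA hB false y → i a * y ∈ S := fun a y hy => by
    have : a = (a - hA a • 1) + hA a • 1 := by simp
    rw [this, map_add, add_mul]
    refine S.add_mem (hR (.mulLeft (by simp [h1A]) hy)) ?_
    simpa using S.smul_mem _ (hR hy)
  have stepB : ∀ b y, Reduced i j hA hB true y → j b * y ∈ S := fun b y hy => by
    have : b = (b - hB b • 1) + hB b • 1 := by simp
    rw [this, map_add, add_mul]
    refine S.add_mem (hR (.mulRight (by simp [h1B]) hy)) ?_
    simpa using S.smul_mem _ (hR hy)
  have memA : ∀ a, i a ∈ S := fun a => by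
    have : a = (a - hA a • 1) + hA a • 1 := by simp
    rw [this, map_add]
    refine S.add_mem (hR (.left (by simp [h1A]))) ?_
    simpa using S.smul_mem _ h1S
  have memB : ∀ b, j b ∈ S := fun b => by
    have : b = (b - hB b • 1) + hB b • 1 := by simp
    rw [this, map_add]
    refine S.add_mem (hR (.right (by simp [h1B]))) ?_
    simpa using S.smul_mem _ h1S
  have mulA : ∀ a, ∀ s ∈ S, i a * s ∈ S := fun a s hs => by
    rw [hSdef] at hs
    induction hs using Submodule.span_induction with
    | zero => simp
    | add x y _ _ hx hy => rw [mul_add]; exact S.add_mem hx hy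
    | smul c x _ hx => rw [mul_smul_comm]; exact S.smul_mem c hx
    | mem y hy =>
      rcases hy with rfl | ⟨c, hy⟩
      · simpa using memA a
      · cases hy with
        | left ha => rw [← map_mul]; exact memA _
        | right hb => exact stepA a _ (.right hb)
        | mulLeft ha hx => rw [← mul_assoc, ← map_mul]; exact stepA _ _ hx
        | mulRight hb hx => exact stepA a _ (.mulRight hb hx)
  have mulB : ∀ b, ∀ s ∈ S, j b * s ∈ S := fun b s hs => by
    rw [hSdef] at hs
    induction hs using Submodule.span_induction with
    | zero => simp
    | add x y _ _ hx hy => rw [mul_add]; exact S.add_mem hx hy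
    | smul c x _ hx => rw [mul_smul_comm]; exact S.smul_mem c hx
    | mem y hy =>
      rcases hy with rfl | ⟨c, hy⟩
      · simpa using memB b
      · cases hy with
        | right hb => rw [← map_mul]; exact memB _
        | left ha => exact stepB b _ (.left ha)
        | mulRight hb hx => rw [← mul_assoc, ← map_mul]; exact stepB _ _ hx
        | mulLeft ha hx => exact stepB b _ (.mulLeft ha hx)
  have key : ∀ x : H, ∀ s ∈ S, x * s ∈ S := hij.induction _ mulA mulB
    (fun x y hx hy s hs => by rw [add_mul]; exact S.add_mem (hx s hs) (hy s hs))
    (fun x y hx hy s hs => by rw [mul_assoc]; exact hx _ (hy s hs))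
  simpa using key x 1 h1S

/-- A functional on `A` extends to the coproduct by zero on the other reduced words. -/
theorem IsAlgCoprod.exists_functional (hij : IsAlgCoprod i j) (h1A : hA 1 = 1) (h1B : hB 1 = 1)
    (φ : A →ₗ[k] k) : ∃ l : H →ₗ[k] k, (∀ a, l (i a) = φ a) ∧
      (∀ x, Reduced i j hA hB false x → l x = 0) ∧
      ∀ a x, Reduced i j hA hB false x → l (i a * x) = 0 := by
  classical
  obtain ⟨I, bA, bA1, hbA⟩ := exists_basis_of_unital_functional hA h1A
  obtain ⟨J, bB, bB1, hbB⟩ := exists_basis_of_unital_functional hB h1B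
  let X := AltWord I J true
  let Y := AltWord I J false
  let E := AltWord.letterEquiv I J
  let e : (X →₀ A) ≃ₗ[k] (Y →₀ B) := fockEquiv bA bB E
  let x₀ : X := .nil _
  let y₀ : Y := .nil _
  have hE : ∀ x o, (E (x, some o)).2 = none ∧ (E (x, some o)).1 ≠ y₀ := fun x o =>
    ⟨rfl, by simp [E, AltWord.letterEquiv, AltWord.swapLetter, y₀]⟩
  have hE' : ∀ y o, (E.symm (y, some o)).2 = none ∧ (E.symm (y, some o)).1 ≠ x₀ := fun y o =>
    ⟨rfl, by simp [E, AltWord.letterEquiv, AltWord.unswapLetter, x₀]⟩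
  have e1 : e (Finsupp.single x₀ 1) = Finsupp.single y₀ 1 := by
    have := fockEquiv_single bA bB E x₀ none
    rw [bA1] at this
    rw [this, show E (x₀, none) = (y₀, none) from rfl, bB1]
  -- A acts on its free module `X →₀ A`, and B acts on the same space through `e`. The universal
  -- property of the coproduct joins these into a representation of H.
  obtain ⟨π, hπA, hπB⟩ := hij.exists_lift (Module.End k (X →₀ A)) (Algebra.lsmul k k (X →₀ A))
    ((e.symm.conjAlgEquiv k).toAlgHom.comp (Algebra.lsmul k k (Y →₀ B)))
  have hπA' : ∀ a f, π (i a) f = a • f := fun a f => by rw [hπA]; rfl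
  have hπB' : ∀ b f, e (π (j b) f) = b • e f := fun b f => by
    rw [hπB]; simp [LinearEquiv.conjAlgEquiv]
  let Ω : X →₀ A := Finsupp.single x₀ 1
  -- Apply a reduced word to the vacuum `Ω`. If the word starts in A, its tail is empty or starts in
  -- B, and the tail gives a vector with A-coordinates in k · 1; multiplying by a in ker hA leaves
  -- coordinates in ker hA. The other case is symmetric.
  have main : ∀ c x, Reduced i j hA hB c x →
      (c = true → ∀ w, hA (π x Ω w) = 0) ∧ (c = false → ∀ w, hB (e (π x Ω) w) = 0) := by
    intro c x hx
    induction hx with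
    | @left a ha =>
      refine ⟨fun _ w => ?_, by simp⟩
      rw [hπA', Finsupp.smul_apply, Finsupp.single_apply]
      split_ifs <;> simp [ha]
    | @right b hb =>
      refine ⟨by simp, fun _ w => ?_⟩
      rw [hπB', e1, Finsupp.smul_apply, Finsupp.single_apply]
      split_ifs <;> simp [hb]
    | @mulLeft a ha x hx ih =>
      refine ⟨fun _ w => ?_, by simp⟩
      have := (fockEquiv_of_forall_eq_zero bB bA E.symm h1B bB1 hbB bA1 x₀ hE' _ (ih.2 rfl)).1 w
      rw [← fockEquiv_symm, LinearEquiv.symm_apply_apply] at this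
      obtain ⟨c, hc⟩ := Submodule.mem_span_singleton.1 this
      rw [map_mul, Module.End.mul_apply, hπA', Finsupp.smul_apply, ← hc]
      simp [ha]
    | @mulRight b hb x hx ih =>
      refine ⟨by simp, fun _ w => ?_⟩
      have := (fockEquiv_of_forall_eq_zero bA bB E h1A bA1 hbA bB1 y₀ hE _ (ih.1 rfl)).1 w
      obtain ⟨c, hc⟩ := Submodule.mem_span_singleton.1 this
      rw [map_mul, Module.End.mul_apply, hπB', Finsupp.smul_apply, ← hc]
      simp [hb]
  have main' : ∀ x, Reduced i j hA hB false x → π x Ω x₀ = 0 := fun x hx => by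
    have := (fockEquiv_of_forall_eq_zero bB bA E.symm h1B bB1 hbB bA1 x₀ hE' _
      ((main _ x hx).2 rfl)).2
    rwa [← fockEquiv_symm, LinearEquiv.symm_apply_apply] at this
  -- The value of the functional at x is φ of the A-coordinate of xΩ at the empty word. This
  -- coordinate is zero for words starting in B, and stays zero after multiplication by a because A
  -- acts coordinatewise.
  refine ⟨φ ∘ₗ Finsupp.lapply x₀ ∘ₗ (LinearMap.applyₗ Ω) ∘ₗ π.toLinearMap, fun a => ?_,
    fun x hx => ?_, fun a x hx => ?_⟩
  · simp [hπA', Ω]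
  · simp [main' x hx]
  · simp [hπA', main' x hx]

/-! ### Comultiplication of reduced words -/

section Comul

variable {A B H : Type u} [Ring A] [Ring B] [Ring H] [Bialgebra k A] [Bialgebra k B]
  [Bialgebra k H]

/-- For the projection P = id − h(·) 1 onto ker h, invariance and h(a) = 0 remove all correction
terms in (P ⊗ P)Δ(a), which therefore equals Δ(a). -/
theorem comul_mem_span_of_invariant {h : A →ₗ[k] k} (h1 : h 1 = 1) (hr : RightInvariant h)
    (hl : LeftInvariant h) {a : A} (ha : h a = 0) :
    Coalgebra.comul a ∈ Submodule.span k
      (Set.image2 (fun x y : A => x ⊗ₜ[k] y) {x | h x = 0} {y | h y = 0}) := by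
  let P : A →ₗ[k] A := LinearMap.id - LinearMap.toSpanSingleton k A 1 ∘ₗ h
  have hP : ∀ x, h (P x) = 0 := fun x => by simp [P, h1]
  have key : TensorProduct.map P P (Coalgebra.comul a) = Coalgebra.comul a := by
    have e : TensorProduct.map P P = LinearMap.id
        - (LinearMap.toSpanSingleton k A 1).rTensor A ∘ₗ h.rTensor A
        - (LinearMap.toSpanSingleton k A 1).lTensor A ∘ₗ h.lTensor A
        + TensorProduct.map (LinearMap.toSpanSingleton k A 1) (LinearMap.toSpanSingleton k A 1) ∘ₗ
          h.lTensor k ∘ₗ h.rTensor A := by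
      ext x y
      simp only [P, AlgebraTensorModule.curry_apply, LinearMap.restrictScalars_self, curry_apply,
        map_tmul, LinearMap.sub_apply, LinearMap.id_apply, LinearMap.comp_apply,
        LinearMap.add_apply, LinearMap.rTensor_tmul, LinearMap.lTensor_tmul, sub_tmul, tmul_sub]
      abel
    rw [e]
    simp only [LinearMap.add_apply, LinearMap.sub_apply, LinearMap.comp_apply, LinearMap.id_apply,
      hr a, hl a, ha, zero_tmul, tmul_zero, map_zero, sub_zero, add_zero]
  rw [← key]
  generalize (Coalgebra.comul a : A ⊗[k] A) = t
  induction t with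
  | zero => simp
  | add x y hx hy => rw [map_add]; exact Submodule.add_mem _ hx hy
  | tmul x y => exact Submodule.subset_span ⟨P x, hP x, P y, hP y, rfl⟩

theorem comul_map_mem_span (i : A →ₐc[k] H) {S T : Set A} {a : A}
    (ha : Coalgebra.comul a ∈ Submodule.span k (Set.image2 (fun x y : A => x ⊗ₜ[k] y) S T)) :
    Coalgebra.comul (i a) ∈ Submodule.span k
      (Set.image2 (fun x y : H => x ⊗ₜ[k] y) (i '' S) (i '' T)) := by
  rw [← CoalgHomClass.map_comp_comul_apply]
  have := Submodule.mem_map_of_mem (f := TensorProduct.map (i : A →ₗ[k] H) (i : A →ₗ[k] H)) ha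
  rw [Submodule.map_span] at this
  refine Submodule.span_mono ?_ this
  rintro _ ⟨_, ⟨x, hx, y, hy, rfl⟩, rfl⟩
  exact ⟨i x, ⟨x, hx, rfl⟩, i y, ⟨y, hy, rfl⟩, rfl⟩

theorem mul_mem_span_image2_tmul {S T : Set H} {u v : H ⊗[k] H}
    (hu : u ∈ Submodule.span k (Set.image2 (fun x y : H => x ⊗ₜ[k] y) S S))
    (hv : v ∈ Submodule.span k (Set.image2 (fun x y : H => x ⊗ₜ[k] y) T T)) :
    u * v ∈ Submodule.span k (Set.image2 (fun x y : H => x ⊗ₜ[k] y)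
      (Set.image2 (· * ·) S T) (Set.image2 (· * ·) S T)) := by
  have := Submodule.mul_mem_mul hu hv
  rw [Submodule.span_mul_span] at this
  refine Submodule.span_mono ?_ this
  rintro _ ⟨_, ⟨x, hx, y, hy, rfl⟩, _, ⟨z, hz, w, hw, rfl⟩, rfl⟩
  exact ⟨x * z, ⟨x, hx, z, hz, rfl⟩, y * w, ⟨y, hy, w, hw, rfl⟩, by simp⟩

variable (i : A →ₐc[k] H) (j : B →ₐc[k] H) {hA : A →ₗ[k] k} {hB : B →ₗ[k] k}

/-- The comultiplication is multiplicative and sends each letter into ker ⊗ ker, so both tensor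
factors repeat the pattern of the word. -/
theorem Reduced.comul_mem_span (h1A : hA 1 = 1) (hrA : RightInvariant hA) (hlA : LeftInvariant hA)
    (h1B : hB 1 = 1) (hrB : RightInvariant hB) (hlB : LeftInvariant hB) {c : Bool} {x : H}
    (hx : Reduced (i : A →ₐ[k] H) (j : B →ₐ[k] H) hA hB c x) :
    Coalgebra.comul x ∈ Submodule.span k (Set.image2 (fun x y : H => x ⊗ₜ[k] y)
      {y | Reduced (i : A →ₐ[k] H) (j : B →ₐ[k] H) hA hB c y}
      {y | Reduced (i : A →ₐ[k] H) (j : B →ₐ[k] H) hA hB c y}) := by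
  have L : ∀ {a : A}, hA a = 0 → _ := fun ha =>
    comul_map_mem_span i (comul_mem_span_of_invariant h1A hrA hlA ha)
  have R : ∀ {b : B}, hB b = 0 → _ := fun hb =>
    comul_map_mem_span j (comul_mem_span_of_invariant h1B hrB hlB hb)
  induction hx with
  | left ha =>
    refine Submodule.span_mono (Set.image2_subset ?_ ?_) (L ha) <;>
    · rintro _ ⟨a, ha, rfl⟩
      exact .left ha
  | right hb =>
    refine Submodule.span_mono (Set.image2_subset ?_ ?_) (R hb) <;>
    · rintro _ ⟨a, ha, rfl⟩
      exact .right ha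
  | mulLeft ha hx ih =>
    rw [Bialgebra.comul_mul]
    refine Submodule.span_mono (Set.image2_subset ?_ ?_) (mul_mem_span_image2_tmul (L ha) ih) <;>
    · rintro _ ⟨_, ⟨a, ha, rfl⟩, x, hx, rfl⟩
      exact .mulLeft ha hx
  | mulRight hb hx ih =>
    rw [Bialgebra.comul_mul]
    refine Submodule.span_mono (Set.image2_subset ?_ ?_) (mul_mem_span_image2_tmul (R hb) ih) <;>
    · rintro _ ⟨_, ⟨a, ha, rfl⟩, x, hx, rfl⟩
      exact .mulRight ha hx

theorem lTensor_eq_zero_of_mem_span {l : H →ₗ[k] k} {S T : Set H} (hl : ∀ x ∈ T, l x = 0)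
    {t : H ⊗[k] H} (ht : t ∈ Submodule.span k (Set.image2 (fun x y : H => x ⊗ₜ[k] y) S T)) :
    l.lTensor H t = 0 := by
  have : Submodule.span k (Set.image2 (fun x y : H => x ⊗ₜ[k] y) S T) ≤
      LinearMap.ker (l.lTensor H) := by
    rw [Submodule.span_le]
    rintro _ ⟨x, hx, y, hy, rfl⟩
    simp [hl y hy]
  exact this ht

/-- A functional `φ` on `A` extends to a functional `l` on the coproduct such that all
`x₍₁₎ l(x₍₂₎)` are of the form `a₍₁₎ φ(a₍₂₎)`. -/
theorem IsAlgCoprod.exists_functional_comul {i : A →ₐc[k] H} {j : B →ₐc[k] H}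
    (hij : IsAlgCoprod (i : A →ₐ[k] H) (j : B →ₐ[k] H))
    (h1A : hA 1 = 1) (hrA : RightInvariant hA) (hlA : LeftInvariant hA)
    (h1B : hB 1 = 1) (hrB : RightInvariant hB) (hlB : LeftInvariant hB) (φ : A →ₗ[k] k) :
    ∃ l : H →ₗ[k] k, (∀ a, l (i a) = φ a) ∧ ∀ x, ∃ a, l x = φ a ∧
      l.lTensor H (Coalgebra.comul x) =
        (i : A →ₗ[k] H).rTensor k (φ.lTensor A (Coalgebra.comul a)) := by
  obtain ⟨l, hl1, hl2, hl3⟩ := hij.exists_functional h1A h1B φ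
  refine ⟨l, hl1, fun x => ?_⟩
  have hi : ∀ a, l.lTensor H (Coalgebra.comul (i a)) =
      (i : A →ₗ[k] H).rTensor k (φ.lTensor A (Coalgebra.comul a)) := fun a => by
    rw [← CoalgHomClass.map_comp_comul_apply]
    generalize (Coalgebra.comul a : A ⊗[k] A) = t
    induction t with
    | zero => simp
    | add x y hx hy => simp only [map_add, hx, hy]
    | tmul x y => simpa using congrArg (i x ⊗ₜ[k] ·) (hl1 y)
  -- Words outside A are matched with a = 0.
  have hz : ∀ y, l y = 0 → l.lTensor H (Coalgebra.comul y) = 0 → ∃ a, l y = φ a ∧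
      l.lTensor H (Coalgebra.comul y) =
        (i : A →ₗ[k] H).rTensor k (φ.lTensor A (Coalgebra.comul a)) := fun y h1 h2 =>
    ⟨0, by simp [h1], by simp [h2]⟩
  refine Submodule.span_induction (p := fun x _ => ∃ a, l x = φ a ∧
      l.lTensor H (Coalgebra.comul x) =
        (i : A →ₗ[k] H).rTensor k (φ.lTensor A (Coalgebra.comul a))) ?_ ?_ ?_ ?_
    (hij.mem_span_reduced h1A h1B x)
  · rintro y (rfl | ⟨c, hy⟩)
    · rw [show (1 : H) = i 1 from (map_one i).symm]
      exact ⟨1, hl1 1, hi 1⟩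
    · have hco := hy.comul_mem_span i j h1A hrA hlA h1B hrB hlB
      cases hy with
      | @left a ha => exact ⟨a, hl1 a, hi a⟩
      | right hb =>
        exact hz _ (hl2 _ (.right hb)) (lTensor_eq_zero_of_mem_span (fun x hx => hl2 x hx) hco)
      | mulRight hb hx =>
        exact hz _ (hl2 _ (.mulRight hb hx))
          (lTensor_eq_zero_of_mem_span (fun x hx => hl2 x hx) hco)
      | @mulLeft a ha x hx =>
        -- `Reduced.comul_mem_span` is too coarse for this word, since its span includes single
        -- letters of A, on which `l` need not vanish. It is applied to the tail only, so that the
        -- tensor factors keep a nonempty tail starting in B.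
        refine hz _ (hl3 _ _ hx) ?_
        rw [Bialgebra.comul_mul]
        refine lTensor_eq_zero_of_mem_span ?_ (mul_mem_span_image2_tmul
          (comul_map_mem_span i (comul_mem_span_of_invariant h1A hrA hlA ha))
          (hx.comul_mem_span i j h1A hrA hlA h1B hrB hlB))
        rintro _ ⟨_, ⟨a, _, rfl⟩, x, hx, rfl⟩
        exact hl3 a x hx
  · exact ⟨0, by simp, by simp⟩
  · rintro x y _ _ ⟨a, ha, ha'⟩ ⟨b, hb, hb'⟩
    exact ⟨a + b, by simp [ha, hb], by simp only [map_add, ha', hb']⟩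
  · rintro c x _ ⟨a, ha, ha'⟩
    exact ⟨c • a, by simp [ha], by simp only [map_smul, ha']⟩

end Comul

end Words

/-! ### Exactness of the restriction functors -/

theorem FreeProd.isAlgCoprod (k A B : Type u) [Field k] [Ring A] [Ring B] [Algebra k A]
    [Algebra k B] : IsAlgCoprod (FreeProd.inl k A B) (FreeProd.inr k A B) where
  exists_lift _ _ _ f g := ⟨FreeProd.lift f g, FreeProd.lift_inl f g, FreeProd.lift_inr f g⟩
  induction _ h1 h2 h3 h4 x := FreeProd.induction h1 h2 h3 h4 x

namespace YetterDrinfeld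

section Exact

variable {k A : Type u} [Field k] [Ring A] [HopfAlgebra k A] {X Y Z : YetterDrinfeld k A}

theorem injective_of_mono (f : X ⟶ Y) [Mono f] : Function.Injective f.lin := by
  rw [← LinearMap.ker_eq_bot, LinearMap.ker_eq_bot']
  intro x hx
  have : subι X _ (ker_act f) (ker_coact f) = 0 := by
    rw [← cancel_mono f]
    exact hom_ext fun v => v.2.trans (by simp)
  exact LinearMap.congr_fun (congrArg Hom.lin this) (⟨x, hx⟩ : LinearMap.ker f.lin)

theorem surjective_of_epi (f : X ⟶ Y) [Epi f] : Function.Surjective f.lin := by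
  have : quotπ Y _ (range_act f) (range_coact' f) = 0 := by
    rw [← cancel_epi f]
    exact hom_ext fun v => (Submodule.Quotient.mk_eq_zero _).2 ⟨v, rfl⟩
  intro y
  exact (Submodule.Quotient.mk_eq_zero _).1 (LinearMap.congr_fun (congrArg Hom.lin this) y)

theorem mono_of_injective (f : X ⟶ Y) (hf : Function.Injective f.lin) : Mono f :=
  ⟨fun _ _ h => hom_ext fun v => hf (LinearMap.congr_fun (congrArg Hom.lin h) v)⟩

theorem epi_of_surjective (f : X ⟶ Y) (hf : Function.Surjective f.lin) : Epi f :=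
  ⟨fun _ _ h => hom_ext fun v => by
    obtain ⟨x, rfl⟩ := hf v
    exact LinearMap.congr_fun (congrArg Hom.lin h) x⟩

theorem ker_le_range_of_shortExact {S : ShortComplex (YetterDrinfeld k A)} (hS : S.ShortExact) :
    LinearMap.ker S.g.lin ≤ LinearMap.range S.f.lin := by
  intro x hx
  have w : subι S.X₂ _ (ker_act S.g) (ker_coact S.g) ≫ S.g = 0 := hom_ext fun v => v.2
  have := hS.mono_f
  let l := hS.exact.lift _ w
  have hl : l ≫ S.f = _ := hS.exact.lift_f _ w
  exact ⟨l.lin ⟨x, hx⟩, LinearMap.congr_fun (congrArg Hom.lin hl) (⟨x, hx⟩ : LinearMap.ker S.g.lin)⟩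

theorem shortExact_of_lin (S : ShortComplex (YetterDrinfeld k A))
    (hf : Function.Injective S.f.lin) (hg : Function.Surjective S.g.lin)
    (h : LinearMap.ker S.g.lin ≤ LinearMap.range S.f.lin) : S.ShortExact :=
  have := mono_of_injective _ hf
  have := epi_of_surjective _ hg
  { exact := ShortComplex.exact_of_f_is_kernel _ (isLimitOfExact _ _ S.zero hf h) }

/-- The short exact sequence defined by a monomorphism. -/
def quotComplex (f : X ⟶ Y) : ShortComplex (YetterDrinfeld k A) where
  f := f
  g := quotπ Y _ (range_act f) (range_coact' f)
  zero := hom_ext fun v => (Submodule.Quotient.mk_eq_zero _).2 ⟨v, rfl⟩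

end Exact

/-! ### Averaging operators attached to functionals -/

section Average

variable {k H : Type u} [Field k] [Ring H] [HopfAlgebra k H] (l : H →ₗ[k] k)

/-- The map `m ↦ m₍₀₎ l(m₍₁₎)`. -/
def average (M : YetterDrinfeld k H) : M.carrier →ₗ[k] M.carrier :=
  (TensorProduct.rid k M.carrier).toLinearMap ∘ₗ l.lTensor M.carrier ∘ₗ M.coact

theorem average_map {M N : YetterDrinfeld k H} (f : M ⟶ N) (m : M.carrier) :
    f.lin (average l M m) = average l N (f.lin m) := by
  simp only [average, LinearMap.comp_apply, ← f.map_coact]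
  generalize M.coact m = t
  induction t with
  | zero => simp
  | add x y hx hy => simp only [map_add, hx, hy]
  | tmul x y => simp

/-- By coassociativity m₍₀₎ l(m₍₁₎) has coaction m₍₀₎ ⊗ m₍₁₎ l(m₍₂₎). So the values x₍₁₎ l(x₍₂₎)
decide in which subspace the averages lie. -/
theorem coact_average (M : YetterDrinfeld k H) (m : M.carrier) :
    M.coact (average l M m) =
      ((TensorProduct.rid k H).toLinearMap ∘ₗ l.lTensor H ∘ₗ Coalgebra.comul).lTensor M.carrier
        (M.coact m) := by
  have h1 : ∀ t : M.carrier ⊗[k] H, M.coact (TensorProduct.rid k M.carrier (l.lTensor _ t)) =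
      ((TensorProduct.rid k H).toLinearMap ∘ₗ l.lTensor H).lTensor M.carrier
        (TensorProduct.assoc k M.carrier H H (M.coact.rTensor H t)) := by
    intro t
    induction t with
    | zero => simp
    | add x y hx hy => simp only [map_add, hx, hy]
    | tmul x y =>
      simp only [LinearMap.lTensor_tmul, rid_tmul, map_smul, LinearMap.rTensor_tmul]
      generalize M.coact x = s
      induction s with
      | zero => simp
      | add a b ha hb => simp only [map_add, ha, hb, add_tmul, smul_add]
      | tmul a b => simp
  simp only [average, LinearMap.comp_apply, LinearEquiv.coe_coe, h1]
  have := M.coaction.coassoc m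
  change TensorProduct.assoc k M.carrier H H (M.coact.rTensor H (M.coact m)) = _ at this
  rw [this, ← LinearMap.lTensor_comp_apply]
  rfl

theorem average_eq_self_of_coact {L : Type u} [Ring L] [HopfAlgebra k L] (f : L →ₐc[k] H)
    (hl : ∀ a, l (f a) = Coalgebra.counit a) (M : YetterDrinfeld k H) {m : M.carrier}
    (hm : m ∈ resSubmodule f M) : average l M m = m := by
  obtain ⟨t, ht⟩ := hm
  have e : ∀ t : M.carrier ⊗[k] L, l.lTensor M.carrier ((f : L →ₗ[k] H).lTensor M.carrier t) =
      Coalgebra.counit.lTensor M.carrier ((f : L →ₗ[k] H).lTensor M.carrier t) := by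
    intro t
    induction t with
    | zero => simp
    | add x y hx hy => simp only [map_add, hx, hy]
    | tmul x y => simp [hl]
  simp only [average, LinearMap.comp_apply, ← ht, e]
  rw [ht]
  have := M.coaction.counit m
  change Coalgebra.counit.lTensor M.carrier (M.coact m) = _ at this
  rw [this]
  simp

theorem average_mem_resSubmodule {L : Type u} [Ring L] [HopfAlgebra k L] (f : L →ₐc[k] H)
    (hl : ∀ x, TensorProduct.rid k H (l.lTensor H (Coalgebra.comul x)) ∈
      LinearMap.range (f : L →ₗ[k] H)) (M : YetterDrinfeld k H) (m : M.carrier) :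
    average l M m ∈ resSubmodule f M := by
  refine Submodule.mem_comap.2 ?_
  rw [coact_average]
  generalize M.coact m = t
  induction t with
  | zero => simp
  | add x y hx hy => rw [map_add]; exact Submodule.add_mem _ hx hy
  | tmul x y =>
    obtain ⟨b, hb⟩ := hl y
    exact ⟨x ⊗ₜ b, by simpa using congrArg (x ⊗ₜ[k] ·) hb⟩

/-- The coinvariants of the underlying comodule. -/
def coinvariants (M : YetterDrinfeld k H) : Submodule k M.carrier :=
  LinearMap.eqLocus M.coact ((TensorProduct.mk k M.carrier H).flip 1)

theorem mem_coinvariants {M : YetterDrinfeld k H} {m : M.carrier} :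
    m ∈ coinvariants M ↔ M.coact m = m ⊗ₜ 1 := Iff.rfl

theorem average_of_mem_coinvariants (h1 : l 1 = 1) {M : YetterDrinfeld k H} {m : M.carrier}
    (hm : m ∈ coinvariants M) : average l M m = m := by
  simp [average, mem_coinvariants.1 hm, h1]

theorem average_mem_coinvariants
    (hl : ∀ x, TensorProduct.rid k H (l.lTensor H (Coalgebra.comul x)) = l x • 1)
    (M : YetterDrinfeld k H) (m : M.carrier) : average l M m ∈ coinvariants M := by
  rw [mem_coinvariants, coact_average]
  simp only [average, LinearMap.comp_apply]
  generalize M.coact m = t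
  induction t with
  | zero => simp
  | add x y hx hy => simp only [map_add, add_tmul, hx, hy]
  | tmul x y => simp [hl, smul_tmul']

end Average

section Restriction

variable {k H L : Type u} [Field k] [Ring H] [HopfAlgebra k H] [Ring L] [HopfAlgebra k L]
  (f : L →ₐc[k] H) (hf : Function.Injective f)

instance : (restriction f hf).Additive where
  map_add := hom_ext fun _ => rfl

instance : (restriction f hf).Linear k where
  map_smul _ _ := hom_ext fun _ => rfl

/-- `average l` is a natural projection onto the restricted subspace. Averaging a preimage gives
surjectivity. For exactness in the middle, the preimage is fixed by averaging because its image is,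
so it already lies in the restricted subspace. -/
theorem restriction_map_shortExact {l : H →ₗ[k] k} (h1 : ∀ a, l (f a) = Coalgebra.counit a)
    (h2 : ∀ x, TensorProduct.rid k H (l.lTensor H (Coalgebra.comul x)) ∈
      LinearMap.range (f : L →ₗ[k] H)) (S : ShortComplex (YetterDrinfeld k H))
    (hS : S.ShortExact) : (S.map (restriction f hf)).ShortExact := by
  have := hS.mono_f
  have := hS.epi_g
  have inj := injective_of_mono S.f
  refine shortExact_of_lin _ ?_ ?_ ?_
  · intro x y hxy
    exact Subtype.ext (inj (congrArg Subtype.val hxy))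
  · intro q
    obtain ⟨m, hm⟩ := surjective_of_epi S.g (q : resSubmodule f S.X₃).1
    refine ⟨⟨average l S.X₂ m, average_mem_resSubmodule l f h2 _ m⟩, Subtype.ext ?_⟩
    refine (average_map l S.g m).trans ?_
    rw [hm]
    exact average_eq_self_of_coact l f h1 _ (q : resSubmodule f S.X₃).2
  · intro x hx
    have hx' : S.g.lin (x : resSubmodule f S.X₂).1 = 0 := congrArg Subtype.val hx
    obtain ⟨y, hy⟩ := ker_le_range_of_shortExact hS hx'
    have hy' : average l S.X₁ y = y := inj (by
      rw [average_map, hy]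
      exact average_eq_self_of_coact l f h1 _ (x : resSubmodule f S.X₂).2)
    refine ⟨⟨y, hy' ▸ average_mem_resSubmodule l f h2 _ y⟩, Subtype.ext hy⟩

theorem preservesFiniteLimits_restriction
    (h : ∀ S : ShortComplex (YetterDrinfeld k H), S.ShortExact →
      (S.map (restriction f hf)).ShortExact) :
    PreservesFiniteLimits (restriction f hf) ∧ PreservesFiniteColimits (restriction f hf) :=
  ((Functor.exact_tfae (restriction f hf)).out 0 3).1 h

end Restriction

/-- On a coproduct of cosemisimple Hopf algebras there is a functional inducing a retraction
onto the factor `A` which is compatible with coactions, and a normalized invariant functional. -/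
theorem exists_retracting_functional {k A B H : Type u} [Field k] [Ring A] [Ring B] [Ring H]
    [HopfAlgebra k A] [HopfAlgebra k B] [HopfAlgebra k H] {i : A →ₐc[k] H} {j : B →ₐc[k] H}
    (hij : IsAlgCoprod (i : A →ₐ[k] H) (j : B →ₐ[k] H)) (hA : IsCosemisimple k A)
    (hB : IsCosemisimple k B) :
    (∃ l : H →ₗ[k] k, (∀ a, l (i a) = Coalgebra.counit a) ∧
      ∀ x, TensorProduct.rid k H (l.lTensor H (Coalgebra.comul x)) ∈
        LinearMap.range (i : A →ₗ[k] H)) ∧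
    ∃ l : H →ₗ[k] k, l 1 = 1 ∧
      ∀ x, TensorProduct.rid k H (l.lTensor H (Coalgebra.comul x)) = l x • 1 := by
  obtain ⟨gA, h1A, hrA⟩ := exists_rightInvariant hA
  obtain ⟨gB, h1B, hrB⟩ := exists_rightInvariant hB
  have hlA := hrA.leftInvariant hA h1A
  have hlB := hrB.leftInvariant hB h1B
  refine ⟨?_, ?_⟩
  -- For φ = ε the element a₍₁₎ φ(a₍₂₎) is a itself.
  · obtain ⟨l, hl1, hl2⟩ :=
      hij.exists_functional_comul h1A hrA hlA h1B hrB hlB (Coalgebra.counit (R := k))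
    refine ⟨l, hl1, fun x => ?_⟩
    obtain ⟨a, -, ha⟩ := hl2 x
    refine ⟨a, ?_⟩
    rw [ha, Coalgebra.lTensor_counit_comul]
    simp
  -- For the Haar functional φ of A the element a₍₁₎ φ(a₍₂₎) is φ(a) 1 = l(x) 1.
  · obtain ⟨l, hl1, hl2⟩ := hij.exists_functional_comul h1A hrA hlA h1B hrB hlB gA
    refine ⟨l, ?_, fun x => ?_⟩
    · rw [← h1A, ← hl1]
      exact congrArg l (map_one i).symm
    · obtain ⟨a, ha, ha'⟩ := hl2 x
      rw [ha', hlA, ha]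
      simp

end YetterDrinfeld

/-! ### Cofree Yetter–Drinfeld modules -/

section Antipode

variable {k H : Type u} [Field k] [Ring H] [HopfAlgebra k H]

/-- Rebrackets a₍₁₎ ⊗ … ⊗ a₍₄₎ so that the two inner factors arise from a single Δ and can be
cancelled against the antipode. -/
theorem assoc_comp_map_comul_comul_comp_comul :
    (TensorProduct.assoc k H H (H ⊗[k] H)).toLinearMap ∘ₗ
      TensorProduct.map Coalgebra.comul Coalgebra.comul ∘ₗ Coalgebra.comul =
    LinearMap.lTensor H (TensorProduct.assoc k H H H).toLinearMap ∘ₗ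
      LinearMap.lTensor H (LinearMap.rTensor H Coalgebra.comul) ∘ₗ
      LinearMap.lTensor H Coalgebra.comul ∘ₗ Coalgebra.comul := by
  simp only [coassoc_simps]

/-- Among three factors, comultiplying the two outer ones agrees with splitting the middle one into
three. This is the comparison needed in `cofree_yd`. -/
theorem assoc_comp_map_comul_lTensor_comul :
    (TensorProduct.assoc k H H (H ⊗[k] (H ⊗[k] H))).toLinearMap ∘ₗ
      TensorProduct.map Coalgebra.comul (LinearMap.lTensor H Coalgebra.comul) ∘ₗ
      LinearMap.lTensor H Coalgebra.comul ∘ₗ Coalgebra.comul =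
    (LinearMap.lTensor H (LinearMap.lTensor H (TensorProduct.assoc k H H H).toLinearMap)) ∘ₗ
      (LinearMap.lTensor H (TensorProduct.assoc k H (H ⊗[k] H) H).toLinearMap) ∘ₗ
      (LinearMap.lTensor H (LinearMap.rTensor H
        (LinearMap.lTensor H Coalgebra.comul ∘ₗ Coalgebra.comul))) ∘ₗ
      LinearMap.lTensor H Coalgebra.comul ∘ₗ Coalgebra.comul := by
  simp only [coassoc_simps]

/-- The antipode reverses the comultiplication. -/
theorem HopfAlgebra.comul_antipode_apply (x : H) :
    Coalgebra.comul (HopfAlgebra.antipode k x) =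
      TensorProduct.map (HopfAlgebra.antipode k) (HopfAlgebra.antipode k)
        (TensorProduct.comm k H H (Coalgebra.comul x)) := by
  let S : H →ₗ[k] H := HopfAlgebra.antipode k
  let D : H →ₗ[k] H ⊗[k] H := Coalgebra.comul
  let C : H ⊗[k] H →ₗ[k] H ⊗[k] H :=
    TensorProduct.map S S ∘ₗ (TensorProduct.comm k H H).toLinearMap
  have h : WithConv.toConv (D ∘ₗ S) = WithConv.toConv (C ∘ₗ D) := by
    -- Both sides are convolution inverses of Δ in Hom(H, H ⊗ H). On the left, ΔS * Δ = Δ ∘ (S * id)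
    -- because Δ is an algebra map.
    apply left_inv_eq_right_inv (a := WithConv.toConv D)
    · have := LinearMap.algHom_comp_convMul_distrib (Bialgebra.comulAlgHom k H)
        (WithConv.toConv S) (WithConv.toConv LinearMap.id)
      rw [LinearMap.antipode_mul_id] at this
      refine WithConv.ofConv_injective (this.symm.trans ?_)
      ext x
      simp [Algebra.algebraMap_eq_smul_one, Algebra.TensorProduct.one_def, smul_tmul']
    · refine WithConv.ofConv_injective (LinearMap.ext fun x => ?_)
      -- The other product is x₍₁₎S(x₍₄₎) ⊗ x₍₂₎S(x₍₃₎), the value of `G` on the iterated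
      -- comultiplication. The inner pair collapses to a counit, after which the outer pair does.
      let G : H ⊗[k] (H ⊗[k] (H ⊗[k] H)) →ₗ[k] H ⊗[k] H :=
        LinearMap.mul' k (H ⊗[k] H) ∘ₗ TensorProduct.map LinearMap.id C ∘ₗ
          (TensorProduct.assoc k H H (H ⊗[k] H)).symm.toLinearMap
      have e1 : LinearMap.mul' k (H ⊗[k] H) ∘ₗ TensorProduct.map D (C ∘ₗ D) =
          G ∘ₗ (TensorProduct.assoc k H H (H ⊗[k] H)).toLinearMap ∘ₗ TensorProduct.map D D := by
        ext x y
        simp [G]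
      have e2 : G ∘ₗ LinearMap.lTensor H (TensorProduct.assoc k H H H).toLinearMap ∘ₗ
          LinearMap.lTensor H (LinearMap.rTensor H D) =
          TensorProduct.map (LinearMap.mul' k H ∘ₗ S.lTensor H)
            (Algebra.linearMap k H ∘ₗ Coalgebra.counit) ∘ₗ
            (TensorProduct.assoc k H H H).symm.toLinearMap ∘ₗ
            LinearMap.lTensor H (TensorProduct.comm k H H).toLinearMap := by
        ext y z w
        have aux : ∀ s : H ⊗[k] H, G (y ⊗ₜ TensorProduct.assoc k H H H (s ⊗ₜ w)) =
            (y * S w) ⊗ₜ LinearMap.mul' k H (S.lTensor H s) := by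
          intro s
          induction s with
          | zero => simp
          | add a b ha hb => simp only [map_add, add_tmul, tmul_add, ha, hb]
          | tmul a b => simp [G, C]
        simp [aux, D, S]
      have e3 : TensorProduct.map (LinearMap.mul' k H ∘ₗ S.lTensor H)
            (Algebra.linearMap k H ∘ₗ Coalgebra.counit) ∘ₗ
            (TensorProduct.assoc k H H H).symm.toLinearMap ∘ₗ
            LinearMap.lTensor H (TensorProduct.comm k H H).toLinearMap ∘ₗ
            LinearMap.lTensor H D =
          (TensorProduct.mk k H H).flip 1 ∘ₗ LinearMap.mul' k H ∘ₗ S.lTensor H := by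
        ext y z
        have aux : ∀ s : H ⊗[k] H, TensorProduct.map (LinearMap.mul' k H ∘ₗ S.lTensor H)
            (Algebra.linearMap k H ∘ₗ Coalgebra.counit)
            ((TensorProduct.assoc k H H H).symm (y ⊗ₜ TensorProduct.comm k H H s)) =
            (y * S (TensorProduct.lid k H (Coalgebra.counit.rTensor H s))) ⊗ₜ 1 := by
          intro s
          induction s with
          | zero => simp
          | add a b ha hb => simp only [map_add, add_tmul, tmul_add, mul_add, ha, hb]
          | tmul a b => simp [Algebra.algebraMap_eq_smul_one, smul_tmul']
        simp [aux, D]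
      have e4 := assoc_comp_map_comul_comul_comp_comul (k := k) (H := H)
      have f1 := LinearMap.congr_fun e1 (D x)
      have f4 := LinearMap.congr_fun e4 x
      have f2 := LinearMap.congr_fun e2 (LinearMap.lTensor H D (D x))
      have f3 := LinearMap.congr_fun e3 (D x)
      simp only [LinearMap.comp_apply, LinearEquiv.coe_coe] at f1 f2 f3 f4
      change LinearMap.mul' k (H ⊗[k] H) (TensorProduct.map D (C ∘ₗ D) (D x)) = _
      rw [f1, f4]
      refine f2.trans (f3.trans ?_)
      have := HopfAlgebra.mul_antipode_lTensor_comul_apply (R := k) x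
      simp only [S, D, this]
      simp [Algebra.TensorProduct.algebraMap_apply]
  exact congrArg (fun g : WithConv (H →ₗ[k] H ⊗[k] H) => g x) h

end Antipode

/-- A bilinear map `N × H → N` is a right action of the algebra `H`. -/
structure IsRightAction {k H N : Type u} [Field k] [Ring H] [Algebra k H] [AddCommGroup N]
    [Module k N] (act : N →ₗ[k] H →ₗ[k] N) : Prop where
  act_one : ∀ v, act v 1 = v
  act_mul : ∀ v a b, act v (a * b) = act (act v a) b

section Cofree

variable {k H N : Type u} [Field k] [Ring H] [HopfAlgebra k H] [AddCommGroup N] [Module k N]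
  (act : N →ₗ[k] H →ₗ[k] N)

/-- The iterated comultiplication `a ↦ a₍₁₎ ⊗ (a₍₂₎ ⊗ a₍₃₎)`. -/
def comul₃ (k H : Type u) [Field k] [Ring H] [HopfAlgebra k H] : H →ₐ[k] H ⊗[k] (H ⊗[k] H) :=
  (Algebra.TensorProduct.map (AlgHom.id k H) (Bialgebra.comulAlgHom k H)).comp
    (Bialgebra.comulAlgHom k H)

theorem comul₃_apply (a : H) : comul₃ k H a = Coalgebra.comul.lTensor H (Coalgebra.comul a) := rfl

/-- Antimultiplicativity of S makes `ydTwist` a right action of the algebra H ⊗ H ⊗ H. Pulled back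
along the algebra map `comul₃` it becomes an action of H. -/
theorem ydTwist_mul (h : IsRightAction act) (t : N ⊗[k] H) (s s' : H ⊗[k] (H ⊗[k] H)) :
    ydTwist act t (s * s') = ydTwist act (ydTwist act t s) s' := by
  induction t with
  | zero => simp
  | add x y hx hy => simp only [map_add, LinearMap.add_apply, hx, hy]
  | tmul n p =>
    induction s with
    | zero => simp
    | add x y hx hy => simp only [map_add, add_mul, LinearMap.add_apply, hx, hy]
    | tmul x s =>
      induction s with
      | zero => simp
      | add x y hx hy => simp only [map_add, add_mul, tmul_add, LinearMap.add_apply, hx, hy]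
      | tmul y z =>
        induction s' with
        | zero => simp
        | add x y hx hy => simp only [map_add, mul_add, hx, hy]
        | tmul x' s =>
          induction s with
          | zero => simp
          | add x y hx hy => simp only [map_add, mul_add, tmul_add, hx, hy]
          | tmul y' z' => simp [h.act_mul, HopfAlgebra.antipode_mul_antidistrib, mul_assoc]

/-- The action of `H` on `N ⊗ H`, `(n ⊗ h) · a = n · a₍₂₎ ⊗ S(a₍₁₎) h a₍₃₎`. -/
def cofreeAct : N ⊗[k] H →ₗ[k] H →ₗ[k] N ⊗[k] H := (ydTwist act).compl₂ (comul₃ k H).toLinearMap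

theorem cofreeAct_apply (t : N ⊗[k] H) (a : H) : cofreeAct act t a = ydTwist act t (comul₃ k H a) :=
  rfl

variable (k H N) in
/-- The coaction of `H` on `N ⊗ H`, `n ⊗ h ↦ (n ⊗ h₍₁₎) ⊗ h₍₂₎`. -/
def cofreeCoact : N ⊗[k] H →ₗ[k] (N ⊗[k] H) ⊗[k] H :=
  (TensorProduct.assoc k N H H).symm.toLinearMap ∘ₗ Coalgebra.comul.lTensor N

/-- On n ⊗ h both sides are n · a₍₃₎ ⊗ S(a₍₂₎) h₍₁₎ a₍₄₎ ⊗ S(a₍₁₎) h₍₂₎ a₍₅₎. The left side uses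
that S reverses Δ. -/
theorem cofree_yd (t : N ⊗[k] H) (a : H) : cofreeCoact k H N (cofreeAct act t a) =
    ydTwist (cofreeAct act) (cofreeCoact k H N t) (comul₃ k H a) := by
  induction t with
  | zero => simp
  | add x y hx hy => simp only [map_add, LinearMap.add_apply, hx, hy]
  | tmul n h =>
    let D : H →ₗ[k] H ⊗[k] H := Coalgebra.comul
    let S : H →ₗ[k] H := HopfAlgebra.antipode k
    -- `Φ` has an arbitrary tensor u in place of Δ(h), which reduces the identity to u = p ⊗ q.
    let Φ : H ⊗[k] H → H ⊗[k] (H ⊗[k] H) →ₗ[k] (N ⊗[k] H) ⊗[k] H := fun u =>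
      (TensorProduct.assoc k N H H).symm.toLinearMap ∘ₗ
        TensorProduct.map (act n) (LinearMap.mul' k (H ⊗[k] H) ∘ₗ
          TensorProduct.map (LinearMap.mulRight k u ∘ₗ D ∘ₗ S) D) ∘ₗ
        (TensorProduct.leftComm k H H H).toLinearMap
    have hΦ : ∀ u x y z, Φ u (x ⊗ₜ (y ⊗ₜ z)) =
        (TensorProduct.assoc k N H H).symm (act n y ⊗ₜ (D (S x) * u * D z)) := fun u x y z => rfl
    have hΦadd : ∀ u v, Φ (u + v) = Φ u + Φ v := fun u v => by
      ext x y z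
      simp [hΦ, mul_add, add_mul, tmul_add]
    have hΦ0 : Φ 0 = 0 := by
      ext x y z
      simp [hΦ]
    have step1 : ∀ s, cofreeCoact k H N (ydTwist act (n ⊗ₜ h) s) = Φ (D h) s := by
      intro s
      induction s with
      | zero => simp
      | add x y hx hy => simp only [map_add, hx, hy]
      | tmul x s =>
        induction s with
        | zero => simp
        | add x y hx hy => simp only [map_add, tmul_add, hx, hy]
        | tmul y z => simp [hΦ, cofreeCoact, D, S, Bialgebra.comul_mul]
    have key : ∀ u, Φ u (comul₃ k H a) =
        ydTwist (cofreeAct act) ((TensorProduct.assoc k N H H).symm (n ⊗ₜ u)) (comul₃ k H a) := by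
      intro u
      induction u with
      | zero => simp [hΦ0]
      | add x y hx hy => simp only [hΦadd, LinearMap.add_apply, map_add, tmul_add, hx, hy]
      | tmul p q =>
        let R : H ⊗[k] ((H ⊗[k] (H ⊗[k] H)) ⊗[k] H) →ₗ[k] (N ⊗[k] H) ⊗[k] H :=
          TensorProduct.map (ydTwist act (n ⊗ₜ p))
            (LinearMap.mul' k H ∘ₗ TensorProduct.map (LinearMap.mulRight k q ∘ₗ S) LinearMap.id) ∘ₗ
          (TensorProduct.leftComm k H (H ⊗[k] (H ⊗[k] H)) H).toLinearMap
        have hR : ∀ x Y z, R (x ⊗ₜ (Y ⊗ₜ z)) = ydTwist act (n ⊗ₜ p) Y ⊗ₜ (S x * q * z) :=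
          fun x Y z => rfl
        -- `K` sends a₁ ⊗ … ⊗ a₅ to n · a₃ ⊗ S(a₂) p a₄ ⊗ S(a₁) q a₅.
        let K : H ⊗[k] (H ⊗[k] (H ⊗[k] (H ⊗[k] H))) →ₗ[k] (N ⊗[k] H) ⊗[k] H :=
          R ∘ₗ (LinearMap.lTensor H (TensorProduct.assoc k H (H ⊗[k] H) H).symm.toLinearMap) ∘ₗ
            (LinearMap.lTensor H (LinearMap.lTensor H
              (TensorProduct.assoc k H H H).symm.toLinearMap))
        have step2 : Φ (p ⊗ₜ q) = K ∘ₗ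
            (TensorProduct.assoc k H H (H ⊗[k] (H ⊗[k] H))).toLinearMap ∘ₗ
            TensorProduct.map D (LinearMap.lTensor H D) := by
          ext x y z
          have aux : ∀ s r : H ⊗[k] H, (TensorProduct.assoc k N H H).symm
              (act n y ⊗ₜ (TensorProduct.map S S (TensorProduct.comm k H H s) * p ⊗ₜ q * r)) =
              K (TensorProduct.assoc k H H (H ⊗[k] (H ⊗[k] H)) (s ⊗ₜ (y ⊗ₜ r))) := by
            intro s r
            induction s with
            | zero => simp
            | add a b ha hb => simp only [map_add, add_mul, tmul_add, add_tmul, ha, hb]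
            | tmul a b =>
              induction r with
              | zero => simp
              | add c d hc hd => simp only [map_add, mul_add, tmul_add, hc, hd]
              | tmul c d => simp [K, hR, S]
          simpa [hΦ, D, S, HopfAlgebra.comul_antipode_apply] using aux (D x) (D z)
        have step3 : ydTwist (cofreeAct act) ((n ⊗ₜ p) ⊗ₜ q) =
            R ∘ₗ (LinearMap.lTensor H (LinearMap.rTensor H (comul₃ k H).toLinearMap)) := by
          ext x y z
          simp [hR, cofreeAct_apply, S]
        have e := LinearMap.congr_fun (assoc_comp_map_comul_lTensor_comul (k := k) (H := H)) a
        simp only [LinearMap.comp_apply, LinearEquiv.coe_coe] at e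
        rw [step2, TensorProduct.assoc_symm_tmul, step3]
        simp only [LinearMap.comp_apply, LinearEquiv.coe_coe, comul₃_apply, D]
        rw [e]
        have h : LinearMap.lTensor H (TensorProduct.assoc k H (H ⊗[k] H) H).symm.toLinearMap ∘ₗ
            LinearMap.lTensor H (LinearMap.lTensor H
              (TensorProduct.assoc k H H H).symm.toLinearMap) ∘ₗ
            LinearMap.lTensor H (LinearMap.lTensor H
              (TensorProduct.assoc k H H H).toLinearMap) ∘ₗ
            LinearMap.lTensor H (TensorProduct.assoc k H (H ⊗[k] H) H).toLinearMap =
            LinearMap.id := by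
          ext; simp
        exact congrArg R (LinearMap.congr_fun h _)
    rw [cofreeAct_apply, step1, key]
    rfl

end Cofree

section CofreeModule

variable {k H N : Type u} [Field k] [Ring H] [HopfAlgebra k H] [AddCommGroup N] [Module k N]
  {act : N →ₗ[k] H →ₗ[k] N}

/-- The cofree Yetter–Drinfeld module on a right `H`-module. -/
def cofree (h : IsRightAction act) : YetterDrinfeld k H where
  carrier := N ⊗[k] H
  act := cofreeAct act
  act_one v := by
    rw [cofreeAct_apply, map_one]
    induction v with
    | zero => simp
    | add x y hx hy => rw [map_add, LinearMap.add_apply, hx, hy]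
    | tmul n p =>
      rw [show (1 : H ⊗[k] (H ⊗[k] H)) = 1 ⊗ₜ (1 ⊗ₜ 1) from rfl]
      simp [h.act_one]
  act_mul v a b := by rw [cofreeAct_apply, map_mul, ydTwist_mul act h]; rfl
  coaction :=
    { coact := cofreeCoact k H N
      coassoc := fun v => by
        induction v with
        | zero => simp
        | add x y hx hy => simp only [map_add, hx, hy]
        | tmul n p =>
          have e1 : ∀ s : H ⊗[k] H, TensorProduct.assoc k (N ⊗[k] H) H H
              ((cofreeCoact k H N).rTensor H ((TensorProduct.assoc k N H H).symm (n ⊗ₜ s))) =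
              (TensorProduct.assoc k N H (H ⊗[k] H)).symm
                (n ⊗ₜ TensorProduct.assoc k H H H (Coalgebra.comul.rTensor H s)) := by
            intro s
            induction s with
            | zero => simp
            | add x y hx hy => simp only [map_add, tmul_add, hx, hy]
            | tmul x y =>
              simp only [TensorProduct.assoc_symm_tmul, LinearMap.rTensor_tmul, cofreeCoact,
                LinearMap.comp_apply, LinearEquiv.coe_coe, LinearMap.lTensor_tmul]
              generalize (Coalgebra.comul x : H ⊗[k] H) = r
              induction r with
              | zero => simp
              | add x y hx hy => simp only [map_add, tmul_add, add_tmul, hx, hy]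
              | tmul x y => simp
          have e2 : ∀ s : H ⊗[k] H, Coalgebra.comul.lTensor (N ⊗[k] H)
              ((TensorProduct.assoc k N H H).symm (n ⊗ₜ s)) =
              (TensorProduct.assoc k N H (H ⊗[k] H)).symm (n ⊗ₜ Coalgebra.comul.lTensor H s) := by
            intro s
            induction s with
            | zero => simp
            | add x y hx hy => simp only [map_add, tmul_add, hx, hy]
            | tmul x y => simp
          rw [show cofreeCoact k H N (n ⊗ₜ p) =
            (TensorProduct.assoc k N H H).symm (n ⊗ₜ Coalgebra.comul p) from rfl, e1, e2,
            Coalgebra.coassoc_apply]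
      counit := fun v => by
        induction v with
        | zero => simp
        | add x y hx hy => simp only [map_add, add_tmul, hx, hy]
        | tmul n p =>
          have e1 : ∀ s : H ⊗[k] H, Coalgebra.counit.lTensor (N ⊗[k] H)
              ((TensorProduct.assoc k N H H).symm (n ⊗ₜ s)) =
              (TensorProduct.assoc k N H k).symm (n ⊗ₜ Coalgebra.counit.lTensor H s) := by
            intro s
            induction s with
            | zero => simp
            | add x y hx hy => simp only [map_add, tmul_add, hx, hy]
            | tmul x y => simp
          rw [show cofreeCoact k H N (n ⊗ₜ p) =
            (TensorProduct.assoc k N H H).symm (n ⊗ₜ Coalgebra.comul p) from rfl, e1,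
            Coalgebra.lTensor_counit_comul, TensorProduct.assoc_symm_tmul] }
  yd v a := cofree_yd act v a

variable (k H N) in
/-- The projection `N ⊗ H → N`, `n ⊗ h ↦ ε(h) n`. -/
def cofreeCounit : N ⊗[k] H →ₗ[k] N :=
  (TensorProduct.rid k N).toLinearMap ∘ₗ Coalgebra.counit.lTensor N

theorem cofreeCounit_act (t : N ⊗[k] H) (a : H) :
    cofreeCounit k H N (cofreeAct act t a) = act (cofreeCounit k H N t) a := by
  induction t with
  | zero => simp
  | add x y hx hy => simp only [map_add, LinearMap.add_apply, hx, hy]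
  | tmul n p =>
    have e : ∀ s : H ⊗[k] (H ⊗[k] H), cofreeCounit k H N (ydTwist act (n ⊗ₜ p) s) =
        Coalgebra.counit (R := k) p • act n (TensorProduct.rid k H (Coalgebra.counit.lTensor H
          (TensorProduct.lid k _ (Coalgebra.counit.rTensor _ s)))) := by
      intro s
      induction s with
      | zero => simp
      | add x y hx hy => simp only [map_add, smul_add, hx, hy]
      | tmul x s =>
        induction s with
        | zero => simp
        | add x y hx hy => simp only [map_add, tmul_add, smul_add, hx, hy]
        | tmul y z =>
          simp [cofreeCounit, smul_smul, mul_comm, mul_left_comm]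
    have e2 : ∀ s : H ⊗[k] H, TensorProduct.lid k (H ⊗[k] H) (Coalgebra.counit.rTensor _
        (Coalgebra.comul.lTensor H s)) =
        Coalgebra.comul (TensorProduct.lid k H (Coalgebra.counit.rTensor H s)) := by
      intro s
      induction s with
      | zero => simp
      | add x y hx hy => simp only [map_add, hx, hy]
      | tmul y z => simp
    rw [cofreeAct_apply, e, comul₃_apply, e2, Coalgebra.rTensor_counit_comul,
      TensorProduct.lid_tmul, one_smul, Coalgebra.lTensor_counit_comul]
    simp [cofreeCounit]

/-- An element of the cofree module is recovered from its coaction and the projection to N. This is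
the source of uniqueness in the universal property. -/
theorem rTensor_cofreeCounit_coact (t : N ⊗[k] H) :
    (cofreeCounit k H N).rTensor H (cofreeCoact k H N t) = t := by
  induction t with
  | zero => simp
  | add x y hx hy => simp only [map_add, hx, hy]
  | tmul n p =>
    have e : ∀ s : H ⊗[k] H, (cofreeCounit k H N).rTensor H
        ((TensorProduct.assoc k N H H).symm (n ⊗ₜ s)) =
        n ⊗ₜ TensorProduct.lid k H (Coalgebra.counit.rTensor H s) := by
      intro s
      induction s with
      | zero => simp
      | add x y hx hy => simp only [map_add, tmul_add, hx, hy]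
      | tmul y z => simp [cofreeCounit, smul_tmul]
    rw [show cofreeCoact k H N (n ⊗ₜ p) =
            (TensorProduct.assoc k N H H).symm (n ⊗ₜ Coalgebra.comul p) from rfl, e]
    simp

end CofreeModule

section TensorMap

variable {R U V W P Q : Type*} [CommRing R] [AddCommGroup U] [Module R U] [AddCommGroup V]
  [Module R V] [AddCommGroup W] [Module R W] [AddCommGroup P] [Module R P] [AddCommGroup Q]
  [Module R Q]

theorem TensorProduct.map_rTensor (ψ : V →ₗ[R] W) (f : P →ₗ[R] Q) (φ : U →ₗ[R] V)
    (t : U ⊗[R] P) :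
    TensorProduct.map ψ f (φ.rTensor P t) = TensorProduct.map (ψ ∘ₗ φ) f t := by
  simp

theorem TensorProduct.rTensor_map (ψ : V →ₗ[R] W) (φ : U →ₗ[R] V) (f : P →ₗ[R] Q)
    (t : U ⊗[R] P) :
    ψ.rTensor Q (TensorProduct.map φ f t) = TensorProduct.map (ψ ∘ₗ φ) f t := by
  simp

end TensorMap

/-! ### Universal property of cofree modules and of their restrictions; injectivity -/

namespace YetterDrinfeld

section SemiHom

variable {k H L : Type u} [Field k] [Ring H] [HopfAlgebra k H] [Ring L] [HopfAlgebra k L]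

/-- A linear map from a Yetter–Drinfeld module over `L` to one over `H` compatible with the
structures along `f : L → H`. -/
structure IsSemiHom (f : L →ₐc[k] H) (X : YetterDrinfeld k L) (M : YetterDrinfeld k H)
    (φ : X.carrier →ₗ[k] M.carrier) : Prop where
  map_act : ∀ x a, φ (X.act x a) = M.act (φ x) (f a)
  map_coact : ∀ x, TensorProduct.map φ (f : L →ₗ[k] H) (X.coact x) = M.coact (φ x)

variable {f : L →ₐc[k] H} (hf : Function.Injective f) {X : YetterDrinfeld k L}
  {M : YetterDrinfeld k H}

theorem IsSemiHom.mem_resSubmodule {φ : X.carrier →ₗ[k] M.carrier} (h : IsSemiHom f X M φ)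
    (x : X.carrier) : φ x ∈ resSubmodule f M := by
  refine Submodule.mem_comap.2 ⟨φ.rTensor L (X.coact x), ?_⟩
  rw [← h.map_coact]
  exact LinearMap.congr_fun (LinearMap.lTensor_comp_rTensor _ _ _) _

/-- A semilinear morphism as a morphism to the restriction. -/
def IsSemiHom.toRes {φ : X.carrier →ₗ[k] M.carrier} (h : IsSemiHom f X M φ) :
    X ⟶ resObj f hf M where
  lin := LinearMap.codRestrict (resSubmodule f M) φ h.mem_resSubmodule
  map_act v a := Subtype.ext (h.map_act v a)
  map_coact v := by
    apply map_injective _ (resSubmodule f M).subtype_injective _ hf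
    refine Eq.trans ?_ (map_resObj_coact f hf M _).symm
    refine Eq.trans ?_ (h.map_coact v)
    exact TensorProduct.map_rTensor (resSubmodule f M).subtype (f : L →ₗ[k] H)
      (LinearMap.codRestrict (resSubmodule f M) φ h.mem_resSubmodule) (X.coact v)

theorem isSemiHom_of_hom (φ : X ⟶ resObj f hf M) :
    IsSemiHom f X M ((resSubmodule f M).subtype ∘ₗ φ.lin) where
  map_act x a := congrArg Subtype.val (φ.map_act x a)
  map_coact x := by
    refine Eq.trans ?_ (map_resObj_coact f hf M (φ.lin x))
    rw [← φ.map_coact]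
    exact (TensorProduct.map_rTensor (resSubmodule f M).subtype (f : L →ₗ[k] H) φ.lin
      (X.coact x)).symm

theorem isSemiHom_id {X M : YetterDrinfeld k H} (φ : X ⟶ M) :
    IsSemiHom (BialgHom.id k H) X M φ.lin where
  map_act := φ.map_act
  map_coact := φ.map_coact

/-- A compatible map along the identity is a morphism. -/
def IsSemiHom.toHom {X M : YetterDrinfeld k H} {φ : X.carrier →ₗ[k] M.carrier}
    (h : IsSemiHom (BialgHom.id k H) X M φ) : X ⟶ M where
  lin := φ
  map_act := h.map_act
  map_coact := h.map_coact

variable {N : Type u} [AddCommGroup N] [Module k N] {act : N →ₗ[k] H →ₗ[k] N}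

/-- Existence half of the universal property, by x ↦ γ(x₍₀₎) ⊗ f(x₍₁₎). Working along f covers both
morphisms over H, with f the identity, and morphisms from L-modules to the restriction. -/
theorem isSemiHom_cofree (h : IsRightAction act) (γ : X.carrier →ₗ[k] N)
    (hγ : ∀ x a, γ (X.act x a) = act (γ x) (f a)) :
    IsSemiHom f X (cofree h) (TensorProduct.map γ (f : L →ₗ[k] H) ∘ₗ X.coact) where
  map_act x a := by
    have h1 := ydTwist_map f γ X.act act hγ (X.coact x)
      (Coalgebra.comul.lTensor L (Coalgebra.comul a))
    rw [comul_map] at h1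
    exact (congrArg _ (X.yd x a)).trans h1
  map_coact x := by
    have e1 : ∀ t : X.carrier ⊗[k] L,
        TensorProduct.map (TensorProduct.map γ (f : L →ₗ[k] H) ∘ₗ X.coact) (f : L →ₗ[k] H) t =
        (TensorProduct.assoc k N H H).symm
          (TensorProduct.map γ (TensorProduct.map (f : L →ₗ[k] H) (f : L →ₗ[k] H))
            (TensorProduct.assoc k X.carrier L L (X.coact.rTensor L t))) := by
      intro t
      induction t with
      | zero => simp
      | add x y hx hy => simp only [map_add, hx, hy]
      | tmul x y =>
        simp only [map_tmul, LinearMap.rTensor_tmul, LinearMap.comp_apply]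
        generalize X.coact x = s
        induction s with
        | zero => simp
        | add x y hx hy => simp only [map_add, add_tmul, hx, hy]
        | tmul x y => simp
    have e2 : ∀ t : X.carrier ⊗[k] L,
        TensorProduct.map γ (TensorProduct.map (f : L →ₗ[k] H) (f : L →ₗ[k] H))
          (Coalgebra.comul.lTensor X.carrier t) =
        Coalgebra.comul.lTensor N (TensorProduct.map γ (f : L →ₗ[k] H) t) := by
      intro t
      induction t with
      | zero => simp
      | add x y hx hy => simp only [map_add, hx, hy]
      | tmul x y => simp [← CoalgHomClass.map_comp_comul_apply]
    have hc : TensorProduct.assoc k X.carrier L L (X.coact.rTensor L (X.coact x)) = _ :=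
      X.coaction.coassoc x
    refine (e1 _).trans ?_
    rw [hc, e2]
    rfl

theorem cofreeCounit_map_coact (γ : X.carrier →ₗ[k] N) (x : X.carrier) :
    cofreeCounit k H N (TensorProduct.map γ (f : L →ₗ[k] H) (X.coact x)) = γ x := by
  have e : ∀ t : X.carrier ⊗[k] L, cofreeCounit k H N (TensorProduct.map γ (f : L →ₗ[k] H) t) =
      γ (TensorProduct.rid k X.carrier (Coalgebra.counit.lTensor X.carrier t)) := by
    intro t
    induction t with
    | zero => simp
    | add x y hx hy => simp only [map_add, hx, hy]
    | tmul x y => simp [cofreeCounit]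
  have hc : Coalgebra.counit.lTensor X.carrier (X.coact x) = _ := X.coaction.counit x
  rw [e, hc]
  simp

/-- Uniqueness half: a colinear map into the cofree module is determined by its composite with the
projection to N. -/
theorem IsSemiHom.eq_map_coact {h : IsRightAction act} {φ : X.carrier →ₗ[k] (cofree h).carrier}
    (hφ : IsSemiHom f X (cofree h) φ) (x : X.carrier) :
    φ x = TensorProduct.map ((cofreeCounit k H N) ∘ₗ φ) (f : L →ₗ[k] H) (X.coact x) := by
  have h1 := congrArg ((cofreeCounit k H N).rTensor H) (hφ.map_coact x)
  refine (rTensor_cofreeCounit_coact (k := k) (H := H) (N := N) (φ x)).symm.trans (h1.symm.trans ?_)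
  exact TensorProduct.rTensor_map (cofreeCounit k H N) φ (f : L →ₗ[k] H) (X.coact x)

end SemiHom

section Injective

variable {k L N : Type u} [Field k] [Ring L] [HopfAlgebra k L] [AddCommGroup N] [Module k N]

/-- The universal property of the cofree Yetter–Drinfeld module on a right module. -/
structure IsCofree (I : YetterDrinfeld k L) (act : N →ₗ[k] L →ₗ[k] N)
    (e : I.carrier →ₗ[k] N) : Prop where
  map_act : ∀ v a, e (I.act v a) = act (e v) a
  exists_hom : ∀ (X : YetterDrinfeld k L) (γ : X.carrier →ₗ[k] N),
    (∀ x a, γ (X.act x a) = act (γ x) a) → ∃ φ : X ⟶ I, ∀ x, e (φ.lin x) = γ x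
  hom_ext : ∀ (X : YetterDrinfeld k L) (φ ψ : X ⟶ I),
    (∀ x, e (φ.lin x) = e (ψ.lin x)) → φ = ψ

/-- Every linear map to the right module `N` can be made equivariant without changing it at the
vectors where it is equivariant already. This says that `N` is injective. -/
def IsInjectiveAction (act : N →ₗ[k] L →ₗ[k] N) : Prop :=
  ∀ (W : Type u) [AddCommGroup W] [Module k W] (actW : W →ₗ[k] L →ₗ[k] W), IsRightAction actW →
    ∀ g : W →ₗ[k] N, ∃ G : W →ₗ[k] N, (∀ w a, G (actW w a) = act (G w) a) ∧
      ∀ v, (∀ a, g (actW v a) = act (g v) a) → G v = g v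

theorem isRightAction (X : YetterDrinfeld k L) : IsRightAction X.act := ⟨X.act_one, X.act_mul⟩

/-- A linear retraction of the monomorphism extends the composite to N linearly. The extension is
equivariant on the image of the monomorphism, so making it equivariant everywhere does not change it
there. -/
theorem IsCofree.injective {I : YetterDrinfeld k L} {act : N →ₗ[k] L →ₗ[k] N}
    {e : I.carrier →ₗ[k] N} (h : IsCofree I act e) (hN : IsInjectiveAction act) : Injective I where
  factors {X Y} g f _ := by
    obtain ⟨r, hr⟩ := f.lin.exists_leftInverse_of_injective
      (LinearMap.ker_eq_bot.2 (injective_of_mono f))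
    have hr' : ∀ x, r (f.lin x) = x := LinearMap.congr_fun hr
    obtain ⟨G, hG, hG'⟩ := hN Y.carrier Y.act (isRightAction Y) (e ∘ₗ g.lin ∘ₗ r)
    obtain ⟨φ, hφ⟩ := h.exists_hom Y G hG
    refine ⟨φ, h.hom_ext _ _ _ fun x => ?_⟩
    refine (hφ _).trans ((hG' _ fun a => ?_).trans ?_)
    · rw [← f.map_act]
      simp only [LinearMap.comp_apply, hr', g.map_act, h.map_act]
    · simp only [LinearMap.comp_apply, hr']

end Injective

section CofreeInstances

variable {k H L N : Type u} [Field k] [Ring H] [HopfAlgebra k H] [Ring L] [HopfAlgebra k L]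
  [AddCommGroup N] [Module k N] {act : N →ₗ[k] H →ₗ[k] N}

theorem isCofree_cofree (h : IsRightAction act) :
    IsCofree (cofree h) act (cofreeCounit k H N) where
  map_act := cofreeCounit_act
  exists_hom X γ hγ := ⟨(isSemiHom_cofree (f := BialgHom.id k H) h γ hγ).toHom,
    fun x => cofreeCounit_map_coact (f := BialgHom.id k H) γ x⟩
  hom_ext X φ ψ hφψ := hom_ext fun x => by
    rw [(isSemiHom_id φ).eq_map_coact, (isSemiHom_id ψ).eq_map_coact,
      show cofreeCounit k H N ∘ₗ φ.lin = cofreeCounit k H N ∘ₗ ψ.lin from LinearMap.ext hφψ]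

/-- The restriction of a cofree module is cofree on the same N with the action restricted to L. Its
injectivity thus becomes a question about N as an L-module. -/
theorem isCofree_resObj_cofree (f : L →ₐc[k] H) (hf : Function.Injective f)
    (h : IsRightAction act) :
    IsCofree (resObj f hf (cofree h)) (act.compl₂ (f : L →ₗ[k] H))
      (cofreeCounit k H N ∘ₗ (resSubmodule f (cofree h)).subtype) where
  map_act v a := cofreeCounit_act _ _
  exists_hom X γ hγ := ⟨(isSemiHom_cofree (f := f) h γ hγ).toRes hf,
    fun x => cofreeCounit_map_coact (f := f) γ x⟩
  hom_ext X φ ψ hφψ := hom_ext fun x => Subtype.ext (by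
    refine ((isSemiHom_of_hom hf φ).eq_map_coact x).trans
      (Eq.trans ?_ ((isSemiHom_of_hom hf ψ).eq_map_coact x).symm)
    exact congrArg (fun γ : X.carrier →ₗ[k] N =>
      TensorProduct.map γ (f : L →ₗ[k] H) (X.coact x)) (LinearMap.ext hφψ))

end CofreeInstances

end YetterDrinfeld

/-! ### Coinduced modules over a coproduct of algebras -/

section Coinduced

variable {k H A B : Type u} [Field k] [Ring H] [Algebra k H] [Ring A] [Algebra k A] [Ring B]
  [Algebra k B]

/-- A right action as an algebra map to the opposite of the endomorphism algebra. -/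
def IsRightAction.toAlgHom {W : Type u} [AddCommGroup W] [Module k W] {act : W →ₗ[k] H →ₗ[k] W}
    (h : IsRightAction act) : H →ₐ[k] (Module.End k W)ᵐᵒᵖ :=
  AlgHom.ofLinearMap ((MulOpposite.opLinearEquiv k).toLinearMap ∘ₗ act.flip)
    (MulOpposite.unop_injective (LinearMap.ext h.act_one))
    (fun a b => MulOpposite.unop_injective (LinearMap.ext fun w => h.act_mul w a b))

theorem IsAlgCoprod.exists_action {i : A →ₐ[k] H} {j : B →ₐ[k] H} (hij : IsAlgCoprod i j)
    {W : Type u} [AddCommGroup W] [Module k W] {actA : W →ₗ[k] A →ₗ[k] W}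
    {actB : W →ₗ[k] B →ₗ[k] W} (hA : IsRightAction actA) (hB : IsRightAction actB) :
    ∃ act : W →ₗ[k] H →ₗ[k] W, IsRightAction act ∧ (∀ w a, act w (i a) = actA w a) ∧
      ∀ w b, act w (j b) = actB w b := by
  obtain ⟨φ, hφi, hφj⟩ := hij.exists_lift _ hA.toAlgHom hB.toAlgHom
  refine ⟨((MulOpposite.opLinearEquiv k).symm.toLinearMap ∘ₗ φ.toLinearMap).flip, ⟨fun w => ?_,
    fun w a b => ?_⟩, fun w a => ?_, fun w b => ?_⟩
  · simp
  · simp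
  · exact LinearMap.congr_fun (congrArg MulOpposite.unop (hφi a)) w
  · exact LinearMap.congr_fun (congrArg MulOpposite.unop (hφj b)) w

variable (k H) in
/-- The right action on `Hom(H, V)` given by `(φ · a) x = φ (a x)`. -/
def coindAct (V : Type u) [AddCommGroup V] [Module k V] :
    (H →ₗ[k] V) →ₗ[k] H →ₗ[k] (H →ₗ[k] V) :=
  LinearMap.mk₂ k (fun φ a => φ ∘ₗ LinearMap.mulLeft k a)
    (fun _ _ _ => rfl) (fun _ _ _ => rfl)
    (fun φ a b => by ext; simp [add_mul]) (fun c φ a => by ext; simp)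

variable {V : Type u} [AddCommGroup V] [Module k V]

@[simp] theorem coindAct_apply (φ : H →ₗ[k] V) (a x : H) : coindAct k H V φ a x = φ (a * x) := rfl

theorem isRightAction_coindAct : IsRightAction (coindAct k H V) where
  act_one φ := by ext; simp
  act_mul φ a b := by ext; simp [mul_assoc]

/-- The equivariant map is the adjoint of the linear map w ↦ g(w)(1). -/
theorem isInjectiveAction_coindAct {H : Type u} [Ring H] [HopfAlgebra k H] :
    YetterDrinfeld.IsInjectiveAction (coindAct k H V) := by
  intro W _ _ actW hW g
  refine ⟨LinearMap.mk₂ k (fun w x => g (actW w x) 1) (by simp) (by simp) (by simp) (by simp),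
    fun w a => ?_, fun v hv => ?_⟩
  · ext x
    simp [hW.act_mul]
  · ext x
    simp [hv]

theorem IsRightAction.compl₂ {W : Type u} [AddCommGroup W] [Module k W]
    {act : W →ₗ[k] H →ₗ[k] W} (h : IsRightAction act) (i : A →ₐ[k] H) :
    IsRightAction (act.compl₂ i.toLinearMap) where
  act_one w := by simp [h.act_one]
  act_mul w a b := by simp [h.act_mul]

/-- The direct sum of two right actions. -/
def prodAct {N W : Type u} [AddCommGroup N] [Module k N] [AddCommGroup W] [Module k W]
    (actN : N →ₗ[k] A →ₗ[k] N) (actW : W →ₗ[k] A →ₗ[k] W) : N × W →ₗ[k] A →ₗ[k] N × W :=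
  LinearMap.mk₂ k (fun y a => (actN y.1 a, actW y.2 a)) (by simp) (by simp) (by simp) (by simp)

/-- The right action on `N × W` for which the graph of `-g` is the trivial module of `ε`. -/
def graphAct {N W : Type u} [AddCommGroup N] [Module k N] [AddCommGroup W] [Module k W]
    (actN : N →ₗ[k] B →ₗ[k] N) (ε : B →ₐ[k] k) (g : W →ₗ[k] N) :
    N × W →ₗ[k] B →ₗ[k] N × W :=
  LinearMap.mk₂ k (fun y b => (actN (y.1 + g y.2) b - ε b • g y.2, ε b • y.2))
    (fun y z b => by ext <;> simp; abel) (fun c y b => by ext <;> simp [smul_sub, smul_comm c])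
    (fun y b c => by ext <;> simp [add_smul]; abel)
    (fun c y b => by ext <;> simp [smul_sub, smul_smul])

theorem isRightAction_prodAct {N W : Type u} [AddCommGroup N] [Module k N] [AddCommGroup W]
    [Module k W] {actN : N →ₗ[k] A →ₗ[k] N} {actW : W →ₗ[k] A →ₗ[k] W} (hN : IsRightAction actN)
    (hW : IsRightAction actW) : IsRightAction (prodAct actN actW) where
  act_one _ := Prod.ext (hN.act_one _) (hW.act_one _)
  act_mul _ _ _ := Prod.ext (hN.act_mul _ _ _) (hW.act_mul _ _ _)

theorem isRightAction_graphAct {N W : Type u} [AddCommGroup N] [Module k N] [AddCommGroup W]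
    [Module k W] {actN : N →ₗ[k] B →ₗ[k] N} (hN : IsRightAction actN) (ε : B →ₐ[k] k)
    (g : W →ₗ[k] N) : IsRightAction (graphAct actN ε g) where
  act_one y := by ext <;> simp [graphAct, hN.act_one]
  act_mul y a b := by
    ext
    · simp [graphAct, hN.act_mul, smul_smul, mul_comm]
    · simp [graphAct, smul_smul, mul_comm]

/-- Over a coproduct of `A` and `B`, any linear map from an `A`-module to a coinduced module can be
made `A`-equivariant by adding a map with `B`-invariant values. -/
theorem IsAlgCoprod.exists_equivariant_sub_invariant {i : A →ₐ[k] H} {j : B →ₐ[k] H}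
    (hij : IsAlgCoprod i j) (ε : B →ₐ[k] k) {W : Type u} [AddCommGroup W] [Module k W]
    {actW : W →ₗ[k] A →ₗ[k] W} (hW : IsRightAction actW) (g : W →ₗ[k] (H →ₗ[k] V)) :
    ∃ G : W →ₗ[k] (H →ₗ[k] V), (∀ w a, G (actW w a) = coindAct k H V (G w) (i a)) ∧
      (∀ w b, coindAct k H V (g w - G w) (j b) = ε b • (g w - G w)) ∧
      ∀ v, (∀ a, g (actW v a) = coindAct k H V (g v) (i a)) → G v = g v := by
  have hN := isRightAction_coindAct (k := k) (H := H) (V := V)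
  -- Let N = Hom(H, V). On N × W the factor A acts diagonally, and B acts so that N × 0 keeps its
  -- action while the graph of −g carries the trivial action through ε. A coproduct needs no
  -- compatibility between the two, so they define an H-action.
  obtain ⟨act, hact, hi, hj⟩ := hij.exists_action (isRightAction_prodAct (hN.compl₂ i) hW)
    (isRightAction_graphAct (hN.compl₂ j) ε g)
  -- `F` is the H-linear map into the coinduced module adjoint to y ↦ (y.1 + g(y.2))(1). It is the
  -- identity on N × 0 (`hFn`), and the required map is G(w) = F(0, w).
  let F : (H →ₗ[k] V) × W →ₗ[k] (H →ₗ[k] V) :=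
    LinearMap.mk₂ k (fun y x => ((act y x).1 + g (act y x).2) 1)
      (fun y z x => by simp; abel) (by simp) (fun y x z => by simp; abel) (by simp)
  have hF : ∀ y x, F y x = ((act y x).1 + g (act y x).2) 1 := fun _ _ => rfl
  have hFact : ∀ y a, F (act y a) = coindAct k H V (F y) a := fun y a => by
    ext x
    simp only [hF, coindAct_apply, hact.act_mul]
  have hFn : ∀ n, F (n, 0) = n := by
    have : ∀ x n, act (n, 0) x = (coindAct k H V n x, 0) :=
      hij.induction _ (fun a n => by rw [hi]; simp [prodAct])
        (fun b n => by rw [hj]; simp [graphAct]) (fun x y hx hy n => by simp [hx, hy])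
        (fun x y hx hy n => by simp [hact.act_mul, hx, hy, hN.act_mul])
    intro n
    ext x
    rw [hF, this]
    simp
  -- The difference g − G is `F` on the graph of −g, where B acts through ε.
  have hsub : ∀ w, F (g w, -w) = g w - F (0, w) := fun w => by
    rw [show (g w, -w) = (g w, (0 : W)) - (0, w) by simp, map_sub, hFn]
  refine ⟨F ∘ₗ LinearMap.inr k _ _, fun w a => ?_, fun w b => ?_, fun v hv => ?_⟩
  · rw [LinearMap.comp_apply, LinearMap.comp_apply, ← hFact, hi]
    simp [prodAct]
  · simp only [LinearMap.comp_apply, LinearMap.inr_apply]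
    rw [← hsub, ← hFact, hj, ← map_smul]
    congr 1
    simp [graphAct]
  -- At vectors v where g is equivariant, A also keeps (g v, −v) on the graph and over such vectors.
  -- The whole H-orbit thus stays on the graph, where the functional defining `F` is zero.
  · have : ∀ x v, (∀ a, g (actW v a) = coindAct k H V (g v) (i a)) →
        ∃ w, (∀ a, g (actW w a) = coindAct k H V (g w) (i a)) ∧
          act (g v, -v) x = (g w, -w) := by
      refine hij.induction _ (fun a v hv => ⟨actW v a, fun b => ?_, ?_⟩)
        (fun b v hv => ⟨ε b • v, fun a => ?_, ?_⟩) (fun x y hx hy v hv => ?_)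
        (fun x y hx hy v hv => ?_)
      · rw [← hW.act_mul, hv, hv, map_mul, hN.act_mul]
      · rw [hi]; simp [prodAct, hv]
      · simp [hv]
      · rw [hj]; simp [graphAct]
      · obtain ⟨w, hw, hw'⟩ := hx v hv
        obtain ⟨z, hz, hz'⟩ := hy v hv
        refine ⟨w + z, fun a => ?_, ?_⟩
        · simp [hw, hz]
        · simp [hw', hz', add_comm]
      · obtain ⟨w, hw, hw'⟩ := hx v hv
        rw [hact.act_mul, hw']
        exact hy w hw
    have h0 : F (g v, -v) = 0 := by
      ext x
      obtain ⟨w, -, hw⟩ := this x v hv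
      rw [hF, hw]
      simp
    rw [hsub, sub_eq_zero] at h0
    exact h0.symm

/-- Only the equivariance of G and its agreement with g are kept; B enters through its counit as an
auxiliary augmentation. -/
theorem IsAlgCoprod.isInjectiveAction_left {A B : Type u} [Ring A] [HopfAlgebra k A] [Ring B]
    [HopfAlgebra k B] {i : A →ₐ[k] H} {j : B →ₐ[k] H} (hij : IsAlgCoprod i j) :
    YetterDrinfeld.IsInjectiveAction ((coindAct k H V).compl₂ i.toLinearMap) := by
  intro W _ _ actW hW g
  obtain ⟨G, h1, -, h3⟩ :=
    hij.exists_equivariant_sub_invariant (Bialgebra.counitAlgHom k B) hW g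
  exact ⟨G, h1, h3⟩

/-- Take W = k, the trivial A-module, and g(c) = c n. Then G(1) is A-invariant and n − G(1) is
B-invariant. Dually this reflects A⁺H ∩ B⁺H = 0 for the augmentation ideals A⁺ and B⁺. -/
theorem IsAlgCoprod.exists_invariant_add_invariant {A B : Type u} [Ring A] [HopfAlgebra k A]
    [Ring B] [HopfAlgebra k B] {i : A →ₐ[k] H} {j : B →ₐ[k] H} (hij : IsAlgCoprod i j)
    (n : H →ₗ[k] V) : ∃ p q : H →ₗ[k] V, n = p + q ∧
      (∀ a, coindAct k H V p (i a) = Coalgebra.counit (R := k) a • p) ∧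
      ∀ b, coindAct k H V q (j b) = Coalgebra.counit (R := k) b • q := by
  obtain ⟨G, h1, h2, -⟩ := hij.exists_equivariant_sub_invariant (Bialgebra.counitAlgHom k B)
    (actW := (LinearMap.mul k k).compl₂ Coalgebra.counit)
    (YetterDrinfeld.isRightAction (YetterDrinfeld.trivialModule k A))
    (LinearMap.toSpanSingleton k _ n)
  refine ⟨G 1, n - G 1, by simp, fun a => ?_, fun b => ?_⟩
  · rw [← h1, ← map_smul]
    simp
  · simpa using h2 1 b

end Coinduced

/-! ### Invariants, coinvariants and morphisms from the trivial module -/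

namespace YetterDrinfeld

section Invariants

variable {k H L : Type u} [Field k] [Ring H] [HopfAlgebra k H] [Ring L] [HopfAlgebra k L]
  (f : L →ₐc[k] H)

/-- The elements spanning a trivial Yetter–Drinfeld module over `L`: coinvariant, and `L` acts on
them through the counit. -/
def invariants (M : YetterDrinfeld k H) : Submodule k M.carrier where
  carrier := {x | x ∈ coinvariants M ∧ ∀ a, M.act x (f a) = Coalgebra.counit (R := k) a • x}
  add_mem' hx hy := ⟨add_mem hx.1 hy.1, fun a => by simp [hx.2, hy.2]⟩
  zero_mem' := ⟨zero_mem _, fun a => by simp⟩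
  smul_mem' c x hx := ⟨Submodule.smul_mem _ c hx.1, fun a => by simp [hx.2, smul_comm c]⟩

variable {f} (hf : Function.Injective f) {M M' : YetterDrinfeld k H}

theorem map_mem_coinvariants (φ : M ⟶ M') {x : M.carrier} (hx : x ∈ coinvariants M) :
    φ.lin x ∈ coinvariants M' := by
  rw [mem_coinvariants] at hx ⊢
  rw [← φ.map_coact, hx, LinearMap.rTensor_tmul]

theorem map_mem_invariants (φ : M ⟶ M') {x : M.carrier} (hx : x ∈ invariants f M) :
    φ.lin x ∈ invariants f M' :=
  ⟨map_mem_coinvariants φ hx.1, fun a => by rw [← φ.map_act, hx.2, map_smul]⟩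

theorem isSemiHom_of_mem_invariants {x : M.carrier} (hx : x ∈ invariants f M) :
    IsSemiHom f (trivialModule k L) M (LinearMap.toSpanSingleton k M.carrier x) where
  map_act c a := by
    change k at c
    change (c * Coalgebra.counit (R := k) a) • x = M.act (c • x) (f a)
    rw [map_smul, LinearMap.smul_apply, hx.2, mul_smul]
  map_coact c := by
    change k at c
    change (c • x) ⊗ₜ[k] f 1 = M.coact (c • x)
    rw [map_smul, mem_coinvariants.1 hx.1, map_one, TensorProduct.smul_tmul']

theorem IsSemiHom.mem_invariants {φ : k →ₗ[k] M.carrier}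
    (hφ : IsSemiHom f (trivialModule k L) M φ) : φ 1 ∈ invariants f M := by
  refine ⟨?_, fun a => ?_⟩
  · refine (hφ.map_coact (1 : k)).symm.trans ((TensorProduct.map_tmul _ _ (1 : k) (1 : L)).trans ?_)
    exact congrArg _ (map_one f)
  · refine (hφ.map_act (1 : k) a).symm.trans (Eq.trans ?_ (map_smul φ (Coalgebra.counit a) 1))
    exact congrArg φ (mul_comm (1 : k) _)

/-- The morphism from the trivial module defined by an invariant element. -/
def homOfInvariant {x : M.carrier} (hx : x ∈ invariants f M) :
    trivialModule k L ⟶ (restriction f hf).obj M :=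
  (isSemiHom_of_mem_invariants hx).toRes hf

/-- The value at `1` of a morphism from the trivial module. -/
def evalOne (φ : trivialModule k L ⟶ (restriction f hf).obj M) : M.carrier :=
  (resSubmodule f M).subtype (φ.lin (1 : k))

theorem evalOne_mem (φ : trivialModule k L ⟶ (restriction f hf).obj M) :
    evalOne hf φ ∈ invariants f M := IsSemiHom.mem_invariants (isSemiHom_of_hom hf φ)

theorem evalOne_homOfInvariant {x : M.carrier} (hx : x ∈ invariants f M) :
    evalOne hf (homOfInvariant hf hx) = x := one_smul k x

theorem evalOne_add (φ ψ : trivialModule k L ⟶ (restriction f hf).obj M) :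
    evalOne hf (φ + ψ) = evalOne hf φ + evalOne hf ψ := rfl

theorem evalOne_comp (φ : trivialModule k L ⟶ (restriction f hf).obj M) (g : M ⟶ M') :
    evalOne hf (φ ≫ (restriction f hf).map g) = g.lin (evalOne hf φ) := rfl

theorem hom_ext_one {φ ψ : trivialModule k H ⟶ M} (h : φ.lin (1 : k) = ψ.lin (1 : k)) :
    φ = ψ := by
  refine hom_ext fun (c : k) => ?_
  have h2 : ∀ χ : trivialModule k H ⟶ M, χ.lin c = c • χ.lin (1 : k) :=
    fun χ => (congrArg χ.lin (mul_one c).symm).trans (map_smul χ.lin c (1 : k))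
  rw [h2, h2, h]

theorem hom_ext_evalOne {φ ψ : trivialModule k L ⟶ (restriction f hf).obj M}
    (h : evalOne hf φ = evalOne hf ψ) : φ = ψ :=
  hom_ext_one (Subtype.ext h)

theorem one_mem_invariants :
    ((1 : k) : (trivialModule k H).carrier) ∈ invariants f (trivialModule k H) := by
  refine ⟨rfl, fun a => ?_⟩
  change (1 : k) * Coalgebra.counit (R := k) (f a) = Coalgebra.counit (R := k) a * 1
  rw [one_mul, mul_one, CoalgHomClass.counit_comp_apply]

/-- The identification of the trivial module with the restriction of the trivial module. -/
def trivialToRes : trivialModule k L ⟶ (restriction f hf).obj (trivialModule k H) :=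
  homOfInvariant hf (one_mem_invariants (k := k) (H := H))

theorem evalOne_trivialToRes_comp (g : trivialModule k H ⟶ M) :
    evalOne hf (trivialToRes hf ≫ (restriction f hf).map g) = g.lin (1 : k) := by
  have h : (1 : k) • (1 : k) = 1 := one_smul k 1
  exact congrArg (fun c : k => g.lin c) h

end Invariants

section Coproduct

variable {k A B H : Type u} [Field k] [Ring A] [HopfAlgebra k A] [Ring B] [HopfAlgebra k B]
  [Ring H] [HopfAlgebra k H] {i : A →ₐc[k] H} {j : B →ₐc[k] H}

/-- The elements of H that act on x through ε form a subalgebra, and A and B generate H. -/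
theorem exists_hom_of_mem_invariants (hij : IsAlgCoprod (i : A →ₐ[k] H) (j : B →ₐ[k] H))
    {M : YetterDrinfeld k H} {x : M.carrier} (hi : x ∈ invariants i M) (hj : x ∈ invariants j M) :
    ∃ t : trivialModule k H ⟶ M, t.lin (1 : k) = x := by
  have h : x ∈ invariants (BialgHom.id k H) M := by
    refine ⟨hi.1, hij.induction _ (fun a => ?_) (fun b => ?_) (fun a b ha hb => ?_)
      (fun a b ha hb => ?_)⟩
    · exact (hi.2 a).trans (by rw [← CoalgHomClass.counit_comp_apply i a]; rfl)
    · exact (hj.2 b).trans (by rw [← CoalgHomClass.counit_comp_apply j b]; rfl)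
    · rw [map_add, map_add, ha, hb, map_add, add_smul]
    · rw [BialgHom.id_apply] at ha hb ⊢
      rw [M.act_mul, ha, map_smul, LinearMap.smul_apply, hb, Bialgebra.counit_mul, mul_smul]
  exact ⟨(isSemiHom_of_mem_invariants h).toHom, one_smul k x⟩

section Cofree

variable {N : Type u} [AddCommGroup N] [Module k N] {act : N →ₗ[k] H →ₗ[k] N}

theorem eq_cofreeCounit_tmul_of_mem_coinvariants (h : IsRightAction act) {t : N ⊗[k] H}
    (ht : t ∈ coinvariants (cofree h)) : t = cofreeCounit k H N t ⊗ₜ 1 := by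
  have h1 : cofreeCoact k H N t = t ⊗ₜ 1 := ht
  rw [← LinearMap.rTensor_tmul, ← h1, rTensor_cofreeCounit_coact]

/-- The A-map k → N with value p lifts to the restricted cofree module. The value of the lift at 1
is coinvariant and projects to p, so it is p ⊗ 1. -/
theorem tmul_one_mem_invariants (hi : Function.Injective i) (h : IsRightAction act) {p : N}
    (hp : ∀ a, act p (i a) = Coalgebra.counit (R := k) a • p) :
    p ⊗ₜ[k] (1 : H) ∈ invariants i (cofree h) := by
  obtain ⟨φ, hφ⟩ := (isCofree_resObj_cofree i hi h).exists_hom (trivialModule k A)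
    (LinearMap.toSpanSingleton k N p) (fun c a => by
      change k at c
      change (c * Coalgebra.counit (R := k) a) • p = act (c • p) (i a)
      rw [map_smul, LinearMap.smul_apply, hp, mul_smul])
  have h1 : cofreeCounit k H N (evalOne hi φ) = p := (hφ (1 : k)).trans (one_smul k p)
  have h2 := evalOne_mem hi φ
  have h3 := eq_cofreeCounit_tmul_of_mem_coinvariants h h2.1
  rw [h1] at h3
  rwa [h3] at h2

end Cofree

/-- The coinvariants of N ⊗ H have the form n ⊗ 1, and n splits by
`IsAlgCoprod.exists_invariant_add_invariant`. -/
theorem coinvariants_cofree_le (hij : IsAlgCoprod (i : A →ₐ[k] H) (j : B →ₐ[k] H))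
    (hi : Function.Injective i) (hj : Function.Injective j) (V : Type u) [AddCommGroup V]
    [Module k V] :
    coinvariants (cofree (isRightAction_coindAct (k := k) (H := H) (V := V))) ≤
      invariants i _ ⊔ invariants j _ := by
  intro t ht
  obtain ⟨p, q, hn, hp, hq⟩ :=
    hij.exists_invariant_add_invariant (V := V) (cofreeCounit k H _ t)
  have h1 := eq_cofreeCounit_tmul_of_mem_coinvariants isRightAction_coindAct ht
  rw [hn, add_tmul] at h1
  rw [h1]
  exact Submodule.add_mem_sup (tmul_one_mem_invariants hi isRightAction_coindAct hp)
    (tmul_one_mem_invariants hj isRightAction_coindAct hq)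

/-- The enough-injectives statement for Yetter–Drinfeld modules over a free product, with control
on the restrictions to the factors and on the coinvariants. -/
theorem exists_mono_cofree (hij : IsAlgCoprod (i : A →ₐ[k] H) (j : B →ₐ[k] H))
    (hi : Function.Injective i) (hj : Function.Injective j) (M : YetterDrinfeld k H) :
    ∃ (I : YetterDrinfeld k H) (φ : M ⟶ I), Mono φ ∧ Injective I ∧
      Injective ((restriction i hi).obj I) ∧ Injective ((restriction j hj).obj I) ∧
      coinvariants I ≤ invariants i I ⊔ invariants j I := by
  -- The embedding is induced by the H-map M → Hom(H, M), x ↦ (b ↦ x · b). Evaluation at 1 recovers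
  -- x.
  obtain ⟨φ, hφ⟩ := (isCofree_cofree
    (isRightAction_coindAct (k := k) (H := H) (V := M.carrier))).exists_hom M M.act fun x a =>
      LinearMap.ext fun b => (M.act_mul x a b).symm
  refine ⟨_, φ, mono_of_injective _ fun x y hxy => ?_, (isCofree_cofree _).injective
    isInjectiveAction_coindAct, (isCofree_resObj_cofree i hi _).injective
    hij.isInjectiveAction_left, (isCofree_resObj_cofree j hj _).injective
    hij.symm.isInjectiveAction_left, coinvariants_cofree_le hij hi hj _⟩
  rw [← M.act_one x, ← M.act_one y, ← hφ, ← hφ, hxy]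

/-- Average any preimage with the invariant functional. -/
theorem exists_coinvariant_lift {l : H →ₗ[k] k} (h1 : l 1 = 1)
    (hl : ∀ x, TensorProduct.rid k H (l.lTensor H (Coalgebra.comul x)) = l x • 1)
    {M N : YetterDrinfeld k H} (p : M ⟶ N) [Epi p] {c : N.carrier} (hc : c ∈ coinvariants N) :
    ∃ d ∈ coinvariants M, p.lin d = c := by
  obtain ⟨m, rfl⟩ := surjective_of_epi p c
  exact ⟨average l M m, average_mem_coinvariants l hl M m, by
    rw [average_map, average_of_mem_coinvariants l h1 hc]⟩

theorem coinvariants_le_of_epi {l : H →ₗ[k] k} (h1 : l 1 = 1)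
    (hl : ∀ x, TensorProduct.rid k H (l.lTensor H (Coalgebra.comul x)) = l x • 1)
    {M N : YetterDrinfeld k H} (p : M ⟶ N) [Epi p]
    (hM : coinvariants M ≤ invariants i M ⊔ invariants j M) :
    coinvariants N ≤ invariants i N ⊔ invariants j N := by
  intro c hc
  obtain ⟨d, hd, rfl⟩ := exists_coinvariant_lift h1 hl p hc
  obtain ⟨x, hx, y, hy, rfl⟩ := Submodule.mem_sup.1 (hM hd)
  rw [map_add]
  exact Submodule.add_mem_sup (map_mem_invariants p hx) (map_mem_invariants p hy)

variable (hi : Function.Injective i)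
  (hj : Function.Injective j)

/-- The two lifts of t(1), one A-invariant and one B-invariant, differ by a coinvariant of X₁.
Writing it as a + b and moving a and b to the two sides produces one lift that is invariant for both
factors. -/
theorem exists_lift_trivialModule (hij : IsAlgCoprod (i : A →ₐ[k] H) (j : B →ₐ[k] H))
    {S : ShortComplex (YetterDrinfeld k H)} (hS : S.ShortExact)
    (h₁ : coinvariants S.X₁ ≤ invariants i S.X₁ ⊔ invariants j S.X₁)
    (t : trivialModule k H ⟶ S.X₃)
    (f : trivialModule k A ⟶ (restriction i hi).obj S.X₂)
    (g : trivialModule k B ⟶ (restriction j hj).obj S.X₂)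
    (hf : f ≫ (restriction i hi).map S.g = trivialToRes hi ≫ (restriction i hi).map t)
    (hg : g ≫ (restriction j hj).map S.g = trivialToRes hj ≫ (restriction j hj).map t) :
    ∃ s : trivialModule k H ⟶ S.X₂, s ≫ S.g = t := by
  have hf' : S.g.lin (evalOne hi f) = t.lin (1 : k) := by
    rw [← evalOne_comp, hf, evalOne_trivialToRes_comp]
  have hg' : S.g.lin (evalOne hj g) = t.lin (1 : k) := by
    rw [← evalOne_comp, hg, evalOne_trivialToRes_comp]
  have := hS.mono_f
  obtain ⟨q, hq⟩ := ker_le_range_of_shortExact hS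
    (show evalOne hi f - evalOne hj g ∈ _ by rw [LinearMap.mem_ker, map_sub, hf', hg', sub_self])
  have hqc : q ∈ coinvariants S.X₁ := by
    have h2 : S.f.lin q ∈ coinvariants S.X₂ :=
      hq ▸ sub_mem (evalOne_mem hi f).1 (evalOne_mem hj g).1
    rw [mem_coinvariants, ← S.f.map_coact] at h2
    exact Module.Flat.rTensor_preserves_injective_linearMap S.f.lin (injective_of_mono S.f)
      (h2.trans (LinearMap.rTensor_tmul _ _ _ _).symm)
  obtain ⟨a, ha, b, hb, rfl⟩ := Submodule.mem_sup.1 (h₁ hqc)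
  have hab : evalOne hi f - S.f.lin a = evalOne hj g + S.f.lin b := by
    rw [map_add] at hq
    rw [sub_eq_iff_eq_add, add_assoc, add_comm (S.f.lin b), hq]
    abel
  obtain ⟨s, hs⟩ := exists_hom_of_mem_invariants hij
    (sub_mem (evalOne_mem hi f) (map_mem_invariants S.f ha))
    (hab ▸ add_mem (evalOne_mem hj g) (map_mem_invariants S.f hb))
  refine ⟨s, hom_ext_one ?_⟩
  have h0 : S.g.lin (S.f.lin a) = 0 := LinearMap.congr_fun (congrArg Hom.lin S.zero) a
  refine (congrArg S.g.lin hs).trans ?_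
  rw [map_sub, hf', h0, sub_zero]

/-- The difference a(1) − b(1) lifts to a coinvariant x + y of M, with x invariant for A and y for
B. Then a(1) − p(x) = b(1) + p(y) is invariant for both factors and defines t. -/
theorem exists_decomposition_trivialModule
    (hij : IsAlgCoprod (i : A →ₐ[k] H) (j : B →ₐ[k] H)) {l : H →ₗ[k] k} (h1 : l 1 = 1)
    (hl : ∀ x, TensorProduct.rid k H (l.lTensor H (Coalgebra.comul x)) = l x • 1)
    {M N : YetterDrinfeld k H} (p : M ⟶ N) [Epi p]
    (hM : coinvariants M ≤ invariants i M ⊔ invariants j M)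
    (a : trivialModule k A ⟶ (restriction i hi).obj N)
    (b : trivialModule k B ⟶ (restriction j hj).obj N) :
    ∃ (t : trivialModule k H ⟶ N) (f : trivialModule k A ⟶ (restriction i hi).obj M)
      (g : trivialModule k B ⟶ (restriction j hj).obj M),
      a = trivialToRes hi ≫ (restriction i hi).map t + f ≫ (restriction i hi).map p ∧
      b = trivialToRes hj ≫ (restriction j hj).map t + g ≫ (restriction j hj).map p := by
  have ha := evalOne_mem hi a
  have hb := evalOne_mem hj b
  obtain ⟨c, hc, hcp⟩ := exists_coinvariant_lift h1 hl p (sub_mem ha.1 hb.1)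
  obtain ⟨x, hx, y, hy, rfl⟩ := Submodule.mem_sup.1 (hM hc)
  have hab : evalOne hi a - p.lin x = evalOne hj b + p.lin y := by
    rw [map_add] at hcp
    rw [sub_eq_iff_eq_add, add_assoc, add_comm (p.lin y), hcp]
    abel
  obtain ⟨t, ht⟩ := exists_hom_of_mem_invariants hij (sub_mem ha (map_mem_invariants p hx))
    (hab ▸ add_mem hb (map_mem_invariants p hy))
  refine ⟨t, homOfInvariant hi hx, homOfInvariant hj (neg_mem hy), hom_ext_evalOne hi ?_,
    hom_ext_evalOne hj ?_⟩
  · rw [evalOne_add, evalOne_trivialToRes_comp, evalOne_comp, evalOne_homOfInvariant, ht]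
    abel
  · rw [evalOne_add, evalOne_trivialToRes_comp, evalOne_comp, evalOne_homOfInvariant, ht, hab,
      map_neg]
    abel

end Coproduct

end YetterDrinfeld

/-! ### Dimension shifting and exact functors -/

namespace CategoryTheory.Abelian.Ext

section DimensionShift

variable {C : Type*} [Category* C] [Abelian C] [HasExt.{u} C]

theorem exists_comp_extClass {S : ShortComplex C} (hS : S.ShortExact) [Injective S.X₂] (T : C)
    {n : ℕ} (x : Ext T S.X₁ (n + 1)) : ∃ y : Ext T S.X₃ n, y.comp hS.extClass rfl = x :=
  covariant_sequence_exact₁ T hS x (eq_zero_of_injective _) rfl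

theorem eq_zero_of_comp_extClass {S : ShortComplex C} (hS : S.ShortExact) [Injective S.X₂] {T : C}
    {n : ℕ} (x : Ext T S.X₃ (n + 1)) (hx : x.comp hS.extClass rfl = 0) : x = 0 := by
  obtain ⟨y, rfl⟩ := covariant_sequence_exact₃ T hS x rfl hx
  rw [eq_zero_of_injective y, zero_comp]

theorem exists_hom_comp_extClass {S : ShortComplex C} (hS : S.ShortExact) [Injective S.X₂] {T : C}
    (x : Ext T S.X₁ 1) : ∃ t : T ⟶ S.X₃, (mk₀ t).comp hS.extClass (zero_add 1) = x := by
  obtain ⟨y, rfl⟩ := exists_comp_extClass hS T x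
  obtain ⟨t, rfl⟩ := (mk₀_bijective _ _).2 y
  exact ⟨t, rfl⟩

theorem mk₀_comp_extClass_eq_zero_iff {S : ShortComplex C} (hS : S.ShortExact) {T : C}
    (t : T ⟶ S.X₃) :
    (mk₀ t).comp hS.extClass (zero_add 1) = 0 ↔ ∃ s : T ⟶ S.X₂, s ≫ S.g = t := by
  constructor
  · intro h
    obtain ⟨y, hy⟩ := covariant_sequence_exact₃ T hS (mk₀ t) (zero_add 1) h
    obtain ⟨s, rfl⟩ := (mk₀_bijective _ _).2 y
    refine ⟨s, (mk₀_bijective _ _).1 ?_⟩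
    rw [← hy, mk₀_comp_mk₀]
  · rintro ⟨s, rfl⟩
    rw [← mk₀_comp_mk₀, comp_assoc_of_second_deg_zero, hS.comp_extClass, comp_zero]

theorem mk₀_add_comp_comp_extClass {S : ShortComplex C} (hS : S.ShortExact) {T : C}
    (t : T ⟶ S.X₃) (s : T ⟶ S.X₂) :
    (mk₀ (t + s ≫ S.g)).comp hS.extClass (zero_add 1) =
      (mk₀ t).comp hS.extClass (zero_add 1) := by
  rw [mk₀_add, add_comp, (mk₀_comp_extClass_eq_zero_iff hS (s ≫ S.g)).2 ⟨s, rfl⟩, add_zero]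

end DimensionShift

section Pull

variable {C D : Type*} [Category* C] [Category* D] [Abelian C] [Abelian D] [HasExt.{u} C]
  [HasExt.{u} D] (k : Type*) [CommRing k] [Linear k C] [Linear k D] (F : C ⥤ D) [F.Additive]
  [F.Linear k] [PreservesFiniteLimits F] [PreservesFiniteColimits F] {T : C} {T' : D}
  (v : T' ⟶ F.obj T)

/-- The map induced on `Ext` by an exact functor `F` and a morphism `T' ⟶ F.obj T`. -/
def mapAlong (M : C) (n : ℕ) : Ext T M n →ₗ[k] Ext T' (F.obj M) n :=
  (mk₀ v).precompOfLinear k (F.obj M) (zero_add n) ∘ₗ F.mapExtLinearMap k T M n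

theorem mapAlong_apply {M : C} {n : ℕ} (x : Ext T M n) :
    mapAlong k F v M n x = (mk₀ v).comp (x.mapExactFunctor F) (zero_add n) := rfl

theorem mapAlong_comp {M N : C} {n m p : ℕ} (x : Ext T M n) (y : Ext M N m) (h : n + m = p) :
    mapAlong k F v N p (x.comp y h) = (mapAlong k F v M n x).comp (y.mapExactFunctor F) h := by
  rw [mapAlong_apply, mapAlong_apply, mapExactFunctor_comp,
    comp_assoc _ _ _ (zero_add n) h (by omega)]

theorem mapAlong_comp_extClass {S : ShortComplex C} (hS : S.ShortExact) {n m : ℕ}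
    (x : Ext T S.X₃ n) (h : n + 1 = m) :
    mapAlong k F v S.X₁ m (x.comp hS.extClass h) =
      (mapAlong k F v S.X₃ n x).comp (hS.map_of_exact F).extClass h := by
  rw [mapAlong_comp, mapExactFunctor_extClass]
  rfl

theorem mapAlong_mk₀ {M : C} (t : T ⟶ M) :
    mapAlong k F v M 0 (mk₀ t) = mk₀ (v ≫ F.map t) := by
  rw [mapAlong_apply, mapExactFunctor_mk₀, mk₀_comp_mk₀]

theorem mapAlong_comp_mk₀ {M N : C} {n : ℕ} (f : M ⟶ N) (x : Ext T M n) :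
    mapAlong k F v N n (x.comp (mk₀ f) (add_zero n)) =
      (mapAlong k F v M n x).comp (mk₀ (F.map f)) (add_zero n) := by
  rw [mapAlong_comp, mapExactFunctor_mk₀]

end Pull

section Pair

variable {C D E : Type*} [Category* C] [Category* D] [Category* E] [Abelian C] [Abelian D]
  [Abelian E] [HasExt.{u} C] [HasExt.{u} D] [HasExt.{u} E] (k : Type*) [CommRing k] [Linear k C]
  [Linear k D] [Linear k E]
  (F : C ⥤ D) [F.Additive] [F.Linear k] [PreservesFiniteLimits F] [PreservesFiniteColimits F]
  (G : C ⥤ E) [G.Additive] [G.Linear k] [PreservesFiniteLimits G] [PreservesFiniteColimits G]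
  {T : C} {T' : D} {T'' : E} (v : T' ⟶ F.obj T) (w : T'' ⟶ G.obj T)

/-- The pair of maps induced on `Ext` by two exact functors. -/
def mapAlongPair (M : C) (n : ℕ) : Ext T M n →ₗ[k] Ext T' (F.obj M) n × Ext T'' (G.obj M) n :=
  (mapAlong k F v M n).prod (mapAlong k G w M n)

variable {S : ShortComplex C} [Injective S.X₂] [Injective (F.obj S.X₂)]
  [Injective (G.obj S.X₂)]

/-- All three middle terms are injective, so the connecting maps from degree n + 1 to degree n + 2
are bijective, and they commute with the comparison. -/
theorem mapAlongPair_bijective_succ (hS : S.ShortExact) {n : ℕ}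
    (h : Function.Bijective (mapAlongPair k F G v w S.X₃ (n + 1))) :
    Function.Bijective (mapAlongPair k F G v w S.X₁ (n + 2)) := by
  have : Injective (S.map F).X₂ := inferInstanceAs (Injective (F.obj S.X₂))
  have : Injective (S.map G).X₂ := inferInstanceAs (Injective (G.obj S.X₂))
  constructor
  · refine (injective_iff_map_eq_zero _).2 fun x hx => ?_
    obtain ⟨y, rfl⟩ := exists_comp_extClass hS T x
    have h1 := congrArg (fun z => z.1) hx
    have h2 := congrArg (fun z => z.2) hx
    replace h1 := (mapAlong_comp_extClass k F v hS y rfl).symm.trans h1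
    replace h2 := (mapAlong_comp_extClass k G w hS y rfl).symm.trans h2
    have h3 : y = 0 := (injective_iff_map_eq_zero _).1 h.1 y
      (Prod.ext (eq_zero_of_comp_extClass _ _ h1) (eq_zero_of_comp_extClass _ _ h2))
    rw [h3, zero_comp]
  · rintro ⟨x₁, x₂⟩
    obtain ⟨y₁, rfl⟩ := exists_comp_extClass (hS.map_of_exact F) T' x₁
    obtain ⟨y₂, rfl⟩ := exists_comp_extClass (hS.map_of_exact G) T'' x₂
    obtain ⟨y, hy⟩ := h.2 (y₁, y₂)
    have h1 : mapAlong k F v _ _ y = y₁ := congrArg (fun z => z.1) hy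
    have h2 : mapAlong k G w _ _ y = y₂ := congrArg (fun z => z.2) hy
    refine ⟨y.comp hS.extClass rfl, Prod.ext ?_ ?_⟩
    · exact (mapAlong_comp_extClass k F v hS y rfl).trans (by rw [h1]; rfl)
    · exact (mapAlong_comp_extClass k G w hS y rfl).trans (by rw [h2]; rfl)

/-- Here Ext¹(T, X₁) is the cokernel of Hom(T, X₂) → Hom(T, X₃), and likewise after applying the
functors. `hlift` and `hdec` express injectivity and surjectivity between these cokernels. -/
theorem mapAlongPair_bijective_one (hS : S.ShortExact)
    (hlift : ∀ (t : T ⟶ S.X₃) (f : T' ⟶ F.obj S.X₂) (g : T'' ⟶ G.obj S.X₂),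
      f ≫ F.map S.g = v ≫ F.map t → g ≫ G.map S.g = w ≫ G.map t → ∃ s : T ⟶ S.X₂, s ≫ S.g = t)
    (hdec : ∀ (a : T' ⟶ F.obj S.X₃) (b : T'' ⟶ G.obj S.X₃), ∃ (t : T ⟶ S.X₃)
      (f : T' ⟶ F.obj S.X₂) (g : T'' ⟶ G.obj S.X₂), a = v ≫ F.map t + f ≫ F.map S.g ∧
        b = w ≫ G.map t + g ≫ G.map S.g) :
    Function.Bijective (mapAlongPair k F G v w S.X₁ 1) := by
  have : Injective (S.map F).X₂ := inferInstanceAs (Injective (F.obj S.X₂))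
  have : Injective (S.map G).X₂ := inferInstanceAs (Injective (G.obj S.X₂))
  constructor
  · refine (injective_iff_map_eq_zero _).2 fun x hx => ?_
    obtain ⟨t, rfl⟩ := exists_hom_comp_extClass hS x
    have h1 := congrArg (fun z => z.1) hx
    have h2 := congrArg (fun z => z.2) hx
    replace h1 := (mapAlong_comp_extClass k F v hS (mk₀ t) (zero_add 1)).symm.trans h1
    replace h2 := (mapAlong_comp_extClass k G w hS (mk₀ t) (zero_add 1)).symm.trans h2
    rw [mapAlong_mk₀] at h1 h2
    obtain ⟨f, hf⟩ := (mk₀_comp_extClass_eq_zero_iff (hS.map_of_exact F) _).1 h1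
    obtain ⟨g, hg⟩ := (mk₀_comp_extClass_eq_zero_iff (hS.map_of_exact G) _).1 h2
    exact (mk₀_comp_extClass_eq_zero_iff hS t).2 (hlift t f g hf hg)
  · rintro ⟨x₁, x₂⟩
    obtain ⟨a, rfl⟩ := exists_hom_comp_extClass (hS.map_of_exact F) x₁
    obtain ⟨b, rfl⟩ := exists_hom_comp_extClass (hS.map_of_exact G) x₂
    obtain ⟨t, f, g, rfl, rfl⟩ := hdec a b
    refine ⟨(mk₀ t).comp hS.extClass (zero_add 1), Prod.ext ?_ ?_⟩
    · refine (mapAlong_comp_extClass k F v hS (mk₀ t) (zero_add 1)).trans ?_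
      rw [mapAlong_mk₀]
      exact (mk₀_add_comp_comp_extClass (hS.map_of_exact F) _ f).symm
    · refine (mapAlong_comp_extClass k G w hS (mk₀ t) (zero_add 1)).trans ?_
      rw [mapAlong_mk₀]
      exact (mk₀_add_comp_comp_extClass (hS.map_of_exact G) _ g).symm

end Pair

end CategoryTheory.Abelian.Ext

/-! ### Bijectivity of the comparison map from degree 2 on -/

namespace YetterDrinfeld

section Coproduct

variable {k A B H : Type u} [Field k] [Ring A] [HopfAlgebra k A] [Ring B] [HopfAlgebra k B]
  [Ring H] [HopfAlgebra k H] {i : A →ₐc[k] H} {j : B →ₐc[k] H}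

theorem shortExact_quotComplex {M I : YetterDrinfeld k H} (φ : M ⟶ I) [Mono φ] :
    (quotComplex φ).ShortExact :=
  shortExact_of_lin _ (injective_of_mono φ) (Submodule.mkQ_surjective _)
    (Submodule.ker_mkQ _).le

theorem exists_preservesFinite_restriction (hij : IsAlgCoprod (i : A →ₐ[k] H) (j : B →ₐ[k] H))
    (hA : IsCosemisimple k A) (hB : IsCosemisimple k B) (hi : Function.Injective i) :
    PreservesFiniteLimits (restriction i hi) ∧ PreservesFiniteColimits (restriction i hi) := by
  obtain ⟨⟨l, h1, h2⟩, -⟩ := exists_retracting_functional hij hA hB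
  exact preservesFiniteLimits_restriction i hi (restriction_map_shortExact i hi h1 h2)

theorem mapAlongPair_bijective (hij : IsAlgCoprod (i : A →ₐ[k] H) (j : B →ₐ[k] H))
    (hA : IsCosemisimple k A) (hB : IsCosemisimple k B) (hi : Function.Injective i)
    (hj : Function.Injective j) [PreservesFiniteLimits (restriction i hi)]
    [PreservesFiniteColimits (restriction i hi)] [PreservesFiniteLimits (restriction j hj)]
    [PreservesFiniteColimits (restriction j hj)] (n : ℕ) (M : YetterDrinfeld k H) :
    Function.Bijective (Abelian.Ext.mapAlongPair k (restriction i hi) (restriction j hj)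
      (trivialToRes hi) (trivialToRes hj) M (n + 2)) := by
  obtain ⟨-, l, h1, hl⟩ := exists_retracting_functional hij hA hB
  have step : ∀ {M I : YetterDrinfeld k H} (φ : M ⟶ I), Mono φ → Injective I →
      Injective ((restriction i hi).obj I) → Injective ((restriction j hj).obj I) → ∀ n : ℕ,
      Function.Bijective (Abelian.Ext.mapAlongPair k (restriction i hi) (restriction j hj)
        (trivialToRes hi) (trivialToRes hj) (quotComplex φ).X₃ (n + 1)) →
      Function.Bijective (Abelian.Ext.mapAlongPair k (restriction i hi) (restriction j hj)
        (trivialToRes hi) (trivialToRes hj) M (n + 2)) := fun {M I} φ _ h1 h2 h3 n h =>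
    have : Injective (quotComplex φ).X₂ := h1
    have : Injective ((restriction i hi).obj (quotComplex φ).X₂) := h2
    have : Injective ((restriction j hj).obj (quotComplex φ).X₂) := h3
    Abelian.Ext.mapAlongPair_bijective_succ k (restriction i hi) (restriction j hj)
      (trivialToRes hi) (trivialToRes hj) (S := quotComplex φ) (shortExact_quotComplex φ) h
  induction n generalizing M with
  | zero =>
    obtain ⟨I, φ, _, hI₁, hI₂, hI₃, hI⟩ := exists_mono_cofree hij hi hj M
    obtain ⟨J, ψ, _, hJ₁, hJ₂, hJ₃, hJ⟩ := exists_mono_cofree hij hi hj (quotComplex φ).X₃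
    have hφ := shortExact_quotComplex φ
    have hψ := shortExact_quotComplex ψ
    have := hφ.epi_g
    have := hψ.epi_g
    -- M itself need not satisfy the condition on coinvariants, but this quotient of the cofree
    -- module I does. Degree 1 therefore holds for the quotient, and one shift gives degree 2 for M.
    have hQ := coinvariants_le_of_epi h1 hl (quotComplex φ).g hI
    have : Injective (quotComplex ψ).X₂ := hJ₁
    have : Injective ((restriction i hi).obj (quotComplex ψ).X₂) := hJ₂
    have : Injective ((restriction j hj).obj (quotComplex ψ).X₂) := hJ₃
    exact step φ ‹_› hI₁ hI₂ hI₃ 0 (Abelian.Ext.mapAlongPair_bijective_one k (restriction i hi)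
      (restriction j hj) (trivialToRes hi) (trivialToRes hj) (S := quotComplex ψ) hψ
      (exists_lift_trivialModule hi hj hij hψ hQ)
      (exists_decomposition_trivialModule hi hj hij h1 hl (quotComplex ψ).g hJ))
  | succ n ih =>
    obtain ⟨I, φ, _, hI₁, hI₂, hI₃, -⟩ := exists_mono_cofree hij hi hj M
    exact step φ ‹_› hI₁ hI₂ hI₃ (n + 1) (ih _)

end Coproduct

end YetterDrinfeld

end

theorem theorem5 {k : Type u} [Field k] [IsAlgClosed k] [CharZero k]
    {A B : Type u} [Ring A] [Ring B] [HopfAlgebra k A] [HopfAlgebra k B]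
    (hA : IsCosemisimple k A) (hB : IsCosemisimple k B) (n : ℕ) (hn : 2 ≤ n) :
    ∃ e : ∀ M : YetterDrinfeld k (FreeProd k A B),
        HGS n M ≃ₗ[k] HGS n ((resLeft k A B).obj M) × HGS n ((resRight k A B).obj M),
      ∀ (M N : YetterDrinfeld k (FreeProd k A B)) (f : M ⟶ N) (x : HGS n M),
        e N (HGS.map n f x) =
          (HGS.map n ((resLeft k A B).map f) (e M x).1,
            HGS.map n ((resRight k A B).map f) (e M x).2) := by
  obtain ⟨n, rfl⟩ := Nat.exists_eq_add_of_le' hn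
  have hij : IsAlgCoprod (FreeProd.inlBialg k A B : A →ₐ[k] FreeProd k A B)
    (FreeProd.inrBialg k A B : B →ₐ[k] FreeProd k A B) := FreeProd.isAlgCoprod k A B
  obtain ⟨_, _⟩ := YetterDrinfeld.exists_preservesFinite_restriction hij hA hB
    (FreeProd.inlBialg_injective k A B)
  obtain ⟨_, _⟩ := YetterDrinfeld.exists_preservesFinite_restriction hij.symm hB hA
    (FreeProd.inrBialg_injective k A B)
  refine ⟨fun M => LinearEquiv.ofBijective _ (YetterDrinfeld.mapAlongPair_bijective hij hA hB
    (FreeProd.inlBialg_injective k A B) (FreeProd.inrBialg_injective k A B) n M),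
    fun M N f x => _root_.Prod.ext ?_ ?_⟩
  -- Naturality holds because exact functors respect the product with a class of degree 0.
  · exact Abelian.Ext.mapAlong_comp_mk₀ k (resLeft k A B)
      (YetterDrinfeld.trivialToRes (FreeProd.inlBialg_injective k A B)) f x
  · exact Abelian.Ext.mapAlong_comp_mk₀ k (resRight k A B)
      (YetterDrinfeld.trivialToRes (FreeProd.inrBialg_injective k A B)) f x
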